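/- Let $k$ be an algebraically closed field. Let $\mathcal C$ be a $k$-linear category with finitely many objects and finite-dimensional morphism spaces, directed with respect to a partial order $\leqslant$ on its objects: $\mathcal C(x,y)\neq 0$ only if $x\leqslant y$. We identify $\mathcal C$ with its associated algebra $\bigoplus_{x,y}\mathcal C(x,y)$ and $\mathcal C$-modules with left modules over it. Suppose that $\mathcal C=\bigoplus_{i\geqslant 0}\mathcal C_i$ is graded with $\mathcal C_i=\bigoplus_{x,y}\mathcal C(x,y)_i$, $\mathcal C_i\cdot\mathcal C_j=\mathcal C_{i+j}$ for all $i,j\geqslant 0$, and $\mathcal C_0=\bigoplus_x\mathcal C(x,x)$, and that the algebra $\mathcal C_0$ is self-injective, i.e. every projective $\mathcal C_0$-module is injective. Let $\mathcal D$ be the graded subcategory of $\mathcal C$ with the same objects, $\mathcal D(x,y)=\mathcal C(x,y)$ for $x\neq y$, and $\mathcal D(x,x)=k\cdot 1_x$. Graded modules are $\mathbb Z$-graded and locally finite (each homogeneous component is finite-dimensional over $k$). For a graded algebra $A=\bigoplus_{i\geqslant 0}A_i$, a graded $A$-module $M$ is generated in degree $s$ if $M=A\cdot M_s$. A graded $A$-module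 $M$ generated in degree $0$ is Koszul if it has a graded projective resolution $\cdots\to P^1\to P^0\to M\to 0$ with $P^i$ generated in degree $i$ for all $i\geqslant 0$. The graded algebra (or category) $A$ is Koszul if $A_0$, viewed as the $A$-module $A/\bigoplus_{i\geqslant 1}A_i$, is Koszul; it is Koszul in the classical sense if moreover $A_0$ is semisimple. For each object $x$ choose a complete set $E_x$ of orthogonal primitive idempotents of $\mathcal C(x,x)$, and put $E=\bigsqcup_x E_x=\{e_\lambda\}_{\lambda\in\Lambda}$, with the pre-order $\lambda\preccurlyeq\mu$ if and only if $x\leqslant y$, where $e_\lambda\in E_x$ and $e_\mu\in E_y$. Put $P_\lambda=\mathcal C e_\lambda$ and $\Delta_\lambda=P_\lambda/\sum_{\mu\not\preccurlyeq\lambda}\operatorname{tr}_{P_\mu}(P_\lambda)$, where $\operatorname{tr}_{P_\mu}(P_\lambda)$ is the sum of the images of all homomorphisms $P_\mu\to P_\lambda$. The category $\mathcal C$ is standardly stratified if every $P_\lambda$ has a finite filtration whose factors are isomorphic to modules $\Delta_\mu$; this does not depend on the choice of the sets $E_x$. Then: 1. $\mathcal C$ is Koszul if and only if $\mathcal C$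 is standardly stratified and $\mathcal D$ is Koszul in the classical sense. 2. If $\mathcal C$ is Koszul, then a graded $\mathcal C$-module $M$ generated in degree $0$ is Koszul if and only if $M$ is projective as a $\mathcal C_0$-module and its restriction $M\downarrow^{\mathcal C}_{\mathcal D}$ is a Koszul $\mathcal D$-module. -/

import Mathlib

set_option linter.unusedSectionVars false
set_option linter.unusedVariables false

open CategoryTheory

universe u v w z

noncomputable section

/-! ## Graded modules over a graded algebra -/

section GradedModules

variable {k : Type u} [Field k] {A : Type v} [Ring A] [Algebra k A]

/-- A `ℤ`-graded left module `M = ⨁ M_j` over the algebra `A` with the `ℕ`-grading `𝒜`: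
each `M_j` is a `k`-subspace and `A_i · M_j ⊆ M_{i+j}`. -/
structure GrModule (𝒜 : ℕ → Submodule k A) where
  carrier : Type w
  [addCommGroup : AddCommGroup carrier]
  [moduleField : Module k carrier]
  [module : Module A carrier]
  [isScalarTower : IsScalarTower k A carrier]
  gr : ℤ → Submodule k carrier
  isInternal : DirectSum.IsInternal gr
  smul_mem : ∀ (i : ℕ) (j : ℤ) (a : A) (m : carrier),
    a ∈ 𝒜 i → m ∈ gr j → a • m ∈ gr (i + j)

attribute [instance] GrModule.addCommGroup GrModule.moduleField GrModule.module
  GrModule.isScalarTower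

namespace GrModule

variable {𝒜 : ℕ → Submodule k A}

/-- Every homogeneous component is finite-dimensional. -/
def LocallyFinite (M : GrModule.{u, v, w} 𝒜) : Prop :=
  ∀ j : ℤ, Module.Finite k (M.gr j)

/-- `M = A · M_s`. -/
def GeneratedInDegree (M : GrModule.{u, v, w} 𝒜) (s : ℤ) : Prop :=
  Submodule.span A (M.gr s : Set M.carrier) = ⊤

/-- Homogeneous `A`-linear maps of degree zero. -/
def IsGradedHom (M : GrModule.{u, v, w} 𝒜) (N : GrModule.{u, v, z} 𝒜)
    (f : M.carrier →ₗ[A] N.carrier) : Prop :=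
  ∀ (j : ℤ) (m : M.carrier), m ∈ M.gr j → f m ∈ N.gr j

/-- A graded module `M` generated in degree `0` is Koszul if it has a graded projective resolution
`⋯ → P 1 → P 0 → M → 0` in which `P i` is generated in degree `i`.  As for all graded modules
under consideration, the `P i` are locally finite. -/
def IsKoszul (M : GrModule.{u, v, w} 𝒜) : Prop :=
  M.GeneratedInDegree 0 ∧
  ∃ (P : ℕ → GrModule.{u, v, max v w} 𝒜)
    (d : ∀ i : ℕ, (P (i + 1)).carrier →ₗ[A] (P i).carrier)
    (ε : (P 0).carrier →ₗ[A] M.carrier),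
    (∀ i, Module.Projective A (P i).carrier) ∧
    (∀ i, (P i).LocallyFinite) ∧
    (∀ i, (P i).GeneratedInDegree (i : ℤ)) ∧
    (∀ i, IsGradedHom (P (i + 1)) (P i) (d i)) ∧
    IsGradedHom (P 0) M ε ∧
    Function.Surjective ε ∧
    Function.Exact (d 0) ε ∧
    (∀ i, Function.Exact (d (i + 1)) (d i))

end GrModule

variable (𝒜 : ℕ → Submodule k A) [GradedAlgebra 𝒜]

/-- The ring `A_0`. -/
abbrev DegreeZeroRing : Subring A := SetLike.GradeZero.subring 𝒜

/-- `M` is projective as an `A_0`-module. -/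
def GrModule.IsProjectiveOverDegreeZero {𝒜 : ℕ → Submodule k A} [GradedAlgebra 𝒜]
    (M : GrModule.{u, v, w} 𝒜) : Prop :=
  Module.Projective (DegreeZeroRing 𝒜) M.carrier

/-- `A_0` as an `A`-module, through the ring homomorphism `A → A_0` that kills `A_i`, `i ≥ 1`. -/
def DegreeZeroCarrier : Type v := 𝒜 0

instance : AddCommGroup (DegreeZeroCarrier 𝒜) := inferInstanceAs (AddCommGroup (𝒜 0))

instance : Module k (DegreeZeroCarrier 𝒜) := inferInstanceAs (Module k (𝒜 0))

instance : Module A (DegreeZeroCarrier 𝒜) :=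
  Module.compHom (𝒜 0) (GradedRing.projZeroRingHom' 𝒜)

theorem degreeZeroCarrier_coe_smul (a : A) (m : 𝒜 0) :
    ((show 𝒜 0 from (a • (show DegreeZeroCarrier 𝒜 from m))) : A)
      = (DirectSum.decompose 𝒜 a 0 : A) * (m : A) := rfl

instance : IsScalarTower k A (DegreeZeroCarrier 𝒜) where
  smul_assoc c a m := by
    apply Subtype.ext
    refine (degreeZeroCarrier_coe_smul 𝒜 (c • a) m).trans ?_
    refine Eq.trans ?_ (congrArg (fun t => c • t) (degreeZeroCarrier_coe_smul 𝒜 a m).symm)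
    rw [DirectSum.decompose_smul, DirectSum.smul_apply, Submodule.coe_smul, smul_mul_assoc]

/-- The graded `A`-module `A_0`, concentrated in degree `0`. -/
def degreeZeroModule : GrModule.{u, v, v} 𝒜 where
  carrier := DegreeZeroCarrier 𝒜
  gr j := if j = 0 then ⊤ else ⊥
  isInternal := by
    classical
    rw [DirectSum.isInternal_submodule_iff_iSupIndep_and_iSup_eq_top]
    refine ⟨?_, ?_⟩
    · intro i
      by_cases hi : i = 0
      · subst hi
        have : (⨆ j : ℤ, ⨆ _ : j ≠ 0,
            (if j = 0 then (⊤ : Submodule k (DegreeZeroCarrier 𝒜)) else ⊥)) = ⊥ := by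
          simp only [iSup_eq_bot]
          intro j hj
          simp [hj]
        rw [this]
        exact disjoint_bot_right
      · simp [hi]
    · exact top_unique (le_iSup_of_le (0 : ℤ) (by simp))
  smul_mem i j a m ha hm := by
    by_cases hj : j = 0
    · subst hj
      by_cases hi : i = 0
      · subst hi
        simp
      · have h0 : a • m = 0 := by
          apply Subtype.ext
          refine (degreeZeroCarrier_coe_smul 𝒜 a m).trans ?_
          rw [DirectSum.decompose_of_mem_ne 𝒜 ha hi, zero_mul]
          rfl
        rw [h0]
        exact Submodule.zero_mem _
    · rw [if_neg hj, Submodule.mem_bot] at hm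
      rw [hm, smul_zero]
      exact Submodule.zero_mem _

/-- A graded algebra `A` is Koszul if `A_0` is a Koszul `A`-module. -/
def IsKoszulAlgebra : Prop := (degreeZeroModule 𝒜).IsKoszul

/-- A graded algebra is Koszul in the classical sense if, moreover, `A_0` is semisimple. -/
def IsClassicalKoszulAlgebra : Prop :=
  IsSemisimpleRing (DegreeZeroRing 𝒜) ∧ IsKoszulAlgebra 𝒜

end GradedModules

/-- A ring is self-injective if every projective module over it is injective. -/
def IsSelfInjective (R : Type v) [Ring R] : Prop :=
  ∀ (P : Type v) [AddCommGroup P] [Module R P], Module.Projective R P → Module.Injective R P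

/-- Restriction of a graded module along a homomorphism of graded algebras. -/
def GrModule.restrict {k : Type u} [Field k] {A B : Type v} [Ring A] [Algebra k A]
    [Ring B] [Algebra k B] {𝒜 : ℕ → Submodule k A} {ℬ : ℕ → Submodule k B}
    (φ : B →ₐ[k] A) (hφ : ∀ i, ∀ b ∈ ℬ i, φ b ∈ 𝒜 i) (M : GrModule.{u, v, w} 𝒜) :
    GrModule.{u, v, w} ℬ :=
  letI : Module B M.carrier := Module.compHom M.carrier φ.toRingHom
  { carrier := M.carrier
    isScalarTower := ⟨fun c b m => by
      change φ (c • b) • m = c • (φ b • m)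
      rw [map_smul, smul_assoc]⟩
    gr := M.gr
    isInternal := M.isInternal
    smul_mem := fun i j b m hb hm => M.smul_mem i j (φ b) m (hφ i b hb) hm }

/-! ## The associated algebra of a linear category with finitely many objects -/

/-- `⨁_{x, y} C(x, y)`; an element is the family of its components. -/
def AssocAlg (C : Type v) [Category.{w} C] : Type (max v w) := ∀ x y : C, x ⟶ y

namespace AssocAlg

variable {C : Type v} [Category.{w} C] [Preadditive C]

instance : AddCommGroup (AssocAlg C) := inferInstanceAs (AddCommGroup (∀ x y : C, x ⟶ y))

@[ext] theorem ext {a b : AssocAlg C} (h : ∀ x y, a x y = b x y) : a = b :=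
  funext fun x => funext fun y => h x y

@[simp] theorem add_apply (a b : AssocAlg C) (x y : C) : (a + b) x y = a x y + b x y := rfl

@[simp] theorem zero_apply (x y : C) : (0 : AssocAlg C) x y = 0 := rfl

instance (k : Type u) [Field k] [Linear k C] : Module k (AssocAlg C) :=
  inferInstanceAs (Module k (∀ x y : C, x ⟶ y))

variable [Fintype C] [DecidableEq C]

/-- The product `b * a` is the composite "`a`, then `b`" on composable morphisms and `0` on
non-composable ones, extended bilinearly. -/
instance : Mul (AssocAlg C) := ⟨fun b a x y => ∑ t : C, a x t ≫ b t y⟩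

/-- The unit is `∑ 1_x`. -/
instance : One (AssocAlg C) := ⟨fun x y => if h : x = y then eqToHom h else 0⟩

theorem mul_apply (b a : AssocAlg C) (x y : C) : (b * a) x y = ∑ t : C, a x t ≫ b t y := rfl

theorem one_apply (x y : C) :
    (1 : AssocAlg C) x y = if h : x = y then eqToHom h else 0 := rfl

instance : Ring (AssocAlg C) :=
  { (inferInstance : AddCommGroup (AssocAlg C)), (inferInstance : Mul (AssocAlg C)),
    (inferInstance : One (AssocAlg C)) with
    left_distrib := fun a b c => by
      ext x y; simp [mul_apply, Finset.sum_add_distrib]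
    right_distrib := fun a b c => by
      ext x y; simp [mul_apply, Finset.sum_add_distrib]
    zero_mul := fun a => by ext x y; simp [mul_apply]
    mul_zero := fun a => by ext x y; simp [mul_apply]
    mul_assoc := fun a b c => by
      ext x y
      simp only [mul_apply, Preadditive.comp_sum, Preadditive.sum_comp, Category.assoc]
      exact Finset.sum_comm
    one_mul := fun a => by
      ext x y
      rw [mul_apply, Finset.sum_eq_single y]
      · simp [one_apply]
      · intro t _ ht
        simp [one_apply, ht]
      · simp
    mul_one := fun a => by
      ext x y
      rw [mul_apply, Finset.sum_eq_single x]
      · simp [one_apply]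
      · intro t _ ht
        simp [one_apply, ht.symm]
      · simp }

variable (k : Type u) [Field k] [Linear k C]

instance : Algebra k (AssocAlg C) :=
  Algebra.ofModule
    (fun r a b => by
      ext x y
      change ∑ t : C, b x t ≫ (r • a t y) = r • ∑ t : C, b x t ≫ a t y
      simp [Finset.smul_sum])
    (fun r a b => by
      ext x y
      change ∑ t : C, (r • b x t) ≫ a t y = r • ∑ t : C, b x t ≫ a t y
      simp [Finset.smul_sum])

@[simp] theorem smul_apply (r : k) (a : AssocAlg C) (x y : C) : (r • a) x y = r • a x y := rfl

/-- A morphism as an element of the associated algebra. -/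
def single (x y : C) : (x ⟶ y) →ₗ[k] AssocAlg C :=
  (LinearMap.single k (fun x : C => ∀ y : C, x ⟶ y) x).comp
    (LinearMap.single k (fun y : C => x ⟶ y) y)

theorem single_apply (x y : C) (f : x ⟶ y) (x' y' : C) :
    single k x y f x' y' =
      (Pi.single x (Pi.single y f : ∀ y : C, x ⟶ y) : ∀ x y : C, x ⟶ y) x' y' := rfl

theorem single_self (x y : C) (f : x ⟶ y) : single k x y f x y = f := by
  rw [single_apply, Pi.single_eq_same, Pi.single_eq_same]

theorem single_of_ne (x y x' y' : C) (f : x ⟶ y) (h : ¬ (x = x' ∧ y = y')) :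
    single k x y f x' y' = 0 := by
  rw [single_apply]
  by_cases hx : x = x'
  · subst hx
    have hy : y' ≠ y := fun e => h ⟨rfl, e.symm⟩
    rw [Pi.single_eq_same, Pi.single_eq_of_ne hy]
  · rw [Pi.single_eq_of_ne (Ne.symm hx)]
    rfl

theorem sum_single (a : AssocAlg C) : ∑ x : C, ∑ y : C, single k x y (a x y) = a := by
  ext x' y'
  have key : ∀ s : C → C → AssocAlg C,
      (∑ x : C, ∑ y : C, s x y) x' y' = ∑ x : C, ∑ y : C, s x y x' y' := by
    intro s
    let ev : AssocAlg C →+ (x' ⟶ y') := ⟨⟨fun b => b x' y', rfl⟩, fun _ _ => rfl⟩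
    change ev (∑ x : C, ∑ y : C, s x y) = ∑ x : C, ∑ y : C, ev (s x y)
    simp only [map_sum]
  rw [key, Finset.sum_eq_single x', Finset.sum_eq_single y', single_self]
  · intro y _ hy
    exact single_of_ne k _ _ _ _ _ (fun h => hy h.2)
  · simp
  · intro x _ hx
    exact Finset.sum_eq_zero fun y _ => single_of_ne k _ _ _ _ _ (fun h => hx h.1)
  · simp

end AssocAlg

/-! ## Gradings on linear categories -/

/-- A grading `C(x, y) = ⨁_i C(x, y)_i` compatible with composition. -/
structure CatGrading (k : Type u) [Field k] (C : Type v) [Category.{w} C] [Preadditive C]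
    [Linear k C] where
  gr : ∀ x y : C, ℕ → Submodule k (x ⟶ y)
  isInternal : ∀ x y : C, DirectSum.IsInternal (gr x y)
  id_mem : ∀ x : C, 𝟙 x ∈ gr x x 0
  comp_mem : ∀ (x y t : C) (i j : ℕ) (f : x ⟶ y) (g : y ⟶ t),
    f ∈ gr x y i → g ∈ gr y t j → f ≫ g ∈ gr x t (i + j)

namespace CatGrading

variable {k : Type u} [Field k] {C : Type v} [Category.{w} C] [Preadditive C] [Linear k C]

/-- `C_i = ⨁_{x, y} C(x, y)_i`. -/
def alg (G : CatGrading k C) (i : ℕ) : Submodule k (AssocAlg C) where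
  carrier := {a | ∀ x y : C, a x y ∈ G.gr x y i}
  add_mem' ha hb x y := add_mem (ha x y) (hb x y)
  zero_mem' x y := zero_mem _
  smul_mem' r a ha x y := Submodule.smul_mem _ r (ha x y)

variable [Fintype C] [DecidableEq C]

theorem single_mem_alg (G : CatGrading k C) {x y : C} {i : ℕ} {f : x ⟶ y}
    (hf : f ∈ G.gr x y i) : AssocAlg.single k x y f ∈ G.alg i := by
  intro x' y'
  by_cases h : x = x' ∧ y = y'
  · obtain ⟨rfl, rfl⟩ := h
    rw [AssocAlg.single_self]
    exact hf
  · rw [AssocAlg.single_of_ne k _ _ _ _ _ h]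
    exact zero_mem _

theorem alg_isInternal (G : CatGrading k C) : DirectSum.IsInternal G.alg := by
  classical
  rw [DirectSum.isInternal_submodule_iff_iSupIndep_and_iSup_eq_top]
  constructor
  · rw [iSupIndep_iff_dfinsupp_lsum_injective]
    rw [injective_iff_map_eq_zero]
    intro s hs
    ext i x y
    have hind := (DirectSum.isInternal_submodule_iff_iSupIndep_and_iSup_eq_top _).1
      (G.isInternal x y)
    have hinj := (iSupIndep_iff_dfinsupp_lsum_injective _).1 hind.1
    let ev : AssocAlg C →ₗ[k] (x ⟶ y) := ⟨⟨fun b => b x y, fun _ _ => rfl⟩, fun _ _ => rfl⟩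
    let evi : ∀ i, G.alg i →ₗ[k] G.gr x y i := fun i =>
      (ev.comp (G.alg i).subtype).codRestrict _ (fun a => a.2 x y)
    have h0 : DFinsupp.mapRange.linearMap evi s = 0 := by
      apply hinj
      rw [map_zero]
      have hcomp : (DFinsupp.lsum ℕ fun i => (G.gr x y i).subtype).toAddMonoidHom.comp
          (DFinsupp.mapRange.linearMap evi).toAddMonoidHom =
          ev.toAddMonoidHom.comp
            (DFinsupp.lsum ℕ fun i => (G.alg i).subtype).toAddMonoidHom := by
        ext i a
        simp [evi]
        rfl
      have := DFunLike.congr_fun hcomp s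
      refine Eq.trans this ?_
      change ev _ = 0
      refine (congrArg ev hs).trans (map_zero ev)
    have h1 := DFunLike.congr_fun h0 i
    exact congrArg Subtype.val h1
  · rw [eq_top_iff]
    intro a _
    rw [← AssocAlg.sum_single k a]
    refine sum_mem fun x _ => sum_mem fun y _ => ?_
    have htop := (G.isInternal x y).submodule_iSup_eq_top
    have hmem : a x y ∈ ⨆ i, G.gr x y i := by rw [htop]; trivial
    generalize a x y = c at hmem
    induction hmem using Submodule.iSup_induction' with
    | mem i f hf => exact Submodule.mem_iSup_of_mem i (G.single_mem_alg hf)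
    | zero => rw [map_zero]; exact zero_mem _
    | add f g _ _ hf hg => rw [map_add]; exact add_mem hf hg

instance (G : CatGrading k C) : GradedAlgebra G.alg :=
  { G.alg_isInternal.chooseDecomposition with
    one_mem := fun x y => by
      rw [AssocAlg.one_apply]
      split_ifs with h
      · subst h
        exact G.id_mem x
      · exact zero_mem _
    mul_mem := fun i j b a hb ha x y => by
      rw [AssocAlg.mul_apply]
      refine sum_mem fun t _ => ?_
      rw [add_comm]
      exact G.comp_mem _ _ _ _ _ _ _ (ha x t) (hb t y) }

/-- The graded category is Koszul. -/
def IsKoszul (G : CatGrading k C) : Prop := IsKoszulAlgebra G.alg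

/-- The graded category is Koszul in the classical sense. -/
def IsClassicalKoszul (G : CatGrading k C) : Prop := IsClassicalKoszulAlgebra G.alg

end CatGrading

/-! ## Directed categories -/

/-- A `k`-linear category with finite-dimensional morphism spaces is directed with respect to the
partial order `le` on its objects if `C(x, y) ≠ 0` only if `le x y`. -/
structure IsDirectedCategory (k : Type u) [Field k] (C : Type v) [Category.{w} C] [Preadditive C]
    [Linear k C] (le : C → C → Prop) : Prop where
  isPartialOrder : IsPartialOrder C le
  finite_hom : ∀ x y : C, Module.Finite k (x ⟶ y)
  le_of_ne_zero : ∀ (x y : C) (f : x ⟶ y), f ≠ 0 → le x y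

/-- The conditions on the grading of a graded directed category: the degree `0` part is formed by
the endomorphisms, and `C_i · C_j = C_{i+j}`. -/
structure CatGrading.IsGradedDirected {k : Type u} [Field k] {C : Type v} [Category.{w} C]
    [Preadditive C] [Linear k C] [Fintype C] [DecidableEq C] (G : CatGrading k C) : Prop where
  gr_zero_self : ∀ x : C, G.gr x x 0 = ⊤
  gr_zero_of_ne : ∀ x y : C, x ≠ y → G.gr x y 0 = ⊥
  mul_eq : ∀ i j : ℕ, G.alg i * G.alg j = G.alg (i + j)

/-! ### Standard modules and standard stratification -/

/-- A primitive idempotent of a ring. -/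
def IsPrimitiveIdempotentElem {R : Type w} [Ring R] (e : R) : Prop :=
  IsIdempotentElem e ∧ e ≠ 0 ∧
    ∀ f g : R, IsIdempotentElem f → IsIdempotentElem g → f * g = 0 → g * f = 0 → e = f + g →
      f = 0 ∨ g = 0

/-- A choice, for each object `x`, of a complete set of orthogonal primitive idempotents of
`C(x, x)`. -/
structure PrimitiveSystem (C : Type v) [Category.{w} C] [Preadditive C] where
  card : C → ℕ
  e : ∀ x : C, Fin (card x) → End x
  complete : ∀ x : C, CompleteOrthogonalIdempotents (e x)
  primitive : ∀ (x : C) (i : Fin (card x)), IsPrimitiveIdempotentElem (e x i)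

namespace PrimitiveSystem

variable (k : Type u) [Field k] {C : Type v} [Category.{w} C] [Preadditive C] [Linear k C]
  [Fintype C] [DecidableEq C] (E : PrimitiveSystem C)

/-- The set `Λ` indexing the chosen idempotents. -/
abbrev Index : Type v := Σ x : C, Fin (E.card x)

/-- `P_λ = C e_λ`. -/
def proj (l : E.Index) : Submodule (AssocAlg C) (AssocAlg C) :=
  Submodule.span (AssocAlg C) {AssocAlg.single k l.1 l.1 (E.e l.1 l.2)}

/-- The sum of the traces of `P_μ` in `P_λ` over all `μ` with `μ ⋠ λ`, where `μ ≼ λ` means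
`le y x` for `e_μ` at the object `y` and `e_λ` at the object `x`. -/
def traceSum (le : C → C → Prop) (l : E.Index) : Submodule (AssocAlg C) (E.proj k l) :=
  ⨆ (m : E.Index) (_ : ¬ le m.1 l.1) (f : E.proj k m →ₗ[AssocAlg C] E.proj k l),
    LinearMap.range f

/-- The standard module `Δ_λ`. -/
abbrev Standard (le : C → C → Prop) (l : E.Index) : Type (max v w) :=
  E.proj k l ⧸ E.traceSum k le l

/-- `N` has a finite filtration whose factors are standard modules. -/
def HasStandardFiltration (le : C → C → Prop) (N : Type z) [AddCommGroup N]
    [Module (AssocAlg C) N] : Prop :=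
  ∃ (n : ℕ) (F : ℕ → Submodule (AssocAlg C) N), Monotone F ∧ F 0 = ⊥ ∧ F n = ⊤ ∧
    ∀ i < n, ∃ m : E.Index,
      Nonempty ((F (i + 1) ⧸ (F i).submoduleOf (F (i + 1))) ≃ₗ[AssocAlg C] E.Standard k le m)

end PrimitiveSystem

/-- The directed category `C` is standardly stratified (for the pre-order induced by `le`): every
`P_λ` has a filtration by standard modules.  Different choices of the idempotents give isomorphic
modules `P_λ` and `Δ_λ`, up to reindexing. -/
def IsStandardlyStratified (k : Type u) [Field k] (C : Type v) [Category.{w} C] [Preadditive C]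
    [Linear k C] [Fintype C] [DecidableEq C] (le : C → C → Prop) : Prop :=
  ∃ E : PrimitiveSystem C, ∀ l : E.Index, E.HasStandardFiltration k le (E.proj k l)

/-! ### Replacing the endomorphism rings by `k · 1` -/

/-- `C(x, y)` for `x ≠ y`, and `k · 1_x` for `x = y`. -/
def reducedHom (k : Type u) [Field k] {C : Type v} [Category.{w} C] [Preadditive C] [Linear k C]
    (x y : C) : Submodule k (x ⟶ y) :=
  ⨅ h : x = y, Submodule.span k {eqToHom h}

section Reduced

variable {k : Type u} [Field k] {C : Type v} [Category.{w} C] [Preadditive C] [Linear k C]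
  {le : C → C → Prop}

theorem reducedHom_self (x : C) : reducedHom k x x = Submodule.span k {𝟙 x} := by
  simp [reducedHom]

theorem reducedHom_of_ne {x y : C} (h : x ≠ y) : reducedHom k x y = ⊤ := by
  simp [reducedHom, h]

theorem id_mem_reducedHom (x : C) : 𝟙 x ∈ reducedHom k x x := by
  rw [reducedHom_self]
  exact Submodule.mem_span_singleton_self _

theorem comp_mem_reducedHom (hC : IsDirectedCategory k C le) {x y t : C} {f : x ⟶ y} {g : y ⟶ t}
    (hf : f ∈ reducedHom k x y) (hg : g ∈ reducedHom k y t) : f ≫ g ∈ reducedHom k x t := by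
  by_cases hxt : x = t
  · subst hxt
    by_cases hxy : x = y
    · subst hxy
      rw [reducedHom_self, Submodule.mem_span_singleton] at *
      obtain ⟨a, rfl⟩ := hf
      obtain ⟨b, rfl⟩ := hg
      exact ⟨b * a, by simp [smul_smul, mul_comm]⟩
    · have h0 : f ≫ g = 0 := by
        by_contra h
        have hf0 : f ≠ 0 := by rintro rfl; simp at h
        have hg0 : g ≠ 0 := by rintro rfl; simp at h
        have := hC.isPartialOrder
        exact hxy (antisymm_of le (hC.le_of_ne_zero _ _ f hf0) (hC.le_of_ne_zero _ _ g hg0))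
      rw [h0]
      exact zero_mem _
  · rw [reducedHom_of_ne hxt]
    trivial

/-- The objects of the subcategory `D` of the directed category `C`. -/
structure EndReduced (hC : IsDirectedCategory k C le) where
  obj : C

namespace EndReduced

variable (hC : IsDirectedCategory k C le)

instance : Category.{w} (EndReduced hC) where
  Hom X Y := reducedHom k X.obj Y.obj
  id X := ⟨𝟙 X.obj, id_mem_reducedHom X.obj⟩
  comp f g := ⟨f.1 ≫ g.1, comp_mem_reducedHom hC f.2 g.2⟩

/-- The inclusion of `D(X, Y)` in `C(X, Y)`. -/
def val {hC : IsDirectedCategory k C le} {X Y : EndReduced hC} (f : X ⟶ Y) : X.obj ⟶ Y.obj :=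
  f.1

instance : Preadditive (EndReduced hC) where
  homGroup X Y := inferInstanceAs (AddCommGroup (reducedHom k X.obj Y.obj))
  add_comp _ _ _ _ _ _ := Subtype.ext (Preadditive.add_comp _ _ _ _ _ _)
  comp_add _ _ _ _ _ _ := Subtype.ext (Preadditive.comp_add _ _ _ _ _ _)

instance : Linear k (EndReduced hC) where
  homModule X Y := inferInstanceAs (Module k (reducedHom k X.obj Y.obj))
  smul_comp _ _ _ _ _ _ := Subtype.ext (Linear.smul_comp _ _ _ _ _ _)
  comp_smul _ _ _ _ _ _ := Subtype.ext (Linear.comp_smul _ _ _ _ _ _)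

/-- `D` has the same objects as `C`. -/
def objEquiv : EndReduced hC ≃ C where
  toFun X := X.obj
  invFun x := ⟨x⟩
  left_inv _ := rfl
  right_inv _ := rfl

instance [Fintype C] : Fintype (EndReduced hC) := Fintype.ofEquiv C (objEquiv hC).symm

instance [DecidableEq C] : DecidableEq (EndReduced hC) := (objEquiv hC).decidableEq

/-- The grading of `D` induced by the grading of `C`. -/
def grading (G : CatGrading k C) : CatGrading k (EndReduced hC) where
  gr X Y i := (G.gr X.obj Y.obj i).comap (reducedHom k X.obj Y.obj).subtype
  isInternal X Y := by
    classical
    have hG := (DirectSum.isInternal_submodule_iff_iSupIndep_and_iSup_eq_top _).1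
      (G.isInternal X.obj Y.obj)
    rw [DirectSum.isInternal_submodule_iff_iSupIndep_and_iSup_eq_top]
    constructor
    · have hind := hG.1
      rw [iSupIndep_def] at hind ⊢
      intro i
      rw [Submodule.disjoint_def]
      intro f hf hf'
      apply Subtype.ext
      refine (Submodule.disjoint_def.1 (hind i)) f.1 hf ?_
      have : (⨆ j, ⨆ _ : j ≠ i, (G.gr X.obj Y.obj j).comap (reducedHom k X.obj Y.obj).subtype) ≤
          (⨆ j, ⨆ _ : j ≠ i, G.gr X.obj Y.obj j).comap (reducedHom k X.obj Y.obj).subtype :=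
        iSup₂_le fun j hj => Submodule.comap_mono (le_iSup₂_of_le j hj le_rfl)
      exact this hf'
    · rw [eq_top_iff]
      rintro ⟨f, hf⟩ _
      obtain ⟨x⟩ := X
      obtain ⟨y⟩ := Y
      by_cases hxy : x = y
      · subst hxy
        refine Submodule.mem_iSup_of_mem 0 ?_
        change f ∈ G.gr x x 0
        change f ∈ reducedHom k x x at hf
        rw [reducedHom_self, Submodule.mem_span_singleton] at hf
        obtain ⟨a, rfl⟩ := hf
        exact Submodule.smul_mem _ _ (G.id_mem x)
      · have hmem : f ∈ ⨆ i, G.gr x y i := by rw [hG.2]; trivial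
        have htop : reducedHom k x y = ⊤ := reducedHom_of_ne hxy
        have hmem' : ∀ g ∈ ⨆ i, G.gr x y i, ∀ hg : g ∈ reducedHom k x y,
            (⟨g, hg⟩ : reducedHom k x y) ∈
              ⨆ i, (G.gr x y i).comap (reducedHom k x y).subtype := by
          intro g hg
          induction hg using Submodule.iSup_induction' with
          | mem i g hg => exact fun _ => Submodule.mem_iSup_of_mem i hg
          | zero => exact fun _ => zero_mem _
          | add g g' _ _ h h' =>
            intro _
            exact add_mem (h (htop ▸ Submodule.mem_top)) (h' (htop ▸ Submodule.mem_top))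
        exact hmem' f hmem hf
  id_mem X := G.id_mem X.obj
  comp_mem X Y T i j f g hf hg := G.comp_mem _ _ _ _ _ f.1 g.1 hf hg

variable [Fintype C] [DecidableEq C]

/-- The inclusion of `D` in `C`, on associated algebras. -/
def inclusion : AssocAlg (EndReduced hC) →ₐ[k] AssocAlg C :=
  AlgHom.ofLinearMap
    { toFun := fun a x y => val (a ⟨x⟩ ⟨y⟩)
      map_add' := fun _ _ => rfl
      map_smul' := fun _ _ => rfl }
    (by
      ext x y
      change val ((1 : AssocAlg (EndReduced hC)) ⟨x⟩ ⟨y⟩) = (1 : AssocAlg C) x y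
      by_cases h : x = y
      · subst h
        simp only [AssocAlg.one_apply, dite_true]
        rfl
      · have h' : ¬ ((⟨x⟩ : EndReduced hC) = ⟨y⟩) := fun e => h (congrArg EndReduced.obj e)
        simp only [AssocAlg.one_apply, h, h', dite_false]
        rfl)
    (fun b a => by
      ext x y
      change val ((b * a) ⟨x⟩ ⟨y⟩) = ∑ t : C, val (a ⟨x⟩ ⟨t⟩) ≫ val (b ⟨t⟩ ⟨y⟩)
      rw [AssocAlg.mul_apply]
      refine (map_sum (reducedHom k x y).subtype _ _).trans ?_
      exact Fintype.sum_equiv (objEquiv hC) _ _ (fun _ => rfl))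

theorem inclusion_mem (G : CatGrading k C) (i : ℕ) (b : AssocAlg (EndReduced hC))
    (hb : b ∈ (grading hC G).alg i) : inclusion hC b ∈ G.alg i :=
  fun x y => hb ⟨x⟩ ⟨y⟩

/-- `M↓_D`. -/
def restrict (G : CatGrading k C) (M : GrModule.{u, max v w, z} G.alg) :
    GrModule.{u, max v w, z} (grading hC G).alg :=
  M.restrict (inclusion hC) (inclusion_mem hC G)

end EndReduced

end Reduced

end

/-! Let `A` and `B` be the algebras of the category and of its subcategory with trivial
endomorphisms. The inclusion `B → A` is bijective in positive degrees, `B_0` is a product of copies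
of `k`, hence semisimple, and `A_0` is self-injective. Both assertions follow from comparing linear
resolutions over `A` and `B`, with projectivity over `A_0` as the link.

Koszulity is handled in finite stages. A cover `P → M` in degree `s` is a graded projective
surjection, generated in degree `s` and bijective there; `LinearUpTo n s M` says that `n` successive
kernels of covers are generated in degrees `s+1, …, s+n`. Lifts to a cover are unique
(`IsCover.hom_ext`), so kernels do not depend on the cover, and the class is closed under summands,
extensions, finite products and shifts. `isKoszul_iff_linearUpTo` identifies Koszul modules with
those linear to every stage.

Projectivity over `A_0` (`projective_comp_of_linearUpTo`): if `K` is the kernel of a cover `P → M`,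
then `M_{s+m+1} = P_{s+m+1} / K_{s+1+m}`. By induction the submodule is projective, hence injective
by self-injectivity, so it splits off. Applied to the ideal `J = ⨁_{i ≥ 1} A_i`, this makes each
`A_i` projective over `A_0` when `A` is Koszul.

Descent to `B` (`linearUpTo_restrict`): over `B` the module `A` is an extension of `A/B`,
concentrated in degree `0`, by `B`, so it is linear as far as `B_0` is. A `B`-cover `Q` of a
projective `A`-module `P` that covers `M` also covers `M`, and its kernel over `M` is an extension
of `ker (P → M)` by `ker (Q → P)`. Since `A` and `B` have the same ideal `J`, linearity of `B_0` to
stage `n` gives linearity to stage `n+1`. In the converse direction (`linearUpTo_of_restrict`), the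
same short exact sequence is read from left to right, and projectivity over `A_0` guarantees that
`A`-covers exist at each stage.

Finally, `isStandardlyStratified_iff` says that standard stratification amounts to projectivity of
`A` over `A_0`. The trace submodule of `P_λ` is its positive part, so `Δ_λ` is `A_0 e_λ`, which is
projective over `A_0`. Conversely, in a module projective over `A_0`, the part at a maximal object
of its support is killed by `J` and contains a copy of some `Δ_μ` as an `A_0`-summand; such copies
are split off one at a time. -/

noncomputable section

namespace GrModule

/-! ### Gradings described by their projections -/

section Internal

variable {k : Type u} [Field k] {V : Type w} [AddCommGroup V] [Module k V]

/-- A family of subspaces is a grading as soon as it admits a jointly faithful family of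
projections with finite supports. -/
theorem isInternal_of_proj (gr : ℤ → Submodule k V) (p : ℤ → V → V)
    (hadd : ∀ j x y, p j (x + y) = p j x + p j y)
    (hmem : ∀ j x, p j x ∈ gr j)
    (hself : ∀ j, ∀ x ∈ gr j, p j x = x)
    (hne : ∀ i j, i ≠ j → ∀ x ∈ gr j, p i x = 0)
    (hfin : ∀ x, {j | p j x ≠ 0}.Finite)
    (hext : ∀ x, (∀ j, p j x = 0) → x = 0) : DirectSum.IsInternal gr := by
  classical
  let q : ∀ j, V →+ V := fun j => AddMonoidHom.mk' (p j) (hadd j)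
  rw [DirectSum.isInternal_submodule_iff_iSupIndep_and_iSup_eq_top]
  constructor
  · rw [iSupIndep_def]
    intro i
    rw [Submodule.disjoint_def]
    intro x hx hx'
    have h0 : ∀ y ∈ ⨆ j, ⨆ _ : j ≠ i, gr j, p i y = 0 := by
      intro y hy
      induction hy using Submodule.iSup_induction' with
      | mem j y hy =>
        by_cases hj : j = i
        · subst hj
          simp only [ne_eq, not_true_eq_false, iSup_false, Submodule.mem_bot] at hy
          subst hy
          exact (q j).map_zero
        · simp only [ne_eq, hj, not_false_eq_true, iSup_pos] at hy
          exact hne i j (Ne.symm hj) y hy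
      | zero => exact (q i).map_zero
      | add y y' _ _ h h' => rw [hadd, h, h', add_zero]
    rw [← hself i x hx]
    exact h0 x hx'
  · rw [eq_top_iff]
    intro x _
    -- The vector and the finite sum of its projections have the same projections, so joint
    -- faithfulness identifies them.
    have key : x - ∑ j ∈ (hfin x).toFinset, p j x = 0 := by
      apply hext
      intro i
      change q i _ = 0
      rw [map_sub, map_sum, sub_eq_zero]
      by_cases hi : i ∈ (hfin x).toFinset
      · rw [Finset.sum_eq_single_of_mem i hi]
        · exact (hself i _ (hmem i x)).symm
        · intro j _ hj
          exact hne i j (Ne.symm hj) _ (hmem j x)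
      · rw [Finset.sum_eq_zero]
        · by_contra h
          exact hi ((hfin x).mem_toFinset.2 h)
        · intro j hj
          refine hne i j ?_ _ (hmem j x)
          rintro rfl
          exact hi hj
    rw [sub_eq_zero.1 key]
    exact sum_mem fun j _ => Submodule.mem_iSup_of_mem j (hmem j x)

end Internal

variable {k : Type u} [Field k] {A : Type v} [Ring A] [Algebra k A] {𝒜 : ℕ → Submodule k A}

/-- The projection onto the homogeneous component of degree `j`. -/
def proj (M : GrModule.{u, v, w} 𝒜) (j : ℤ) : M.carrier →ₗ[k] M.carrier :=
  (M.gr j).subtype ∘ₗ DirectSum.component k ℤ (fun j => M.gr j) j ∘ₗ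
    (LinearEquiv.ofBijective (DirectSum.coeLinearMap M.gr) M.isInternal).symm.toLinearMap

section Proj

variable (M : GrModule.{u, v, w} 𝒜)

theorem proj_mem (j : ℤ) (m : M.carrier) : M.proj j m ∈ M.gr j := Subtype.prop _

theorem decomp_of_mem {j : ℤ} {m : M.carrier} (hm : m ∈ M.gr j) :
    (LinearEquiv.ofBijective (DirectSum.coeLinearMap M.gr) M.isInternal).symm m =
      DirectSum.lof k ℤ (fun j => M.gr j) j ⟨m, hm⟩ := by
  rw [LinearEquiv.symm_apply_eq]
  exact (DirectSum.coeLinearMap_lof M.gr j ⟨m, hm⟩).symm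

theorem proj_of_mem {j : ℤ} {m : M.carrier} (hm : m ∈ M.gr j) : M.proj j m = m := by
  simp only [proj, LinearMap.comp_apply, LinearEquiv.coe_coe, M.decomp_of_mem hm]
  rw [DirectSum.component.lof_self]
  rfl

theorem proj_of_ne {i j : ℤ} (h : i ≠ j) {m : M.carrier} (hm : m ∈ M.gr j) :
    M.proj i m = 0 := by
  simp only [proj, LinearMap.comp_apply, LinearEquiv.coe_coe, M.decomp_of_mem hm]
  rw [DirectSum.component.of, dif_neg h.symm]
  rfl

theorem proj_proj_self (j : ℤ) (m : M.carrier) : M.proj j (M.proj j m) = M.proj j m :=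
  M.proj_of_mem (M.proj_mem j m)

theorem finite_proj (m : M.carrier) : {j | M.proj j m ≠ 0}.Finite := by
  classical
  refine (DFinsupp.support ((LinearEquiv.ofBijective (DirectSum.coeLinearMap M.gr)
    M.isInternal).symm m)).finite_toSet.subset ?_
  intro j hj
  simp only [Finset.mem_coe, DFinsupp.mem_support_toFun]
  intro h
  apply hj
  simp only [proj, LinearMap.comp_apply, LinearEquiv.coe_coe]
  change ((_ : M.gr j) : M.carrier) = 0
  rw [ZeroMemClass.coe_eq_zero]
  exact h

theorem eq_zero_of_proj {m : M.carrier} (h : ∀ j, M.proj j m = 0) : m = 0 := by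
  rw [← (LinearEquiv.ofBijective (DirectSum.coeLinearMap M.gr) M.isInternal).symm.map_eq_zero_iff]
  refine DFinsupp.ext fun j => ?_
  exact Subtype.ext (h j)

theorem eq_of_proj {m n : M.carrier} (h : ∀ j, M.proj j m = M.proj j n) : m = n := by
  rw [← sub_eq_zero]
  exact M.eq_zero_of_proj fun j => by rw [map_sub, h, sub_self]

theorem sum_proj (m : M.carrier) : ∑ j ∈ (M.finite_proj m).toFinset, M.proj j m = m := by
  apply M.eq_of_proj
  intro i
  rw [map_sum]
  by_cases hi : i ∈ (M.finite_proj m).toFinset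
  · rw [Finset.sum_eq_single_of_mem i hi, proj_proj_self]
    intro j _ hj
    exact M.proj_of_ne (Ne.symm hj) (M.proj_mem j m)
  · rw [Finset.sum_eq_zero]
    · by_contra h
      exact hi ((M.finite_proj m).mem_toFinset.2 (Ne.symm h))
    · intro j hj
      refine M.proj_of_ne ?_ (M.proj_mem j m)
      rintro rfl
      exact hi hj

theorem hom_induction {p : M.carrier → Prop} (hom : ∀ j, ∀ m ∈ M.gr j, p m) (zero : p 0)
    (add : ∀ m n, p m → p n → p (m + n)) (m : M.carrier) : p m := by
  rw [← M.sum_proj m]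
  exact Finset.sum_induction _ p add zero fun j _ => hom j _ (M.proj_mem j m)

theorem proj_smul {i : ℕ} {a : A} (ha : a ∈ 𝒜 i) (j : ℤ) (m : M.carrier) :
    M.proj (i + j) (a • m) = a • M.proj j m := by
  induction m using M.hom_induction with
  | hom l m hm =>
    by_cases h : l = j
    · subst h
      rw [M.proj_of_mem hm, M.proj_of_mem (M.smul_mem i l a m ha hm)]
    · rw [M.proj_of_ne (Ne.symm h) hm, smul_zero,
        M.proj_of_ne (fun e => h (by omega)) (M.smul_mem i l a m ha hm)]
  | zero => simp
  | add m n hm hn => rw [smul_add, map_add, hm, hn, map_add, smul_add]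

theorem proj_smul' {i : ℕ} {a : A} (ha : a ∈ 𝒜 i) (j : ℤ) (m : M.carrier) :
    M.proj j (a • m) = a • M.proj (j - i) m := by
  rw [← M.proj_smul ha]
  congr 2
  omega

end Proj

/-! ### Homogeneous maps and generation in one degree -/

section Hom

variable {M : GrModule.{u, v, w} 𝒜} {N : GrModule.{u, v, z} 𝒜} {f : M.carrier →ₗ[A] N.carrier}

theorem map_algebra_smul (f : M.carrier →ₗ[A] N.carrier) (c : k) (m : M.carrier) :
    f (c • m) = c • f m := by
  rw [← algebraMap_smul A c m, map_smul, algebraMap_smul]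

theorem IsGradedHom.proj_apply (hf : IsGradedHom M N f) (j : ℤ) (m : M.carrier) :
    f (M.proj j m) = N.proj j (f m) := by
  induction m using M.hom_induction with
  | hom l m hm =>
    by_cases h : l = j
    · subst h
      rw [M.proj_of_mem hm, N.proj_of_mem (hf _ _ hm)]
    · rw [M.proj_of_ne (Ne.symm h) hm, map_zero, N.proj_of_ne (Ne.symm h) (hf _ _ hm)]
  | zero => simp
  | add m n hm hn => simp only [map_add, hm, hn]

theorem isGradedHom_id (M : GrModule.{u, v, w} 𝒜) : IsGradedHom M M LinearMap.id :=
  fun _ _ hm => hm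

theorem IsGradedHom.exists_preimage (hf : IsGradedHom M N f) (hs : Function.Surjective f)
    {j : ℤ} {n : N.carrier} (hn : n ∈ N.gr j) : ∃ m ∈ M.gr j, f m = n := by
  obtain ⟨m, rfl⟩ := hs n
  exact ⟨M.proj j m, M.proj_mem j m, by rw [hf.proj_apply, N.proj_of_mem hn]⟩

theorem IsGradedHom.mem_of_injective (hf : IsGradedHom M N f) (hi : Function.Injective f)
    {j : ℤ} {m : M.carrier} (hm : f m ∈ N.gr j) : m ∈ M.gr j := by
  have : M.proj j m = m := hi (by rw [hf.proj_apply, N.proj_of_mem hm])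
  rw [← this]
  exact M.proj_mem j m

/-- The homogeneous part of degree zero of an `A`-linear map. -/
theorem exists_gradedPart [GradedAlgebra 𝒜] (g : M.carrier →ₗ[A] N.carrier) :
    ∃ g' : M.carrier →ₗ[A] N.carrier, IsGradedHom M N g' ∧
      ∀ j, ∀ m ∈ M.gr j, g' m = N.proj j (g m) := by
  let gk : M.carrier →ₗ[k] N.carrier :=
    { toFun := g, map_add' := g.map_add, map_smul' := fun c m => map_algebra_smul g c m }
  -- This is `m ↦ ∑ j, proj j (g (m_j))`. It is a priori only `k`-linear; `A`-linearity is checked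
  -- on homogeneous scalars and vectors, where both degrees move by the same amount.
  let h : M.carrier →ₗ[k] N.carrier :=
    (DirectSum.toModule k ℤ N.carrier (fun j => N.proj j ∘ₗ gk ∘ₗ (M.gr j).subtype)) ∘ₗ
      (LinearEquiv.ofBijective (DirectSum.coeLinearMap M.gr) M.isInternal).symm.toLinearMap
  have hh : ∀ j, ∀ m ∈ M.gr j, h m = N.proj j (g m) := by
    intro j m hm
    simp only [h, LinearMap.comp_apply, LinearEquiv.coe_coe, M.decomp_of_mem hm]
    rw [DirectSum.toModule_lof]
    rfl
  refine ⟨{ toFun := h, map_add' := h.map_add, map_smul' := ?_ }, ?_, hh⟩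
  · intro a m
    change h (a • m) = a • h m
    induction m using M.hom_induction with
    | hom j m hm =>
      induction a using DirectSum.Decomposition.inductionOn 𝒜 with
      | zero => simp
      | homogeneous a =>
        rw [hh _ _ hm, hh _ _ (M.smul_mem _ _ _ _ a.2 hm), map_smul, N.proj_smul a.2]
      | add a b ha hb => rw [add_smul, map_add, ha, hb, add_smul]
    | zero => simp
    | add m n hm hn => rw [smul_add, map_add, hm, hn, map_add, smul_add]
  · intro j m hm
    change h m ∈ _
    rw [hh j m hm]
    exact N.proj_mem _ _

/-- An ungraded lift exists by projectivity, and its homogeneous part of degree zero is still a lift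
because `f` and `g` are homogeneous. Projectivity of the underlying module is thus all that graded
lifting needs. -/
theorem exists_graded_lift [GradedAlgebra 𝒜] {P : GrModule 𝒜}
    [Module.Projective A P.carrier] (hf : IsGradedHom M N f) (hs : Function.Surjective f)
    {g : P.carrier →ₗ[A] N.carrier} (hg : IsGradedHom P N g) :
    ∃ h : P.carrier →ₗ[A] M.carrier, IsGradedHom P M h ∧ f ∘ₗ h = g := by
  obtain ⟨h, hh⟩ := Module.projective_lifting_property f g hs
  obtain ⟨h', hh', hj⟩ := exists_gradedPart (M := P) (N := M) h
  refine ⟨h', hh', LinearMap.ext fun p => ?_⟩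
  induction p using P.hom_induction with
  | hom j p hp =>
    rw [LinearMap.comp_apply, hj j p hp, hf.proj_apply, ← LinearMap.comp_apply, hh,
      N.proj_of_mem (hg _ _ hp)]
  | zero => simp
  | add m n hm hn => rw [map_add, map_add, hm, hn]

theorem GeneratedInDegree.ext {s : ℤ} (hM : M.GeneratedInDegree s)
    {g : M.carrier →ₗ[A] N.carrier} (h : ∀ m ∈ M.gr s, f m = g m) : f = g :=
  LinearMap.ext_on hM h

theorem GeneratedInDegree.of_surjective {s : ℤ} (hM : M.GeneratedInDegree s)
    (hf : IsGradedHom M N f) (hs : Function.Surjective f) : N.GeneratedInDegree s := by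
  rw [GeneratedInDegree, eq_top_iff, ← LinearMap.range_eq_top.2 hs, LinearMap.range_eq_map, ← hM,
    Submodule.map_span]
  apply Submodule.span_mono
  rintro _ ⟨m, hm, rfl⟩
  exact hf s m hm

theorem GeneratedInDegree.map_mem_span {s : ℤ} (hM : M.GeneratedInDegree s)
    (hf : IsGradedHom M N f) (m : M.carrier) : f m ∈ Submodule.span A (N.gr s : Set N.carrier) := by
  have hm : m ∈ Submodule.span A (M.gr s : Set M.carrier) := by
    rw [hM]
    trivial
  have := Submodule.mem_map_of_mem (f := f) hm
  rw [Submodule.map_span] at this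
  refine Submodule.span_mono ?_ this
  rintro _ ⟨x, hx, rfl⟩
  exact hf _ _ hx

/-- Scalars have degree at least `0`, so acting on generators of degree `s` never reaches a lower
degree. -/
theorem GeneratedInDegree.proj_eq_zero [GradedAlgebra 𝒜] {s : ℤ} (hM : M.GeneratedInDegree s)
    {j : ℤ} (hj : j < s) (m : M.carrier) : M.proj j m = 0 := by
  have hm : m ∈ Submodule.span A (M.gr s : Set M.carrier) := by
    rw [hM]
    trivial
  induction hm using Submodule.span_induction generalizing j with
  | mem m hm => exact M.proj_of_ne (by omega) hm
  | zero => exact map_zero _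
  | add m n _ _ hm hn => rw [map_add, hm hj, hn hj, add_zero]
  | smul a m _ hm =>
    induction a using DirectSum.Decomposition.inductionOn 𝒜 with
    | zero => simp
    | homogeneous a => rw [M.proj_smul' a.2, hm (by omega), smul_zero]
    | add a b ha hb => rw [add_smul, map_add, ha, hb, add_zero]

theorem GeneratedInDegree.eq_zero_of_mem [GradedAlgebra 𝒜] {s : ℤ} (hM : M.GeneratedInDegree s)
    {j : ℤ} (hj : j < s) {m : M.carrier} (hm : m ∈ M.gr j) : m = 0 := by
  rw [← M.proj_of_mem hm, hM.proj_eq_zero hj]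

theorem LocallyFinite.of_surjective (hM : M.LocallyFinite)
    (hf : IsGradedHom M N f) (hs : Function.Surjective f) : N.LocallyFinite := by
  intro j
  let gk : M.gr j →ₗ[k] N.gr j :=
    { toFun := fun m => ⟨f m.1, hf j _ m.2⟩
      map_add' := fun x y => Subtype.ext (f.map_add x y)
      map_smul' := fun c m => Subtype.ext (map_algebra_smul f c m) }
  have := hM j
  refine Module.Finite.of_surjective gk ?_
  rintro ⟨n, hn⟩
  obtain ⟨m, hm, rfl⟩ := hf.exists_preimage hs hn
  exact ⟨⟨m, hm⟩, rfl⟩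

theorem LocallyFinite.of_injective (hN : N.LocallyFinite)
    (hf : IsGradedHom M N f) (hi : Function.Injective f) : M.LocallyFinite := by
  intro j
  let gk : M.gr j →ₗ[k] N.gr j :=
    { toFun := fun m => ⟨f m.1, hf j _ m.2⟩
      map_add' := fun x y => Subtype.ext (f.map_add x y)
      map_smul' := fun c m => Subtype.ext (map_algebra_smul f c m) }
  have := hN j
  refine Module.Finite.of_injective gk ?_
  intro x y h
  exact Subtype.ext (hi (congrArg Subtype.val h))

end Hom

/-! ### Constructions -/

/-- A submodule is homogeneous if it is stable under the projections. -/
def IsHomogeneous (M : GrModule.{u, v, w} 𝒜) (N : Submodule A M.carrier) : Prop :=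
  ∀ j, ∀ m ∈ N, M.proj j m ∈ N

/-- A homogeneous submodule as a graded module. -/
def sub (M : GrModule.{u, v, w} 𝒜) (N : Submodule A M.carrier) (hN : M.IsHomogeneous N) :
    GrModule.{u, v, w} 𝒜 where
  carrier := N
  moduleField := inferInstanceAs (Module k (N.restrictScalars k))
  isScalarTower := ⟨fun c a m => Subtype.ext (smul_assoc c a m.1)⟩
  gr j := (M.gr j).comap (N.restrictScalars k).subtype
  isInternal := by
    refine isInternal_of_proj (V := N) _ (fun j m => ⟨M.proj j m.1, hN j _ m.2⟩) ?_ ?_ ?_ ?_ ?_ ?_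
    · exact fun j x y => Subtype.ext (map_add _ _ _)
    · exact fun j x => M.proj_mem j x.1
    · exact fun j x hx => Subtype.ext (M.proj_of_mem hx)
    · exact fun i j h x hx => Subtype.ext (M.proj_of_ne h hx)
    · refine fun x => (M.finite_proj x.1).subset fun j hj h => hj (Subtype.ext h)
    · exact fun x h => Subtype.ext (M.eq_zero_of_proj fun j => congrArg Subtype.val (h j))
  smul_mem := by
    intro i j a m ha hm
    exact M.smul_mem i j a m.1 ha hm

/-- The inclusion of a homogeneous submodule. -/
def subι (M : GrModule.{u, v, w} 𝒜) (N : Submodule A M.carrier) (hN : M.IsHomogeneous N) :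
    (M.sub N hN).carrier →ₗ[A] M.carrier := N.subtype

section Sub

variable (M : GrModule.{u, v, w} 𝒜) (N : Submodule A M.carrier) (hN : M.IsHomogeneous N)

theorem isGradedHom_subι : IsGradedHom (M.sub N hN) M (M.subι N hN) := fun _ _ hm => hm

theorem subι_injective : Function.Injective (M.subι N hN) := Subtype.val_injective

theorem subι_mem (m : (M.sub N hN).carrier) : M.subι N hN m ∈ N := m.2

/-- Lifting a map through a homogeneous submodule. -/
def subLift {X : Type*} [AddCommGroup X] [Module A X] (f : X →ₗ[A] M.carrier)
    (hf : ∀ x, f x ∈ N) : X →ₗ[A] (M.sub N hN).carrier := f.codRestrict N hf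

end Sub

theorem IsGradedHom.isHomogeneous_ker {M : GrModule.{u, v, w} 𝒜} {N : GrModule.{u, v, z} 𝒜}
    {f : M.carrier →ₗ[A] N.carrier} (hf : IsGradedHom M N f) :
    M.IsHomogeneous (LinearMap.ker f) := by
  intro j m hm
  rw [LinearMap.mem_ker] at hm ⊢
  rw [hf.proj_apply, hm, map_zero]

theorem IsGradedHom.isHomogeneous_range {M : GrModule.{u, v, w} 𝒜} {N : GrModule.{u, v, z} 𝒜}
    {f : M.carrier →ₗ[A] N.carrier} (hf : IsGradedHom M N f) :
    N.IsHomogeneous (LinearMap.range f) := by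
  rintro j _ ⟨m, rfl⟩
  exact ⟨M.proj j m, hf.proj_apply j m⟩

/-- The kernel of a graded homomorphism. -/
abbrev ker {M : GrModule.{u, v, w} 𝒜} {N : GrModule.{u, v, z} 𝒜}
    {f : M.carrier →ₗ[A] N.carrier} (hf : IsGradedHom M N f) : GrModule.{u, v, w} 𝒜 :=
  M.sub (LinearMap.ker f) hf.isHomogeneous_ker

/-- The inclusion of the kernel. -/
abbrev kerι {M : GrModule.{u, v, w} 𝒜} {N : GrModule.{u, v, z} 𝒜}
    {f : M.carrier →ₗ[A] N.carrier} (hf : IsGradedHom M N f) : (ker hf).carrier →ₗ[A] M.carrier :=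
  M.subι _ _

theorem apply_kerι {M : GrModule.{u, v, w} 𝒜} {N : GrModule.{u, v, z} 𝒜}
    {f : M.carrier →ₗ[A] N.carrier} (hf : IsGradedHom M N f) (m : (ker hf).carrier) :
    f (kerι hf m) = 0 := m.2

/-- The finite product of graded modules. -/
def pi {ι : Type z} [Finite ι] (M : ι → GrModule.{u, v, w} 𝒜) : GrModule.{u, v, max z w} 𝒜 where
  carrier := ∀ i, (M i).carrier
  gr j := Submodule.pi Set.univ fun i => (M i).gr j
  isInternal := by
    refine isInternal_of_proj _ (fun j m i => (M i).proj j (m i)) ?_ ?_ ?_ ?_ ?_ ?_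
    · exact fun j x y => funext fun i => map_add _ _ _
    · exact fun j x i _ => (M i).proj_mem j (x i)
    · exact fun j x hx => funext fun i => (M i).proj_of_mem (hx i trivial)
    · exact fun i j h x hx => funext fun l => (M l).proj_of_ne h (hx l trivial)
    · refine fun x => (Set.finite_iUnion fun i => (M i).finite_proj (x i)).subset fun j hj => ?_
      rw [Set.mem_iUnion]
      by_contra h
      push Not at h
      exact hj (funext fun i => by simpa using h i)
    · exact fun x h => funext fun i => (M i).eq_zero_of_proj fun j => congrFun (h j) i
  smul_mem i j a m ha hm := fun l _ => (M l).smul_mem i j a (m l) ha (hm l trivial)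

/-- The product of two graded modules. -/
def prod (M N : GrModule.{u, v, w} 𝒜) : GrModule.{u, v, w} 𝒜 where
  carrier := M.carrier × N.carrier
  gr j := (M.gr j).prod (N.gr j)
  isInternal := by
    refine isInternal_of_proj _ (fun j m => (M.proj j m.1, N.proj j m.2)) ?_ ?_ ?_ ?_ ?_ ?_
    · exact fun j x y => Prod.ext (map_add _ _ _) (map_add _ _ _)
    · exact fun j x => ⟨M.proj_mem j x.1, N.proj_mem j x.2⟩
    · exact fun j x hx => Prod.ext (M.proj_of_mem hx.1) (N.proj_of_mem hx.2)
    · exact fun i j h x hx => Prod.ext (M.proj_of_ne h hx.1) (N.proj_of_ne h hx.2)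
    · refine fun x => ((M.finite_proj x.1).union (N.finite_proj x.2)).subset fun j hj => ?_
      by_contra h
      simp only [Set.mem_union, Set.mem_ofPred_eq, ne_eq, not_or, not_not] at h
      exact hj (Prod.ext h.1 h.2)
    · exact fun x h => Prod.ext (M.eq_zero_of_proj fun j => congrArg Prod.fst (h j))
        (N.eq_zero_of_proj fun j => congrArg Prod.snd (h j))
  smul_mem i j a m ha hm := ⟨M.smul_mem i j a m.1 ha hm.1, N.smul_mem i j a m.2 ha hm.2⟩

/-- The graded module `M` with its degrees raised by `t`. -/
def shift (M : GrModule.{u, v, w} 𝒜) (t : ℤ) : GrModule.{u, v, w} 𝒜 where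
  carrier := M.carrier
  gr j := M.gr (j - t)
  isInternal := by
    refine isInternal_of_proj _ (fun j m => M.proj (j - t) m) ?_ ?_ ?_ ?_ ?_ ?_
    · exact fun j x y => map_add _ _ _
    · exact fun j x => M.proj_mem _ x
    · exact fun j x hx => M.proj_of_mem hx
    · exact fun i j h x hx => M.proj_of_ne (fun e => h (by omega)) hx
    · exact fun x => (M.finite_proj x).preimage (fun a _ b _ h => by simpa using h)
    · refine fun x h => M.eq_zero_of_proj fun j => ?_
      have := h (j + t)
      rwa [add_sub_cancel_right] at this
  smul_mem i j a m ha hm := by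
    have := M.smul_mem i (j - t) a m ha hm
    rwa [← add_sub_assoc] at this

/-- The quotient by a homogeneous submodule. -/
def quot (M : GrModule.{u, v, w} 𝒜) (N : Submodule A M.carrier) (hN : M.IsHomogeneous N) :
    GrModule.{u, v, w} 𝒜 where
  carrier := M.carrier ⧸ N
  gr j := (M.gr j).map (N.mkQ.restrictScalars k)
  isInternal := by
    have key : ∀ j x, (Submodule.Quotient.mk ((M.proj j) x) : M.carrier ⧸ N) =
        ((QuotientAddGroup.map N.toAddSubgroup N.toAddSubgroup (M.proj j).toAddMonoidHom
          (fun m hm => hN j m hm) : M.carrier ⧸ N →+ M.carrier ⧸ N) (Submodule.Quotient.mk x)) :=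
      fun j x => rfl
    refine isInternal_of_proj _ (fun j =>
      (QuotientAddGroup.map N.toAddSubgroup N.toAddSubgroup (M.proj j).toAddMonoidHom
        (fun m hm => hN j m hm) : M.carrier ⧸ N →+ M.carrier ⧸ N)) ?_ ?_ ?_ ?_ ?_ ?_
    · exact fun j x y => map_add _ _ _
    · intro j x
      obtain ⟨x, rfl⟩ := Submodule.Quotient.mk_surjective _ x
      rw [← key]
      exact ⟨_, M.proj_mem j x, rfl⟩
    · rintro j _ ⟨x, hx, rfl⟩
      exact congrArg (Submodule.Quotient.mk (p := N)) (M.proj_of_mem hx)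
    · rintro i j h _ ⟨x, hx, rfl⟩
      exact congrArg (Submodule.Quotient.mk (p := N)) (M.proj_of_ne h hx)
    · intro x
      obtain ⟨x, rfl⟩ := Submodule.Quotient.mk_surjective _ x
      refine (M.finite_proj x).subset fun j hj h => hj ?_
      rw [← key, h]
      rfl
    · intro x h
      obtain ⟨x, rfl⟩ := Submodule.Quotient.mk_surjective _ x
      rw [Submodule.Quotient.mk_eq_zero, ← M.sum_proj x]
      refine sum_mem fun j _ => ?_
      rw [← Submodule.Quotient.mk_eq_zero N, key, h]
  smul_mem i j a m ha hm := by
    obtain ⟨x, hx, rfl⟩ := hm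
    exact ⟨a • x, M.smul_mem i j a x ha hx, rfl⟩

/-- The projection to the quotient. -/
def quotπ (M : GrModule.{u, v, w} 𝒜) (N : Submodule A M.carrier) (hN : M.IsHomogeneous N) :
    M.carrier →ₗ[A] (M.quot N hN).carrier := N.mkQ

theorem isGradedHom_quotπ (M : GrModule.{u, v, w} 𝒜) (N : Submodule A M.carrier)
    (hN : M.IsHomogeneous N) : IsGradedHom M (M.quot N hN) (M.quotπ N hN) :=
  fun _ m hm => ⟨m, hm, rfl⟩

theorem quotπ_surjective (M : GrModule.{u, v, w} 𝒜) (N : Submodule A M.carrier)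
    (hN : M.IsHomogeneous N) : Function.Surjective (M.quotπ N hN) := N.mkQ_surjective

theorem quotπ_eq_zero (M : GrModule.{u, v, w} 𝒜) (N : Submodule A M.carrier)
    (hN : M.IsHomogeneous N) {m : M.carrier} : M.quotπ N hN m = 0 ↔ m ∈ N :=
  Submodule.Quotient.mk_eq_zero N

/-- The universe lift of a graded module. -/
def ulift (M : GrModule.{u, v, w} 𝒜) : GrModule.{u, v, max z w} 𝒜 where
  carrier := ULift.{z} M.carrier
  gr j := (M.gr j).comap (ULift.moduleEquiv (R := k) (M := M.carrier)).toLinearMap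
  isInternal := by
    refine isInternal_of_proj _ (fun j m => ⟨M.proj j m.down⟩) ?_ ?_ ?_ ?_ ?_ ?_
    · exact fun j x y => ULift.ext _ _ (map_add _ _ _)
    · exact fun j x => M.proj_mem _ x.down
    · exact fun j x hx => ULift.ext _ _ (M.proj_of_mem hx)
    · exact fun i j h x hx => ULift.ext _ _ (M.proj_of_ne h hx)
    · exact fun x => (M.finite_proj x.down).subset fun j hj h => hj (ULift.ext _ _ h)
    · exact fun x h => ULift.ext _ _ (M.eq_zero_of_proj fun j => congrArg ULift.down (h j))
  smul_mem i j a m ha hm := M.smul_mem i j a m.down ha hm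

/-- The comparison of a graded module with its universe lift. -/
def upEquiv (M : GrModule.{u, v, w} 𝒜) : M.carrier ≃ₗ[A] (ulift.{u, v, w, z} M).carrier :=
  ULift.moduleEquiv.symm

end GrModule

/-- The grading of `A`, with degrees in `ℤ`. -/
def intGrading {k : Type u} [Field k] {A : Type v} [Ring A] [Algebra k A]
    (𝒜 : ℕ → Submodule k A) (j : ℤ) : Submodule k A :=
  if 0 ≤ j then 𝒜 j.toNat else ⊥

/-! ### The regular graded module -/

section Self

variable {k : Type u} [Field k] {A : Type v} [Ring A] [Algebra k A] (𝒜 : ℕ → Submodule k A)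

@[simp] theorem intGrading_natCast (n : ℕ) : intGrading 𝒜 n = 𝒜 n := by simp [intGrading]

theorem intGrading_of_neg {j : ℤ} (hj : j < 0) : intGrading 𝒜 j = ⊥ := by
  simp [intGrading, hj]

variable [GradedAlgebra 𝒜]

/-- `A` as a graded module over itself. -/
def selfModule : GrModule.{u, v, v} 𝒜 where
  carrier := A
  gr := intGrading 𝒜
  isInternal := by
    classical
    refine GrModule.isInternal_of_proj _
      (fun j a => if 0 ≤ j then (DirectSum.decompose 𝒜 a j.toNat : A) else 0) ?_ ?_ ?_ ?_ ?_ ?_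
    · intro j x y
      split_ifs <;> simp
    · intro j x
      by_cases h : 0 ≤ j
      · simp [h, intGrading]
      · simp [h]
    · intro j x hx
      by_cases h : 0 ≤ j
      · simp only [intGrading, h, if_true] at hx ⊢
        exact DirectSum.decompose_of_mem_same 𝒜 hx
      · simp only [intGrading, h, if_false, Submodule.mem_bot] at hx ⊢
        exact hx.symm
    · intro i j hij x hx
      by_cases h : 0 ≤ j
      · simp only [intGrading, h, if_true] at hx
        split_ifs with hi
        · exact DirectSum.decompose_of_mem_ne 𝒜 hx (by omega)
        · rfl
      · simp only [intGrading, h, if_false, Submodule.mem_bot] at hx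
        simp [hx]
    · intro x
      refine (((DFinsupp.support (DirectSum.decompose 𝒜 x)).finite_toSet).image
        (fun n : ℕ => (n : ℤ))).subset ?_
      intro j hj
      simp only [Set.mem_ofPred_eq, ne_eq, ite_eq_right_iff, Classical.not_imp] at hj
      refine ⟨j.toNat, ?_, by simp [hj.1]⟩
      simp only [Finset.mem_coe, DFinsupp.mem_support_toFun]
      intro h
      exact hj.2 (by rw [h]; rfl)
    · intro x h
      rw [← (DirectSum.decomposeAddEquiv 𝒜).map_eq_zero_iff]
      refine DFinsupp.ext fun n => Subtype.ext ?_
      simpa using h n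
  smul_mem i j a m ha hm := by
    by_cases h : 0 ≤ j
    · obtain ⟨n, rfl⟩ := Int.eq_ofNat_of_zero_le h
      rw [← Nat.cast_add]
      rw [intGrading_natCast] at hm ⊢
      exact SetLike.GradedMul.mul_mem ha hm
    · rw [intGrading_of_neg 𝒜 (by omega), Submodule.mem_bot] at hm
      rw [hm, smul_zero]
      exact zero_mem _

end Self

namespace GrModule

variable {k : Type u} [Field k] {A : Type v} [Ring A] [Algebra k A] {𝒜 : ℕ → Submodule k A}

/-! ### Covers and linear resolutions -/

/-- A graded projective cover, generated in degree `s`, which is bijective in degree `s`. -/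
structure IsCover (P : GrModule.{u, v, w} 𝒜) (M : GrModule.{u, v, z} 𝒜)
    (π : P.carrier →ₗ[A] M.carrier) (s : ℤ) : Prop where
  projective : Module.Projective A P.carrier
  locallyFinite : P.LocallyFinite
  generated : P.GeneratedInDegree s
  graded : IsGradedHom P M π
  surjective : Function.Surjective π
  eq_zero : ∀ p ∈ P.gr s, π p = 0 → p = 0

/-- `M` is generated in degree `s` and has a graded projective resolution which is linear in the
first `n + 1` steps. -/
def LinearUpTo : ℕ → ℤ → GrModule.{u, v, w} 𝒜 → Prop
  | 0, s, M => M.GeneratedInDegree s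
  | n + 1, s, M => M.GeneratedInDegree s ∧
      ∃ (P : GrModule.{u, v, w} 𝒜) (π : P.carrier →ₗ[A] M.carrier) (h : IsCover P M π s),
        LinearUpTo n (s + 1) (ker h.graded)

theorem LinearUpTo.generated {n : ℕ} {s : ℤ} {M : GrModule.{u, v, w} 𝒜}
    (h : LinearUpTo n s M) : M.GeneratedInDegree s := by
  cases n with
  | zero => exact h
  | succ n => exact h.1

/-- `M'` is a graded direct summand of `M`. -/
def IsGradedRetract (M' : GrModule.{u, v, w} 𝒜) (M : GrModule.{u, v, z} 𝒜) : Prop :=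
  ∃ (i : M'.carrier →ₗ[A] M.carrier) (r : M.carrier →ₗ[A] M'.carrier),
    IsGradedHom M' M i ∧ IsGradedHom M M' r ∧ ∀ m, r (i m) = m

theorem IsGradedRetract.refl (M : GrModule.{u, v, w} 𝒜) : IsGradedRetract M M :=
  ⟨LinearMap.id, LinearMap.id, isGradedHom_id M, isGradedHom_id M, fun _ => rfl⟩

theorem isGradedRetract_of_bijective {M : GrModule.{u, v, w} 𝒜} {N : GrModule.{u, v, z} 𝒜}
    {f : M.carrier →ₗ[A] N.carrier} (hf : IsGradedHom M N f) (hb : Function.Bijective f) :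
    IsGradedRetract M N ∧ IsGradedRetract N M := by
  let e := LinearEquiv.ofBijective f hb
  have he : IsGradedHom N M e.symm.toLinearMap := by
    intro j n hn
    refine hf.mem_of_injective hb.1 ?_
    rwa [show f (e.symm.toLinearMap n) = n from e.apply_symm_apply n]
  exact ⟨⟨f, e.symm.toLinearMap, hf, he, e.symm_apply_apply⟩,
    ⟨e.symm.toLinearMap, f, he, hf, e.apply_symm_apply⟩⟩

theorem IsGradedRetract.locallyFinite {M' : GrModule.{u, v, w} 𝒜} {M : GrModule.{u, v, z} 𝒜}
    (h : IsGradedRetract M' M) (hM : M.LocallyFinite) : M'.LocallyFinite := by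
  obtain ⟨i, r, hi, hr, hri⟩ := h
  exact hM.of_surjective hr fun m => ⟨i m, hri m⟩

/-- On generators the difference of two lifts lies in degree `s`, where `π` is injective. This
rigidity plays the role of minimality of projective covers. -/
theorem IsCover.hom_ext {P : GrModule.{u, v, w} 𝒜} {M : GrModule.{u, v, z} 𝒜}
    {π : P.carrier →ₗ[A] M.carrier} {s : ℤ} (h : IsCover P M π s) {Q : GrModule 𝒜}
    (hQ : Q.GeneratedInDegree s) {f g : Q.carrier →ₗ[A] P.carrier} (hf : IsGradedHom Q P f)
    (hg : IsGradedHom Q P g) (hfg : ∀ q, π (f q) = π (g q)) : f = g := by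
  refine hQ.ext fun q hq => sub_eq_zero.1 (h.eq_zero _ (sub_mem (hf _ _ hq) (hg _ _ hq)) ?_)
  rw [map_sub, hfg, sub_self]

section

variable [GradedAlgebra 𝒜]

theorem IsCover.exists_lift {P : GrModule.{u, v, w} 𝒜} {M : GrModule.{u, v, z} 𝒜}
    {π : P.carrier →ₗ[A] M.carrier} {s : ℤ} (h : IsCover P M π s)
    {P' : GrModule 𝒜} {M' : GrModule 𝒜} {π' : P'.carrier →ₗ[A] M'.carrier}
    (h' : IsCover P' M' π' s) {f : M.carrier →ₗ[A] M'.carrier} (hf : IsGradedHom M M' f) :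
    ∃ F : P.carrier →ₗ[A] P'.carrier, IsGradedHom P P' F ∧ ∀ p, π' (F p) = f (π p) := by
  have := h.projective
  obtain ⟨F, hF, hc⟩ := exists_graded_lift h'.graded h'.surjective (P := P) (g := f ∘ₗ π)
    (fun j m hm => hf _ _ (h.graded _ _ hm))
  exact ⟨F, hF, fun p => LinearMap.congr_fun hc p⟩

/-- The inclusion and the retraction lift to the covers; the composite of the lifts lifts the
identity, so it is the identity by `IsCover.hom_ext`. Restricting to kernels gives the claim. For
`M' = M` it says that the kernel of a cover is independent of the cover, up to graded retracts. -/
theorem IsCover.ker_retract {P P' M M' : GrModule.{u, v, w} 𝒜}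
    {π : P.carrier →ₗ[A] M.carrier} {s : ℤ} (h : IsCover P M π s)
    {π' : P'.carrier →ₗ[A] M'.carrier} (h' : IsCover P' M' π' s) (hM : IsGradedRetract M' M) :
    IsGradedRetract (ker h'.graded) (ker h.graded) := by
  obtain ⟨i, r, hi, hr, hri⟩ := hM
  obtain ⟨I, hI, hIc⟩ := h'.exists_lift h hi
  obtain ⟨R, hR, hRc⟩ := h.exists_lift h' hr
  have hid : R ∘ₗ I = LinearMap.id := by
    refine h'.hom_ext h'.generated (fun j m hm => hR _ _ (hI _ _ hm)) (isGradedHom_id P') fun q => ?_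
    rw [LinearMap.comp_apply, hRc, hIc, hri]
    rfl
  refine ⟨P.subLift _ _ (I ∘ₗ kerι h'.graded) fun x => ?_,
    P'.subLift _ _ (R ∘ₗ kerι h.graded) fun x => ?_, ?_, ?_, ?_⟩
  · rw [LinearMap.mem_ker, LinearMap.comp_apply, hIc, apply_kerι, map_zero]
  · rw [LinearMap.mem_ker, LinearMap.comp_apply, hRc, apply_kerι, map_zero]
  · intro j m hm
    exact hI _ _ hm
  · intro j m hm
    exact hR _ _ hm
  · intro m
    apply P'.subι_injective
    exact LinearMap.congr_fun hid _

/-- The idempotent `i ∘ r` of `M` lifts to an endomorphism `E` of the cover. Both `E ∘ E` and `E`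
lift it, so `E` is idempotent, and its image covers the retract. -/
theorem IsCover.exists_retract {P M M' : GrModule.{u, v, w} 𝒜}
    {π : P.carrier →ₗ[A] M.carrier} {s : ℤ} (h : IsCover P M π s) (hM : IsGradedRetract M' M) :
    ∃ (P' : GrModule.{u, v, w} 𝒜) (π' : P'.carrier →ₗ[A] M'.carrier), IsCover P' M' π' s := by
  obtain ⟨i, r, hi, hr, hri⟩ := hM
  obtain ⟨E, hE, hEc⟩ := h.exists_lift h (f := i ∘ₗ r) (fun j m hm => hi _ _ (hr _ _ hm))
  simp only [LinearMap.comp_apply] at hEc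
  have hEE : E ∘ₗ E = E := by
    refine h.hom_ext h.generated (fun j m hm => hE _ _ (hE _ _ hm)) hE fun q => ?_
    simp only [LinearMap.comp_apply, hEc, hri]
  let P' := P.sub (LinearMap.range E) hE.isHomogeneous_range
  let ι : P'.carrier →ₗ[A] P.carrier := P.subι _ _
  let ρ : P.carrier →ₗ[A] P'.carrier := P.subLift _ _ E fun x => ⟨x, rfl⟩
  have hρ : IsGradedHom P P' ρ := fun j m hm => hE j m hm
  have hι : IsGradedHom P' P ι := P.isGradedHom_subι _ _
  have hEι : ∀ p, E (ι p) = ι p := by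
    intro p
    obtain ⟨q, hq⟩ := P.subι_mem _ _ p
    change E (P.subι _ _ p) = P.subι _ _ p
    rw [← hq]
    exact LinearMap.congr_fun hEE q
  have hρι : ∀ p, ρ (ι p) = p := fun p => P.subι_injective _ _ (hEι p)
  have hs : Function.Surjective ρ := fun p => ⟨ι p, hρι p⟩
  have := h.projective
  refine ⟨P', r ∘ₗ π ∘ₗ ι, ⟨Module.Projective.of_split ι ρ (LinearMap.ext hρι),
    h.locallyFinite.of_surjective hρ hs, h.generated.of_surjective hρ hs,
    fun j m hm => hr _ _ (h.graded _ _ (hι _ _ hm)), ?_, ?_⟩⟩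
  · intro m
    obtain ⟨p, hp⟩ := h.surjective (i m)
    refine ⟨ρ p, ?_⟩
    change r (π (E p)) = m
    rw [hEc, hri, hp, hri]
  · intro p hp h0
    apply P.subι_injective _ _
    rw [map_zero]
    refine h.eq_zero _ (hι _ _ hp) ?_
    change π (ι p) = 0
    rw [← hEι, hEc]
    rw [show r (π (ι p)) = 0 from h0, map_zero]

theorem LinearUpTo.retract {n : ℕ} {s : ℤ} {M M' : GrModule.{u, v, w} 𝒜} (h : LinearUpTo n s M)
    (hM : IsGradedRetract M' M) : LinearUpTo n s M' := by
  induction n generalizing s M M' with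
  | zero =>
    obtain ⟨i, r, hi, hr, hri⟩ := hM
    exact GeneratedInDegree.of_surjective h hr fun m => ⟨i m, hri m⟩
  | succ n ih =>
    obtain ⟨hg, P, π, hπ, hk⟩ := h
    obtain ⟨P', π', hπ'⟩ := hπ.exists_retract hM
    refine ⟨?_, P', π', hπ', ih hk (hπ.ker_retract hπ' hM)⟩
    obtain ⟨i, r, hi, hr, hri⟩ := hM
    exact GeneratedInDegree.of_surjective hg hr fun m => ⟨i m, hri m⟩

/-- The definition provides a linear kernel for one cover only; kernels of any two covers are
retracts of each other, which extends this to every cover. -/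
theorem LinearUpTo.ker_of_isCover {n : ℕ} {s : ℤ} {P M : GrModule.{u, v, w} 𝒜}
    (h : LinearUpTo (n + 1) s M) {π : P.carrier →ₗ[A] M.carrier} (hπ : IsCover P M π s) :
    LinearUpTo n (s + 1) (ker hπ.graded) := by
  obtain ⟨hg, P', π', hπ', hk⟩ := h
  exact hk.retract (hπ'.ker_retract hπ (IsGradedRetract.refl M))

theorem LinearUpTo.of_succ {n : ℕ} {s : ℤ} {M : GrModule.{u, v, w} 𝒜}
    (h : LinearUpTo (n + 1) s M) : LinearUpTo n s M := by
  induction n generalizing s M with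
  | zero => exact h.1
  | succ n ih =>
    obtain ⟨hg, P, π, hπ, hk⟩ := h
    exact ⟨hg, P, π, hπ, ih hk⟩

/-! ### Extensions -/

/-- Short exact sequences of graded modules. -/
structure IsGradedShortExact (L M N : GrModule.{u, v, w} 𝒜) (f : L.carrier →ₗ[A] M.carrier)
    (g : M.carrier →ₗ[A] N.carrier) : Prop where
  graded_left : IsGradedHom L M f
  graded_right : IsGradedHom M N g
  injective : Function.Injective f
  surjective : Function.Surjective g
  exact : Function.Exact f g

theorem prod_generated {M N : GrModule.{u, v, w} 𝒜} {s : ℤ} (hM : M.GeneratedInDegree s)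
    (hN : N.GeneratedInDegree s) : (M.prod N).GeneratedInDegree s := by
  rw [GeneratedInDegree, eq_top_iff]
  intro x _
  let i₁ : M.carrier →ₗ[A] (M.prod N).carrier := LinearMap.inl A M.carrier N.carrier
  let i₂ : N.carrier →ₗ[A] (M.prod N).carrier := LinearMap.inr A M.carrier N.carrier
  have h1 : IsGradedHom M (M.prod N) i₁ := fun j m hm => ⟨hm, zero_mem _⟩
  have h2 : IsGradedHom N (M.prod N) i₂ := fun j m hm => ⟨zero_mem _, hm⟩
  have h : i₁ x.1 + i₂ x.2 = x := Prod.ext (add_zero x.1) (zero_add x.2)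
  rw [← h]
  exact add_mem (hM.map_mem_span h1 _) (hN.map_mem_span h2 _)

theorem prod_locallyFinite {M N : GrModule.{u, v, w} 𝒜} (hM : M.LocallyFinite)
    (hN : N.LocallyFinite) : (M.prod N).LocallyFinite := by
  intro j
  have := hM j
  have := hN j
  let f : (M.prod N).gr j →ₗ[k] M.gr j × N.gr j :=
    { toFun := fun m => (⟨m.1.1, m.2.1⟩, ⟨m.1.2, m.2.2⟩), map_add' := fun _ _ => rfl,
      map_smul' := fun _ _ => rfl }
  exact Module.Finite.of_injective f fun x y h => Subtype.ext <| Prod.ext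
    (congrArg (fun z => z.1.1) h) (congrArg (fun z => z.2.1) h)

theorem IsGradedShortExact.generated {L M N : GrModule.{u, v, w} 𝒜}
    {f : L.carrier →ₗ[A] M.carrier} {g : M.carrier →ₗ[A] N.carrier}
    (h : IsGradedShortExact L M N f g) {s : ℤ} (hL : L.GeneratedInDegree s)
    (hN : N.GeneratedInDegree s) : M.GeneratedInDegree s := by
  rw [GeneratedInDegree, eq_top_iff]
  rintro m _
  have hgm : g m ∈ (Submodule.span A (M.gr s : Set M.carrier)).map g := by
    have : g m ∈ Submodule.span A (N.gr s : Set N.carrier) := by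
      rw [hN]
      trivial
    rw [Submodule.map_span]
    refine Submodule.span_mono ?_ this
    intro n hn
    obtain ⟨m, hm, rfl⟩ := h.graded_right.exists_preimage h.surjective hn
    exact ⟨m, hm, rfl⟩
  obtain ⟨m', hm', hmm⟩ := hgm
  have hd : g (m - m') = 0 := by rw [map_sub, hmm, sub_self]
  obtain ⟨l, hl⟩ := (h.exact _).1 hd
  have hfl := hL.map_mem_span h.graded_left l
  rw [hl] at hfl
  simpa using add_mem hfl hm'

/-- The horseshoe lemma for covers: `ρ` lifts to `t : Q → M`, and `P × Q` maps to `M` by `f ∘ π` and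
`t`. Injectivity in degree `s` is tested first in `N`, then in `L`. -/
theorem IsGradedShortExact.horseshoe {L M N P Q : GrModule.{u, v, w} 𝒜}
    {f : L.carrier →ₗ[A] M.carrier} {g : M.carrier →ₗ[A] N.carrier}
    (h : IsGradedShortExact L M N f g) {s : ℤ} {π : P.carrier →ₗ[A] L.carrier}
    {ρ : Q.carrier →ₗ[A] N.carrier} (hπ : IsCover P L π s) (hρ : IsCover Q N ρ s) :
    ∃ (σ : (P.prod Q).carrier →ₗ[A] M.carrier) (hσ : IsCover (P.prod Q) M σ s)
      (f' : (ker hπ.graded).carrier →ₗ[A] (ker hσ.graded).carrier)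
      (g' : (ker hσ.graded).carrier →ₗ[A] (ker hρ.graded).carrier),
      IsGradedShortExact _ _ _ f' g' := by
  have := hπ.projective
  have := hρ.projective
  obtain ⟨t, ht, htc⟩ := exists_graded_lift h.graded_right h.surjective hρ.graded
  replace htc : ∀ q, g (t q) = ρ q := fun q => LinearMap.congr_fun htc q
  have hgf : ∀ l, g (f l) = 0 := fun l => (h.exact _).2 ⟨l, rfl⟩
  let σ : P.carrier × Q.carrier →ₗ[A] M.carrier := (f ∘ₗ π).coprod t
  have hσ : IsCover (P.prod Q) M σ s := by
    refine ⟨inferInstanceAs (Module.Projective A (P.carrier × Q.carrier)),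
      prod_locallyFinite hπ.locallyFinite hρ.locallyFinite,
      prod_generated hπ.generated hρ.generated, ?_, ?_, ?_⟩
    · rintro j ⟨p, q⟩ ⟨hp, hq⟩
      exact add_mem (h.graded_left _ _ (hπ.graded _ _ hp)) (ht _ _ hq)
    · intro m
      obtain ⟨q, hq⟩ := hρ.surjective (g m)
      have : g (m - t q) = 0 := by rw [map_sub, htc, hq, sub_self]
      obtain ⟨l, hl⟩ := (h.exact _).1 this
      obtain ⟨p, rfl⟩ := hπ.surjective l
      refine ⟨(p, q), ?_⟩
      change f (π p) + t q = m
      rw [hl, sub_add_cancel]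
    · rintro ⟨p, q⟩ ⟨hp, hq⟩ h0
      change f (π p) + t q = 0 at h0
      have hq0 : q = 0 := by
        refine hρ.eq_zero q hq ?_
        have := congrArg g h0
        rwa [map_add, hgf, htc, zero_add, map_zero] at this
      subst hq0
      rw [map_zero, add_zero] at h0
      have hp0 : p = 0 := hπ.eq_zero p hp (h.injective (by rw [h0, map_zero]))
      subst hp0
      rfl
  refine ⟨σ, hσ, (P.prod Q).subLift _ _ (LinearMap.inl A P.carrier Q.carrier ∘ₗ kerι hπ.graded)
    fun x => ?_, Q.subLift _ _ (LinearMap.snd A P.carrier Q.carrier ∘ₗ kerι hσ.graded)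
    fun x => ?_, ?_, ?_, ?_, ?_, ?_⟩
  · change f (π (kerι hπ.graded x)) + t 0 = 0
    rw [apply_kerι, map_zero, map_zero, add_zero]
  · have hx : f (π (kerι hσ.graded x).1) + t (kerι hσ.graded x).2 = 0 := apply_kerι hσ.graded x
    have := congrArg g hx
    rwa [map_add, hgf, htc, zero_add, map_zero] at this
  · intro j m hm
    exact ⟨hm, zero_mem _⟩
  · intro j m hm
    exact hm.2
  · intro x y hxy
    apply P.subι_injective
    exact congrArg (fun z => (kerι hσ.graded z).1) hxy
  · intro y
    -- For `y` in the kernel of `ρ`, the element `t y` comes from `L`, hence from some `p`; the pair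
    -- `(-p, y)` then lies in the kernel of `σ`.
    have hy : g (t (kerι hρ.graded y)) = 0 := by rw [htc, apply_kerι]
    obtain ⟨l, hl⟩ := (h.exact _).1 hy
    obtain ⟨p, rfl⟩ := hπ.surjective l
    have hmem : σ (-p, kerι hρ.graded y) = 0 := by
      change f (π (-p)) + t (kerι hρ.graded y) = 0
      rw [map_neg, map_neg, hl, neg_add_cancel]
    exact ⟨⟨(-p, kerι hρ.graded y), hmem⟩, rfl⟩
  · intro x
    constructor
    · intro hx
      have h2 : (kerι hσ.graded x).2 = 0 := congrArg (kerι hρ.graded) hx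
      have h1 : f (π (kerι hσ.graded x).1) + t (kerι hσ.graded x).2 = 0 := apply_kerι hσ.graded x
      rw [h2, map_zero, add_zero] at h1
      refine ⟨⟨(kerι hσ.graded x).1, h.injective (by rw [h1, map_zero])⟩, ?_⟩
      apply (P.prod Q).subι_injective
      exact Prod.ext rfl h2.symm
    · rintro ⟨y, rfl⟩
      rfl

theorem IsGradedShortExact.linearUpTo {n : ℕ} {s : ℤ} {L M N : GrModule.{u, v, w} 𝒜}
    {f : L.carrier →ₗ[A] M.carrier} {g : M.carrier →ₗ[A] N.carrier}
    (h : IsGradedShortExact L M N f g) (hL : LinearUpTo n s L) (hN : LinearUpTo n s N) :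
    LinearUpTo n s M := by
  induction n generalizing s L M N with
  | zero => exact h.generated hL hN
  | succ n ih =>
    obtain ⟨hLg, P, π, hπ, hLk⟩ := hL
    obtain ⟨hNg, Q, ρ, hρ, hNk⟩ := hN
    obtain ⟨σ, hσ, f', g', h'⟩ := h.horseshoe hπ hρ
    exact ⟨h.generated hLg hNg, _, σ, hσ, ih h' hLk hNk⟩

/-- If graded modules have covers, the class of modules with linear resolutions is closed under
cokernels of monomorphisms. -/
theorem IsGradedShortExact.linearUpTo_right {s : ℤ} {n : ℕ}
    (hcov : ∀ (s : ℤ) (N : GrModule.{u, v, w} 𝒜), N.LocallyFinite → N.GeneratedInDegree s →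
      ∃ (P : GrModule.{u, v, w} 𝒜) (π : P.carrier →ₗ[A] N.carrier), IsCover P N π s)
    {L M N : GrModule.{u, v, w} 𝒜}
    {f : L.carrier →ₗ[A] M.carrier} {g : M.carrier →ₗ[A] N.carrier}
    (h : IsGradedShortExact L M N f g) (hlf : M.LocallyFinite) (hL : LinearUpTo n s L)
    (hM : LinearUpTo n s M) : LinearUpTo n s N := by
  induction n generalizing s L M N with
  | zero => exact GeneratedInDegree.of_surjective hM h.graded_right h.surjective
  | succ n ih =>
    have hNg := hM.1.of_surjective h.graded_right h.surjective
    -- Only `N` lacks a cover. Once `hcov` supplies one, the horseshoe produces a cover of `M`, and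
    -- its kernel is linear because `M` is and kernels do not depend on the cover.
    obtain ⟨Q, ρ, hρ⟩ := hcov s N (hlf.of_surjective h.graded_right h.surjective) hNg
    obtain ⟨hLg, P, π, hπ, hLk⟩ := hL
    obtain ⟨σ, hσ, f', g', h'⟩ := h.horseshoe hπ hρ
    exact ⟨hNg, Q, ρ, hρ, ih h'
      (hσ.locallyFinite.of_injective (isGradedHom_subι _ _ _) (subι_injective _ _ _))
      hLk (hM.ker_of_isCover hσ)⟩

/-- The kernel of the composite of a cover with another one. -/
theorem IsCover.comp_shortExact {P Q M : GrModule.{u, v, w} 𝒜} {s : ℤ}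
    {π : Q.carrier →ₗ[A] P.carrier} {ρ : P.carrier →ₗ[A] M.carrier} (hπ : IsCover Q P π s)
    (hρ : IsGradedHom P M ρ) (hs : Function.Surjective ρ) (h0 : ∀ p ∈ P.gr s, ρ p = 0 → p = 0) :
    ∃ (hc : IsCover Q M (ρ ∘ₗ π) s)
      (f : (ker hπ.graded).carrier →ₗ[A] (ker hc.graded).carrier)
      (g : (ker hc.graded).carrier →ₗ[A] (ker hρ).carrier), IsGradedShortExact _ _ _ f g := by
  have hc : IsCover Q M (ρ ∘ₗ π) s := ⟨hπ.projective, hπ.locallyFinite, hπ.generated,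
    fun j m hm => hρ _ _ (hπ.graded _ _ hm), hs.comp hπ.surjective,
    fun q hq hq0 => hπ.eq_zero q hq (h0 _ (hπ.graded _ _ hq) hq0)⟩
  refine ⟨hc, Q.subLift _ _ (kerι hπ.graded) fun x => ?_,
    P.subLift _ _ (π ∘ₗ kerι hc.graded) fun x => apply_kerι hc.graded x, ?_, ?_, ?_, ?_, ?_⟩
  · rw [LinearMap.mem_ker, LinearMap.comp_apply, apply_kerι, map_zero]
  · exact fun j m hm => hm
  · exact fun j m hm => hπ.graded _ _ hm
  · exact fun x y hxy => Q.subι_injective _ _ (congrArg (kerι hc.graded) hxy)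
  · intro y
    obtain ⟨q, hq⟩ := hπ.surjective (kerι hρ y)
    refine ⟨⟨q, ?_⟩, P.subι_injective _ _ hq⟩
    change ρ (π q) = 0
    rw [hq, apply_kerι]
  · intro x
    constructor
    · intro hx
      exact ⟨⟨kerι hc.graded x, congrArg (kerι hρ) hx⟩, rfl⟩
    · rintro ⟨y, rfl⟩
      exact P.subι_injective _ _ (apply_kerι hπ.graded y)

/-! ### Products, shifts, projective modules -/

theorem linearUpTo_of_subsingleton (n : ℕ) (s : ℤ) (M : GrModule.{u, v, w} 𝒜)
    [Subsingleton M.carrier] : LinearUpTo n s M := by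
  have hg : ∀ s, ∀ M : GrModule.{u, v, w} 𝒜, Subsingleton M.carrier → M.GeneratedInDegree s :=
    fun s M _ => Subsingleton.elim _ _
  induction n generalizing s M with
  | zero => exact hg s M inferInstance
  | succ n ih =>
    have hc : IsCover M M LinearMap.id s := ⟨inferInstance, fun j => inferInstance,
      hg s M inferInstance, isGradedHom_id M, fun m => ⟨m, rfl⟩, fun p _ _ => Subsingleton.elim _ _⟩
    have : Subsingleton (ker hc.graded).carrier := (M.subι_injective _ _).subsingleton
    exact ⟨hc.generated, M, _, hc, ih _ _⟩

theorem linearUpTo_of_projective (n : ℕ) {s : ℤ} {M : GrModule.{u, v, w} 𝒜}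
    (hp : Module.Projective A M.carrier) (hf : M.LocallyFinite) (hg : M.GeneratedInDegree s) :
    LinearUpTo n s M := by
  cases n with
  | zero => exact hg
  | succ n =>
    have hc : IsCover M M LinearMap.id s := ⟨hp, hf, hg, isGradedHom_id M, fun m => ⟨m, rfl⟩,
      fun p _ h => h⟩
    have : Subsingleton (ker hc.graded).carrier :=
      ⟨fun x y => M.subι_injective _ _ ((apply_kerι hc.graded x).trans
        (apply_kerι hc.graded y).symm)⟩
    exact ⟨hg, M, _, hc, linearUpTo_of_subsingleton _ _ _⟩

theorem pi_generated {ι : Type z} [Finite ι] {M : ι → GrModule.{u, v, w} 𝒜} {s : ℤ}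
    (hM : ∀ i, (M i).GeneratedInDegree s) : (pi M).GeneratedInDegree s := by
  classical
  have := Fintype.ofFinite ι
  rw [GeneratedInDegree, eq_top_iff]
  intro m _
  let f : ∀ i, (M i).carrier →ₗ[A] (pi M).carrier := fun i =>
    LinearMap.single A (fun i => (M i).carrier) i
  have h1 : ∀ i, IsGradedHom (M i) (pi M) (f i) := by
    intro i j x hx l _
    by_cases hl : l = i
    · subst hl
      change (Pi.single l x : ∀ i, (M i).carrier) l ∈ _
      rwa [Pi.single_eq_same]
    · change (Pi.single i x : ∀ i, (M i).carrier) l ∈ _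
      rw [Pi.single_eq_of_ne hl]
      exact zero_mem _
  have h2 : m = ∑ i, f i (m i) :=
    (LinearMap.sum_single_apply (φ := fun i => (M i).carrier) m).symm
  rw [h2]
  exact sum_mem fun i _ => (hM i).map_mem_span (h1 i) (m i)

theorem pi_locallyFinite {ι : Type z} [Finite ι] {M : ι → GrModule.{u, v, w} 𝒜}
    (hM : ∀ i, (M i).LocallyFinite) : (pi M).LocallyFinite := by
  intro j
  have := fun i => hM i j
  let f : (pi M).gr j →ₗ[k] (∀ i, (M i).gr j) :=
    { toFun := fun m i => ⟨m.1 i, m.2 i trivial⟩, map_add' := fun _ _ => rfl,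
      map_smul' := fun _ _ => rfl }
  exact Module.Finite.of_injective f fun x y h => Subtype.ext <| funext fun i =>
    congrArg Subtype.val (congrFun h i)

theorem pi_isCover {ι : Type z} [Finite ι] {P M : ι → GrModule.{u, v, w} 𝒜} {s : ℤ}
    {π : ∀ i, (P i).carrier →ₗ[A] (M i).carrier} (h : ∀ i, IsCover (P i) (M i) (π i) s) :
    IsCover (pi P) (pi M) (LinearMap.pi fun i => π i ∘ₗ LinearMap.proj i) s := by
  have := fun i => (h i).projective
  have := Fintype.ofFinite ι
  classical
  refine ⟨?_, pi_locallyFinite fun i => (h i).locallyFinite, pi_generated fun i => (h i).generated,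
    ?_, ?_, ?_⟩
  · exact Module.Projective.of_equiv
      (DFinsupp.linearEquivFunOnFintype (R := A) (M := fun i => (P i).carrier))
  · exact fun j m hm i _ => (h i).graded _ _ (hm i trivial)
  · intro m
    choose p hp using fun i => (h i).surjective (m i)
    exact ⟨p, funext hp⟩
  · exact fun p hp h0 => funext fun i => (h i).eq_zero _ (hp i trivial) (congrFun h0 i)

theorem LinearUpTo.pi {ι : Type z} [Finite ι] {n : ℕ} {M : ι → GrModule.{u, v, w} 𝒜} {s : ℤ}
    (h : ∀ i, LinearUpTo n s (M i)) : LinearUpTo n s (pi M) := by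
  induction n generalizing s M with
  | zero => exact pi_generated h
  | succ n ih =>
    choose hg P π hπ hk using h
    refine ⟨pi_generated hg, GrModule.pi P, _, pi_isCover hπ, (ih hk).retract ?_⟩
    -- The product of the kernels is only isomorphic to the kernel of the product map; this
    -- isomorphism transports linearity.
    let f : (GrModule.pi fun i => ker (hπ i).graded).carrier →ₗ[A] (GrModule.pi P).carrier :=
      LinearMap.pi fun i => kerι (hπ i).graded ∘ₗ LinearMap.proj i
    let F := (GrModule.pi P).subLift _ (pi_isCover hπ).graded.isHomogeneous_ker f
      fun x => funext fun i => apply_kerι (hπ i).graded (x i)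
    have hF : IsGradedHom (GrModule.pi fun i => ker (hπ i).graded)
        (ker (pi_isCover hπ).graded) F := fun j m hm i _ => hm i trivial
    refine (isGradedRetract_of_bijective hF ⟨?_, ?_⟩).2
    · intro x y hxy
      have : f x = f y := congrArg (kerι (pi_isCover hπ).graded) hxy
      exact funext fun i => (P i).subι_injective _ _ (congrFun this i)
    · intro y
      exact ⟨fun i => ⟨kerι (pi_isCover hπ).graded y i,
        congrFun (apply_kerι (pi_isCover hπ).graded y) i⟩, rfl⟩

theorem GeneratedInDegree.shift {M : GrModule.{u, v, w} 𝒜} {s : ℤ}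
    (h : M.GeneratedInDegree s) (t : ℤ) : (M.shift t).GeneratedInDegree (s + t) := by
  change Submodule.span A (M.gr (s + t - t) : Set M.carrier) = ⊤
  rw [add_sub_cancel_right]
  exact h

theorem IsCover.shift {P M : GrModule.{u, v, w} 𝒜} {π : P.carrier →ₗ[A] M.carrier} {s : ℤ}
    (h : IsCover P M π s) (t : ℤ) :
    IsCover (P.shift t) (M.shift t) (show P.carrier →ₗ[A] M.carrier from π) (s + t) := by
  refine ⟨h.projective, fun j => h.locallyFinite _, h.generated.shift t,
    fun j m hm => h.graded _ m hm, h.surjective, fun p hp => h.eq_zero p ?_⟩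
  change p ∈ P.gr (s + t - t) at hp
  rwa [add_sub_cancel_right] at hp

theorem LinearUpTo.shift {n : ℕ} {M : GrModule.{u, v, w} 𝒜} {s : ℤ} (h : LinearUpTo n s M)
    (t : ℤ) : LinearUpTo n (s + t) (M.shift t) := by
  induction n generalizing s M with
  | zero => exact GeneratedInDegree.shift h t
  | succ n ih =>
    obtain ⟨hg, P, π, hπ, hk⟩ := h
    refine ⟨hg.shift t, P.shift t, _, hπ.shift t, ?_⟩
    rw [add_right_comm]
    refine (ih hk).retract ?_
    let f : ((ker hπ.graded).shift t).carrier →ₗ[A] (P.shift t).carrier := kerι hπ.graded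
    have hF : IsGradedHom ((ker hπ.graded).shift t) (ker (hπ.shift t).graded)
        ((P.shift t).subLift _ _ f fun x => apply_kerι hπ.graded x) := fun j m hm => hm
    refine (isGradedRetract_of_bijective hF ⟨?_, ?_⟩).2
    · intro x y hxy
      have : f x = f y := congrArg (kerι (hπ.shift t).graded) hxy
      exact P.subι_injective _ _ this
    · intro y
      exact ⟨⟨kerι (hπ.shift t).graded y, apply_kerι (hπ.shift t).graded y⟩, rfl⟩

end

end GrModule

namespace GrModule

variable {k : Type u} [Field k] {A : Type v} [Ring A] [Algebra k A] {𝒜 : ℕ → Submodule k A}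
  [GradedAlgebra 𝒜]

/-! ### Koszul modules are the modules with linear resolutions -/

/-- In a linear resolution the augmentation is automatically injective in degree `s`: its kernel is
the image of the next term, which starts in degree `s + 1`. So the first term is a cover, and the
remaining terms resolve its kernel. -/
theorem linearUpTo_of_resolution (n : ℕ) {s : ℤ} {M : GrModule.{u, v, w} 𝒜}
    (P : ℕ → GrModule.{u, v, w} 𝒜) (d : ∀ i : ℕ, (P (i + 1)).carrier →ₗ[A] (P i).carrier)
    (ε : (P 0).carrier →ₗ[A] M.carrier) (hp : ∀ i, Module.Projective A (P i).carrier)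
    (hf : ∀ i, (P i).LocallyFinite) (hg : ∀ i : ℕ, (P i).GeneratedInDegree (s + i))
    (hd : ∀ i, IsGradedHom (P (i + 1)) (P i) (d i)) (hε : IsGradedHom (P 0) M ε)
    (hs : Function.Surjective ε) (h0 : Function.Exact (d 0) ε)
    (he : ∀ i, Function.Exact (d (i + 1)) (d i)) : LinearUpTo n s M := by
  have hg0 : (P 0).GeneratedInDegree s := by simpa using hg 0
  induction n generalizing s M P with
  | zero => exact hg0.of_surjective hε hs
  | succ n ih =>
    have hc : IsCover (P 0) M ε s := by
      refine ⟨hp 0, hf 0, hg0, hε, hs, fun p hps hp0 => ?_⟩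
      obtain ⟨q, rfl⟩ := (h0 p).1 hp0
      rw [← (P 0).proj_of_mem hps, ← (hd 0).proj_apply, (hg 1).proj_eq_zero (by simp), map_zero]
    refine ⟨hg0.of_surjective hε hs, P 0, ε, hc, ?_⟩
    refine ih (fun i => P (i + 1)) (fun i => d (i + 1))
      ((P 0).subLift _ _ (d 0) fun x => (h0 _).2 ⟨x, rfl⟩) (fun i => hp _) (fun i => hf _)
      (fun i => ?_) (fun i => hd _) (fun j m hm => hd 0 _ _ hm) ?_ ?_ (fun i => he _) ?_
    · have := hg (i + 1)
      rwa [Nat.cast_add, Nat.cast_one, add_comm (i : ℤ), ← add_assoc] at this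
    · intro y
      obtain ⟨x, hx⟩ := (h0 _).1 (apply_kerι hc.graded y)
      exact ⟨x, (P 0).subι_injective _ _ hx⟩
    · intro x
      rw [← he 0 x]
      exact ⟨fun h => congrArg (kerι hc.graded) h, fun h => (P 0).subι_injective _ _ h⟩
    · simpa using hg 1

/-- Covers of successive kernels are spliced into a resolution by dependent choice inside a class
`X` that contains the kernel of some cover of each of its members. The module `N` is a copy of `M`
in the universe where resolutions live. -/
theorem isKoszul_of_cover_closed {M : GrModule.{u, v, w} 𝒜}
    (X : ℤ → GrModule.{u, v, max v w} 𝒜 → Prop)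
    (h : ∀ s N, X s N → ∃ (P : GrModule.{u, v, max v w} 𝒜) (π : P.carrier →ₗ[A] N.carrier)
      (hc : IsCover P N π s), X (s + 1) (ker hc.graded))
    {N : GrModule.{u, v, max v w} 𝒜} (hN : X 0 N) {f : N.carrier →ₗ[A] M.carrier}
    (hf : IsGradedHom N M f) (hb : Function.Bijective f) : M.IsKoszul := by
  let T := { x : ℤ × GrModule.{u, v, max v w} 𝒜 // X x.1 x.2 }
  choose P π hc hk using fun x : T => h x.1.1 x.1.2 x.2
  -- The `n`-th syzygy, bundled with its generating degree and the proof that it lies in `X`.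
  let st : ℕ → T := fun n => Nat.rec ⟨(0, N), hN⟩ (fun _ x => ⟨(x.1.1 + 1, _), hk x⟩) n
  have hst : ∀ n : ℕ, (st n).1.1 = n := by
    intro n
    induction n with
    | zero => rfl
    | succ n ih =>
      change (st n).1.1 + 1 = _
      rw [ih, Nat.cast_add, Nat.cast_one]
  let ε : (P (st 0)).carrier →ₗ[A] N.carrier := π (st 0)
  let d : ∀ n, (P (st (n + 1))).carrier →ₗ[A] (P (st n)).carrier :=
    fun n => kerι (hc (st n)).graded ∘ₗ π (st (n + 1))
  have hε : IsCover (P (st 0)) N ε 0 := hc (st 0)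
  have hrange : ∀ n, Function.Exact (d n) (π (st n)) := by
    intro n x
    constructor
    · intro hx
      obtain ⟨y, hy⟩ := (hc (st (n + 1))).surjective ⟨x, hx⟩
      exact ⟨y, congrArg (kerι (hc (st n)).graded) hy⟩
    · rintro ⟨y, rfl⟩
      exact apply_kerι (hc (st n)).graded _
  refine ⟨(hε.generated.of_surjective hε.graded hε.surjective).of_surjective hf hb.2,
    fun n => P (st n), d, f ∘ₗ ε, fun n => (hc _).projective, fun n => (hc _).locallyFinite,
    fun n => ?_, fun n j m hm => (hc (st (n + 1))).graded j m hm,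
    fun j m hm => hf _ _ (hε.graded _ _ hm), hb.2.comp hε.surjective, ?_, ?_⟩
  · have := (hc (st n)).generated
    rwa [hst] at this
  · intro x
    rw [← hrange 0 x]
    exact map_eq_zero_iff f hb.1
  · intro n x
    rw [← hrange (n + 1) x]
    exact ⟨fun hx => (P (st n)).subι_injective _ (hc (st n)).graded.isHomogeneous_ker hx,
      fun hx => by
      exact (congrArg (kerι (hc (st n)).graded) hx).trans (map_zero _)⟩

/-- A resolution truncates to every stage by `linearUpTo_of_resolution`. Conversely, the modules
linear to every stage form a class closed under kernels of covers, since one cover serves all stages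
by `LinearUpTo.ker_of_isCover`; `isKoszul_of_cover_closed` then splices. -/
theorem isKoszul_iff_linearUpTo {M : GrModule.{u, v, w} 𝒜} {N : GrModule.{u, v, max v w} 𝒜}
    {f : N.carrier →ₗ[A] M.carrier} (hf : IsGradedHom N M f) (hb : Function.Bijective f) :
    M.IsKoszul ↔ ∀ n, LinearUpTo n 0 N := by
  constructor
  · rintro ⟨hg, P, d, ε, hp, hlf, hPg, hd, hε, hs, h0, he⟩ n
    obtain ⟨i, r, hi, hr, hri⟩ := (isGradedRetract_of_bijective hf hb).2
    have hi' : Function.Injective i := fun x y hxy => by rw [← hri x, hxy, hri]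
    have hfs := (isGradedRetract_of_bijective hf hb).1
    let e := LinearEquiv.ofBijective f hb
    have he' : IsGradedHom M N e.symm.toLinearMap := by
      intro j n hn
      refine hf.mem_of_injective hb.1 ?_
      rwa [show f (e.symm.toLinearMap n) = n from e.apply_symm_apply n]
    refine linearUpTo_of_resolution n P d (e.symm.toLinearMap ∘ₗ ε) hp hlf
      (fun i => by simpa using hPg i) hd (fun j m hm => he' _ _ (hε _ _ hm))
      (e.symm.surjective.comp hs) ?_ he
    intro x
    rw [← h0 x]
    exact e.symm.map_eq_zero_iff
  · intro h
    refine isKoszul_of_cover_closed (fun s N => ∀ n, LinearUpTo n s N) ?_ h hf hb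
    intro s N hN
    obtain ⟨hg, P, π, hπ, -⟩ := hN 1
    exact ⟨P, π, hπ, fun n => (hN (n + 1)).ker_of_isCover hπ⟩

/-! ### Free modules and existence of covers -/

/-- The homogeneous component of degree `j`, as a module over `A_0`. -/
def comp (M : GrModule.{u, v, w} 𝒜) (j : ℤ) : Submodule (DegreeZeroRing 𝒜) M.carrier where
  carrier := M.gr j
  add_mem' := add_mem
  zero_mem' := zero_mem _
  smul_mem' r m hm := by
    have := M.smul_mem 0 j r.1 m r.2 hm
    rwa [Nat.cast_zero, zero_add] at this

theorem intGrading_smul_mem (M : GrModule.{u, v, w} 𝒜) {i j l : ℤ} {a : A}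
    (ha : a ∈ intGrading 𝒜 i) {m : M.carrier} (hm : m ∈ M.gr j) (h : i + j = l) :
    a • m ∈ M.gr l := by
  subst h
  by_cases h : 0 ≤ i
  · obtain ⟨n, rfl⟩ := Int.eq_ofNat_of_zero_le h
    rw [intGrading_natCast] at ha
    exact M.smul_mem n j a m ha hm
  · rw [intGrading_of_neg 𝒜 (by omega), Submodule.mem_bot] at ha
    rw [ha, zero_smul]
    exact zero_mem _

variable (𝒜) in
/-- The free graded module on a finite set of generators of degree `s`. -/
def free (ι : Type z) [Finite ι] (s : ℤ) : GrModule.{u, v, max z v} 𝒜 :=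
  pi fun _ : ι => (selfModule 𝒜).shift s

/-- An element of the regular module as an element of `A`. -/
def selfVal : (selfModule 𝒜).carrier ≃ₗ[A] A := LinearEquiv.refl A A

theorem selfModule_generated : (selfModule 𝒜).GeneratedInDegree 0 := by
  rw [GeneratedInDegree, eq_top_iff]
  intro a _
  have h : (1 : A) ∈ (selfModule 𝒜).gr 0 := by
    change (1 : A) ∈ intGrading 𝒜 ((0 : ℕ) : ℤ)
    rw [intGrading_natCast]
    exact SetLike.GradedOne.one_mem
  have := Submodule.smul_mem _ (selfVal a) (Submodule.subset_span h)
  have h1 : selfVal a • (show (selfModule 𝒜).carrier from (1 : A)) = a := mul_one (selfVal a)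
  exact h1 ▸ this

theorem selfModule_locallyFinite (hA : ∀ i, Module.Finite k (𝒜 i)) :
    (selfModule 𝒜).LocallyFinite := by
  intro j
  change Module.Finite k (intGrading 𝒜 j)
  by_cases h : 0 ≤ j
  · rw [intGrading, if_pos h]
    exact hA _
  · rw [intGrading, if_neg h]
    infer_instance

theorem free_projective (ι : Type z) [Finite ι] (s : ℤ) :
    Module.Projective A (free 𝒜 ι s).carrier :=
  inferInstanceAs (Module.Projective A (ι → A))

theorem free_locallyFinite (hA : ∀ i, Module.Finite k (𝒜 i)) (ι : Type z) [Finite ι] (s : ℤ) :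
    (free 𝒜 ι s).LocallyFinite :=
  pi_locallyFinite fun _ j => selfModule_locallyFinite hA (j - s)

theorem free_generated (ι : Type z) [Finite ι] (s : ℤ) :
    (free 𝒜 ι s).GeneratedInDegree s := by
  refine pi_generated fun _ => ?_
  have := (selfModule_generated (𝒜 := 𝒜)).shift s
  rwa [zero_add] at this

/-- The map out of a free module given by the images of the generators. -/
def freeHom {ι : Type z} [Fintype ι] (s : ℤ) (M : GrModule.{u, v, w} 𝒜) (b : ι → M.carrier) :
    (free 𝒜 ι s).carrier →ₗ[A] M.carrier :=
  Fintype.linearCombination A b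

theorem isGradedHom_freeHom {ι : Type z} [Fintype ι] (s : ℤ) (M : GrModule.{u, v, w} 𝒜)
    (b : ι → M.carrier) (hb : ∀ i, b i ∈ M.gr s) :
    IsGradedHom (free 𝒜 ι s) M (freeHom s M b) := fun j f hf =>
  sum_mem fun i _ => M.intGrading_smul_mem (hf i trivial) (hb i) (by omega)

/-- A finite-dimensional homogeneous component is finitely generated over `A_0`. -/
theorem finite_comp (M : GrModule.{u, v, z} 𝒜) (s : ℤ) [Module.Finite k (M.gr s)] :
    Module.Finite (DegreeZeroRing 𝒜) (M.comp s) := by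
  obtain ⟨n, e, he⟩ := Module.Finite.exists_fin (R := k) (M := M.gr s)
  let e' : Fin n → M.comp s := e
  classical
  refine ⟨⟨Finset.univ.image e', ?_⟩⟩
  rw [eq_top_iff, Finset.coe_image, Finset.coe_univ, Set.image_univ]
  intro x _
  have hx : (show M.gr s from x) ∈ Submodule.span k (Set.range e) := by
    rw [he]
    trivial
  obtain ⟨c, hc⟩ := (Submodule.mem_span_range_iff_exists_fun k).1 hx
  refine (Submodule.mem_span_range_iff_exists_fun _).2
    ⟨fun i => ⟨algebraMap k A (c i), SetLike.algebraMap_mem_graded 𝒜 _⟩, Subtype.ext ?_⟩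
  rw [Submodule.coe_sum]
  have h2 := congrArg (M.gr s).subtype hc
  rw [map_sum] at h2
  refine Eq.trans (Finset.sum_congr rfl fun i _ => ?_) h2
  exact algebraMap_smul A (c i) (e i : M.carrier)

theorem exists_generators (M : GrModule.{u, v, z} 𝒜) (s : ℤ) [Module.Finite k (M.gr s)] :
    ∃ (n : ℕ) (b : ULift.{w} (Fin n) → M.comp s), ∀ x : M.comp s,
      ∃ c : ULift.{w} (Fin n) → DegreeZeroRing 𝒜, ∑ i, c i • b i = x := by
  have := M.finite_comp s
  obtain ⟨n, e, he⟩ := Module.Finite.exists_fin (R := DegreeZeroRing 𝒜) (M := M.comp s)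
  refine ⟨n, fun i => e i.down, fun x => ?_⟩
  have hx : x ∈ Submodule.span (DegreeZeroRing 𝒜) (Set.range e) := by
    rw [he]
    trivial
  obtain ⟨c, hc⟩ := (Submodule.mem_span_range_iff_exists_fun _).1 hx
  exact ⟨fun i => c i.down, (Fintype.sum_equiv Equiv.ulift _ _ fun i => rfl).trans hc⟩

/-- A projective homogeneous component has a finite dual basis. -/
theorem exists_dual_basis (M : GrModule.{u, v, z} 𝒜) (s : ℤ) [Module.Finite k (M.gr s)]
    [Module.Projective (DegreeZeroRing 𝒜) (M.comp s)] :
    ∃ (n : ℕ) (b : ULift.{w} (Fin n) → M.carrier)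
      (c : M.comp s →ₗ[DegreeZeroRing 𝒜] (ULift.{w} (Fin n) → DegreeZeroRing 𝒜)),
      (∀ i, b i ∈ M.gr s) ∧ ∀ x : M.comp s, ∑ i, (c x i : A) • b i = x := by
  obtain ⟨n, b, hb⟩ := exists_generators.{u, v, w} M s
  let p : (ULift.{w} (Fin n) → DegreeZeroRing 𝒜) →ₗ[DegreeZeroRing 𝒜] M.comp s :=
    Fintype.linearCombination (DegreeZeroRing 𝒜) b
  obtain ⟨c, hc⟩ := Module.projective_lifting_property p LinearMap.id hb
  refine ⟨n, fun i => b i, c, fun i => (b i).2, fun x => ?_⟩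
  have h1 : p (c x) = x := LinearMap.congr_fun hc x
  have h2 : p (c x) = ∑ i, c x i • b i := rfl
  rw [h2] at h1
  have h3 := congrArg Subtype.val h1
  rwa [Submodule.coe_sum] at h3

/-- The cover is `A ⊗_{A_0} M_s`, realised inside a free module. A finite dual basis makes `M_s` a
summand of `A_0^n`; the same idempotent matrix acts on `A^n` as `E`, and the image of `E` is the
cover. -/
theorem exists_isCover (hA : ∀ i, Module.Finite k (𝒜 i)) (s : ℤ)
    (M : GrModule.{u, v, max v w} 𝒜) (hlf : M.LocallyFinite) (hg : M.GeneratedInDegree s)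
    (hp : Module.Projective (DegreeZeroRing 𝒜) (M.comp s)) :
    ∃ (P : GrModule.{u, v, max v w} 𝒜) (π : P.carrier →ₗ[A] M.carrier), IsCover P M π s := by
  have := hlf s
  obtain ⟨n, b, c, hb, hbc⟩ := exists_dual_basis.{u, v, w} M s
  let F := free 𝒜 (ULift.{w} (Fin n)) s
  let Φ : F.carrier →ₗ[A] M.carrier := freeHom s M b
  have hΦ : IsGradedHom F M Φ := isGradedHom_freeHom s M b hb
  let coe : (ULift.{w} (Fin n) → DegreeZeroRing 𝒜) → F.carrier := fun r i => (r i : A)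
  have hcoe : ∀ r, coe r ∈ F.gr s := by
    intro r i _
    change (r i : A) ∈ intGrading 𝒜 (s - s)
    rw [sub_self, ← Nat.cast_zero, intGrading_natCast]
    exact (r i).2
  let E : F.carrier →ₗ[A] F.carrier := freeHom s F fun i => coe (c ⟨b i, hb i⟩)
  have hE : IsGradedHom F F E := isGradedHom_freeHom s F _ fun i => hcoe _
  have hsum : ∀ r : ULift.{w} (Fin n) → DegreeZeroRing 𝒜,
      Φ (coe r) = (∑ i, r i • (⟨b i, hb i⟩ : M.comp s) : M.comp s) := by
    intro r
    rw [Submodule.coe_sum]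
    rfl
  have hEcoe : ∀ r : ULift.{w} (Fin n) → DegreeZeroRing 𝒜,
      E (coe r) = coe (c (∑ i, r i • (⟨b i, hb i⟩ : M.comp s))) := by
    intro r
    rw [map_sum]
    refine funext fun l => ?_
    change (∑ i, (r i : A) • coe (c ⟨b i, hb i⟩)) l = ((∑ i, c (r i • ⟨b i, hb i⟩)) l : A)
    simp only [map_smul]
    rw [Finset.sum_apply, AddSubmonoidClass.coe_finsetSum]
    exact Finset.sum_apply _ _ _
  have hcc : ∀ x : M.comp s, (∑ i, c x i • (⟨b i, hb i⟩ : M.comp s)) = x := by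
    intro x
    apply Subtype.ext
    rw [Submodule.coe_sum]
    exact hbc x
  have hEf : ∀ f : ULift.{w} (Fin n) → A, E f = ∑ i, f i • coe (c ⟨b i, hb i⟩) := fun f => rfl
  have hEE : ∀ f : ULift.{w} (Fin n) → A, E (E f) = E f := by
    intro f
    rw [hEf f, map_sum]
    refine Finset.sum_congr rfl fun i _ => ?_
    exact (E.map_smul (f i) _).trans (by rw [hEcoe, hcc])
  have hΦE : ∀ f : ULift.{w} (Fin n) → A, Φ (E f) = Φ f := by
    intro f
    rw [hEf f, map_sum]
    refine Finset.sum_congr rfl fun i _ => ?_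
    exact (Φ.map_smul (f i) _).trans (by rw [hsum, hcc])
  have hΦs : Function.Surjective Φ := by
    rw [← LinearMap.range_eq_top, eq_top_iff, ← hg, Submodule.span_le]
    intro x hx
    exact ⟨coe (c ⟨x, hx⟩), by rw [hsum, hcc]⟩
  let P := F.sub (LinearMap.range E) hE.isHomogeneous_range
  let ι : P.carrier →ₗ[A] F.carrier := F.subι _ _
  let ρ : F.carrier →ₗ[A] P.carrier := F.subLift _ _ E fun x => ⟨x, rfl⟩
  have hρ : IsGradedHom F P ρ := fun j m hm => hE j m hm
  have hι : IsGradedHom P F ι := F.isGradedHom_subι _ _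
  have hEι : ∀ p, E (ι p) = ι p := by
    intro p
    obtain ⟨q, hq⟩ := F.subι_mem _ _ p
    change E (F.subι _ _ p) = F.subι _ _ p
    rw [← hq]
    exact hEE q
  have hρι : ∀ p, ρ (ι p) = p := fun p => F.subι_injective _ _ (hEι p)
  have hs : Function.Surjective ρ := fun p => ⟨ι p, hρι p⟩
  have := free_projective (𝒜 := 𝒜) (ULift.{w} (Fin n)) s
  refine ⟨P, Φ ∘ₗ ι, ⟨Module.Projective.of_split ι ρ (LinearMap.ext hρι),
    (free_locallyFinite hA _ s).of_surjective hρ hs, (free_generated _ s).of_surjective hρ hs,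
    fun j m hm => hΦ _ _ (hι _ _ hm), ?_, ?_⟩⟩
  · intro m
    obtain ⟨f, rfl⟩ := hΦs m
    exact ⟨ρ f, hΦE f⟩
  · intro p hps h0
    apply F.subι_injective _ _
    rw [map_zero]
    -- In degree `s` the coordinates lie in `A_0`, so the value of `E` depends only on the image in
    -- `M_s` through `c`. If that image vanishes, so does `E (ι p)`, which equals `ι p`.
    have hp0 : ∀ i, (show ULift.{w} (Fin n) → A from ι p) i ∈ 𝒜 0 := by
      intro i
      have := hι _ _ hps i trivial
      change _ ∈ intGrading 𝒜 (s - s) at this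
      rwa [sub_self, ← Nat.cast_zero, intGrading_natCast] at this
    have hr : ι p = coe fun i => ⟨_, hp0 i⟩ := rfl
    change Φ (ι p) = 0 at h0
    have h1 : E (ι p) = 0 := by
      rw [hr] at h0 ⊢
      rw [hsum] at h0
      rw [hEcoe]
      refine (congrArg (fun t => coe (c t)) (Submodule.coe_eq_zero.1 h0)).trans ?_
      rw [map_zero]
      rfl
    rw [← h1]
    exact (hEι p).symm

/-- A graded projective module generated in one degree is a summand of a free one. -/
theorem isGradedRetract_free (s : ℤ) (P : GrModule.{u, v, z} 𝒜) (hp : Module.Projective A P.carrier)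
    (hlf : P.LocallyFinite) (hg : P.GeneratedInDegree s) :
    ∃ n : ℕ, IsGradedRetract P (free 𝒜 (ULift.{w} (Fin n)) s) := by
  have := hlf s
  obtain ⟨n, b, hb⟩ := exists_generators.{u, v, w} P s
  let Φ := freeHom (𝒜 := 𝒜) s P fun i => (b i : P.carrier)
  have hΦ : IsGradedHom _ P Φ := isGradedHom_freeHom s P _ fun i => (b i).2
  have hs : Function.Surjective Φ := by
    rw [← LinearMap.range_eq_top, eq_top_iff, ← hg, Submodule.span_le]
    intro x hx
    obtain ⟨c, hc⟩ := hb ⟨x, hx⟩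
    have h2 := congrArg Subtype.val hc
    rw [Submodule.coe_sum] at h2
    exact ⟨fun i => (c i : A), h2⟩
  obtain ⟨i, hi, hc⟩ := exists_graded_lift (P := P) hΦ hs (isGradedHom_id P)
  exact ⟨n, i, Φ, hi, hΦ, fun m => LinearMap.congr_fun hc m⟩

/-! ### Modules concentrated in one degree -/

/-- A scalar of positive degree would move vectors out of the only degree present, so `A` acts
through `A_0`. -/
theorem smul_of_concentrated {M : GrModule.{u, v, w} 𝒜} {s : ℤ} (h : ∀ m, m ∈ M.gr s) (a : A)
    (m : M.carrier) : a • m = (DirectSum.decompose 𝒜 a 0 : A) • m := by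
  induction a using DirectSum.Decomposition.inductionOn 𝒜 with
  | zero => simp
  | @homogeneous i a =>
    by_cases hi : i = 0
    · subst hi
      rw [DirectSum.decompose_of_mem_same 𝒜 a.2]
    · rw [DirectSum.decompose_of_mem_ne 𝒜 a.2 hi, zero_smul, ← M.proj_of_mem (h ((a : A) • m))]
      exact M.proj_of_ne (by omega) (M.smul_mem i s a m a.2 (h m))
  | add a b ha hb =>
    rw [add_smul, ha, hb, DirectSum.decompose_add, DirectSum.add_apply, Submodule.coe_add, add_smul]

/-- The embedding of `A_0` into `A`. -/
def degreeZeroVal : (degreeZeroModule 𝒜).carrier →ₗ[k] A := (𝒜 0).subtype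

theorem degreeZeroVal_injective : Function.Injective (degreeZeroVal (𝒜 := 𝒜)) :=
  Subtype.val_injective

theorem degreeZeroVal_mem (x : (degreeZeroModule 𝒜).carrier) : degreeZeroVal x ∈ 𝒜 0 := x.2

theorem degreeZeroVal_smul (a : A) (x : (degreeZeroModule 𝒜).carrier) :
    degreeZeroVal (a • x) = (DirectSum.decompose 𝒜 a 0 : A) * degreeZeroVal x := rfl

theorem mem_gr_degreeZeroModule (x : (degreeZeroModule 𝒜).carrier) :
    x ∈ (degreeZeroModule 𝒜).gr 0 := by
  change x ∈ (if (0 : ℤ) = 0 then (⊤ : Submodule k (DegreeZeroCarrier 𝒜)) else ⊥)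
  rw [if_pos rfl]
  trivial

theorem degreeZeroModule_generated : (degreeZeroModule 𝒜).GeneratedInDegree 0 := by
  rw [GeneratedInDegree, eq_top_iff]
  exact fun x _ => Submodule.subset_span (mem_gr_degreeZeroModule x)

theorem degreeZeroModule_locallyFinite (hA : ∀ i, Module.Finite k (𝒜 i)) :
    (degreeZeroModule 𝒜).LocallyFinite := by
  intro j
  have : Module.Finite k (DegreeZeroCarrier 𝒜) := hA 0
  change Module.Finite k ((if j = 0 then ⊤ else ⊥ : Submodule k (DegreeZeroCarrier 𝒜)))
  by_cases h : j = 0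
  · rw [if_pos h]
    exact Module.Finite.equiv (Submodule.topEquiv (R := k) (M := DegreeZeroCarrier 𝒜)).symm
  · rw [if_neg h]
    infer_instance

theorem decompose_mul_zero (a b : A) : (DirectSum.decompose 𝒜 (a * b) 0 : A) =
    DirectSum.decompose 𝒜 a 0 * DirectSum.decompose 𝒜 b 0 :=
  congrArg Subtype.val (map_mul (GradedRing.projZeroRingHom' 𝒜) a b)

/-- The projection of `A` onto `A_0`. -/
def selfπ : (selfModule 𝒜).carrier →ₗ[A] (degreeZeroModule 𝒜).carrier :=
  ({  toFun := fun a => DirectSum.decompose 𝒜 a 0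
      map_add' := fun a b => by
        rw [DirectSum.decompose_add]
        rfl
      map_smul' := fun a b => degreeZeroVal_injective (decompose_mul_zero a b) } :
    A →ₗ[A] (degreeZeroModule 𝒜).carrier) ∘ₗ selfVal.toLinearMap

theorem degreeZeroVal_selfπ (a : (selfModule 𝒜).carrier) :
    degreeZeroVal (selfπ (𝒜 := 𝒜) a) = DirectSum.decompose 𝒜 (selfVal a) 0 := rfl

/-- The kernel of this cover is the ideal of elements of positive degree, so that ideal is the first
syzygy of `A_0`. -/
theorem isCover_selfπ (hA : ∀ i, Module.Finite k (𝒜 i)) :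
    IsCover (selfModule 𝒜) (degreeZeroModule 𝒜) selfπ 0 := by
  refine ⟨inferInstanceAs (Module.Projective A A), selfModule_locallyFinite hA,
    selfModule_generated, ?_, ?_, ?_⟩
  · intro j a ha
    change selfVal a ∈ intGrading 𝒜 j at ha
    by_cases hj : j = 0
    · subst hj
      exact mem_gr_degreeZeroModule _
    · have : selfπ (𝒜 := 𝒜) a = 0 := by
        apply degreeZeroVal_injective
        rw [degreeZeroVal_selfπ, map_zero]
        by_cases h : 0 ≤ j
        · simp only [intGrading, h, if_true] at ha
          exact DirectSum.decompose_of_mem_ne 𝒜 ha (by omega)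
        · simp only [intGrading, h, if_false, Submodule.mem_bot] at ha
          rw [ha, DirectSum.decompose_zero]
          rfl
      rw [this]
      exact zero_mem _
  · exact fun x => ⟨selfVal.symm (degreeZeroVal x), degreeZeroVal_injective
      (DirectSum.decompose_of_mem_same 𝒜 (degreeZeroVal_mem x))⟩
  · intro a ha h0
    change selfVal a ∈ intGrading 𝒜 ((0 : ℕ) : ℤ) at ha
    rw [intGrading_natCast] at ha
    have := congrArg degreeZeroVal h0
    rw [degreeZeroVal_selfπ, map_zero, DirectSum.decompose_of_mem_same 𝒜 ha] at this
    exact selfVal.map_eq_zero_iff.1 this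

/-- As `A` acts through `A_0`, a dual basis over `A_0` exhibits `N` as a graded summand of a finite
power of the shifted module `A_0`. -/
theorem linearUpTo_of_concentrated {s : ℤ} {n : ℕ} (N : GrModule.{u, v, max v w} 𝒜)
    (h : ∀ m, m ∈ N.gr s) (hlf : N.LocallyFinite)
    (hp : Module.Projective (DegreeZeroRing 𝒜) (N.comp s))
    (h0 : LinearUpTo n 0 (degreeZeroModule 𝒜)) : LinearUpTo n s N := by
  have := hlf s
  obtain ⟨l, b, c, hb, hbc⟩ := exists_dual_basis.{u, v, w} N s
  let Q := pi fun _ : ULift.{w} (Fin l) => (degreeZeroModule 𝒜).shift s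
  have hQ : LinearUpTo n s Q := by
    refine LinearUpTo.pi fun _ => ?_
    have := h0.shift s
    rwa [zero_add] at this
  have hdec : ∀ a : A, (DirectSum.decompose 𝒜 a 0 : A) ∈ 𝒜 0 := fun a => Subtype.prop _
  let i : N.carrier →ₗ[A] Q.carrier :=
    { toFun := fun x j => (⟨c ⟨x, h x⟩ j, (c ⟨x, h x⟩ j).2⟩ : 𝒜 0)
      map_add' := fun x y => funext fun j => Subtype.ext <| by
        have := congrArg (fun t => ((t j : DegreeZeroRing 𝒜) : A))
          (c.map_add ⟨x, h x⟩ ⟨y, h y⟩)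
        exact this
      map_smul' := fun a x => funext fun j => degreeZeroVal_injective <| by
        have h1 : (⟨a • x, h _⟩ : N.comp s) =
            (⟨DirectSum.decompose 𝒜 a 0, hdec a⟩ : DegreeZeroRing 𝒜) • ⟨x, h x⟩ :=
          Subtype.ext (smul_of_concentrated h a x)
        have := congrArg (fun t => ((c t j : DegreeZeroRing 𝒜) : A)) h1
        simp only [map_smul] at this
        exact this }
  let r : Q.carrier →ₗ[A] N.carrier :=
    { toFun := fun f => ∑ j, degreeZeroVal (𝒜 := 𝒜) (f j) • b j
      map_add' := fun f g => by
        rw [← Finset.sum_add_distrib]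
        refine Finset.sum_congr rfl fun j _ => ?_
        have e1 := (degreeZeroVal (𝒜 := 𝒜)).map_add (f j) (g j)
        exact (congrArg (fun t => t • b j) e1).trans (add_smul _ _ _)
      map_smul' := fun a f => by
        rw [RingHom.id_apply, Finset.smul_sum]
        refine Finset.sum_congr rfl fun j _ => ?_
        have e1 : degreeZeroVal (𝒜 := 𝒜) (a • f j) =
          (DirectSum.decompose 𝒜 a 0 : A) * degreeZeroVal (𝒜 := 𝒜) (f j) := degreeZeroVal_smul a (f j)
        refine (congrArg (fun t => t • b j) e1).trans ?_
        rw [mul_smul, ← smul_of_concentrated h] }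
  refine hQ.retract ⟨i, r, ?_, ?_, fun m => hbc ⟨m, h m⟩⟩
  · intro j m hm
    by_cases hj : j = s
    · subst hj
      intro l _
      change _ ∈ (degreeZeroModule 𝒜).gr (j - j)
      rw [sub_self]
      exact mem_gr_degreeZeroModule _
    · have : m = 0 := by
        rw [← N.proj_of_mem (h m)]
        exact N.proj_of_ne (Ne.symm hj) hm
      rw [this, map_zero]
      exact zero_mem _
  · intro j f hf
    by_cases hj : j = s
    · subst hj
      exact h _
    · have : f = 0 := by
        refine funext fun l => ?_
        have hl := hf l trivial
        change f l ∈ (if j - s = 0 then (⊤ : Submodule k (DegreeZeroCarrier 𝒜)) else ⊥) at hl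
        rw [if_neg (by omega)] at hl
        exact hl
      rw [this, map_zero]
      exact zero_mem _

end GrModule

/-! ### Projective modules over a self-injective ring -/

/-- A finitely generated projective `K` is a summand of some `R^n`, which is injective. Extending `K
→ R^n` along `i` and mapping back to `K` gives the retraction; Baer's criterion permits `P` to lie
in any universe. -/
theorem IsSelfInjective.exists_retraction {R : Type v} [Ring R] (h : IsSelfInjective R)
    {K : Type w} {P : Type z} [AddCommGroup K] [Module R K] [AddCommGroup P] [Module R P]
    [Module.Finite R K] [Module.Projective R K] {i : K →ₗ[R] P} (hi : Function.Injective i) :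
    ∃ r : P →ₗ[R] K, ∀ x, r (i x) = x := by
  obtain ⟨n, f, hf⟩ := Module.Finite.exists_fin' R K
  obtain ⟨g, hg⟩ := Module.projective_lifting_property f LinearMap.id hf
  have hB : Module.Baer R (Fin n → R) := Module.Baer.of_injective (h _ inferInstance)
  obtain ⟨e, he⟩ := hB.extension_property i hi g
  exact ⟨f ∘ₗ e, fun x => (congrArg f (LinearMap.congr_fun he x)).trans (LinearMap.congr_fun hg x)⟩

/-- The endomorphism `id - i ∘ r` kills the kernel of `f`, so it descends to a section of `f`. -/
theorem Module.Projective.of_exact_of_retraction {R : Type v} [Ring R] {K M P : Type*}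
    [AddCommGroup K] [Module R K] [AddCommGroup P] [Module R P] [AddCommGroup M] [Module R M]
    [Module.Projective R P] {i : K →ₗ[R] P} {f : P →ₗ[R] M} (hf : Function.Surjective f)
    (h : Function.Exact i f) {r : P →ₗ[R] K} (hr : ∀ x, r (i x) = x) : Module.Projective R M := by
  let t : P →ₗ[R] P := LinearMap.id - i ∘ₗ r
  have ht : ∀ p, f p = 0 → t p = 0 := by
    intro p hp
    obtain ⟨x, rfl⟩ := (h p).1 hp
    simp [t, hr]
  let e := f.quotKerEquivOfSurjective hf
  let σ : M →ₗ[R] P := (LinearMap.ker f).liftQ t (fun p hp => ht p hp) ∘ₗ e.symm.toLinearMap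
  refine Module.Projective.of_split σ f (LinearMap.ext fun m => ?_)
  obtain ⟨p, rfl⟩ := hf m
  have : e.symm (f p) = Submodule.Quotient.mk p := by
    rw [LinearEquiv.symm_apply_eq]
    rfl
  simp only [σ, LinearMap.comp_apply, LinearEquiv.coe_coe, this]
  change f (p - i (r p)) = f p
  rw [map_sub, (h _).2 ⟨_, rfl⟩, sub_zero]

theorem Module.Projective.of_subring {A : Type v} [Ring A] (R : Subring A)
    [Module.Projective R A] (P : Type w) [AddCommGroup P] [Module A P] [Module.Projective A P] :
    Module.Projective R P := by
  obtain ⟨s, hs⟩ := Module.projective_def'.1 (‹Module.Projective A P›)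
  have : Module.Projective R (P →₀ A) := by
    classical
    exact Module.Projective.of_equiv' (finsuppLequivDFinsupp R (ι := P) (M := A)).symm
  exact Module.Projective.of_split (s.restrictScalars R)
    ((Finsupp.linearCombination A id).restrictScalars R)
    (LinearMap.ext fun p => LinearMap.congr_fun hs p)

/-! ### Projectivity of homogeneous components over the degree zero ring -/

namespace GrModule

variable {k : Type u} [Field k] {A : Type v} [Ring A] [Algebra k A] {𝒜 : ℕ → Submodule k A}
  [GradedAlgebra 𝒜]

/-- The map induced on homogeneous components. -/
def compMap {M : GrModule.{u, v, w} 𝒜} {N : GrModule.{u, v, z} 𝒜}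
    {f : M.carrier →ₗ[A] N.carrier} (hf : IsGradedHom M N f) (j : ℤ) :
    M.comp j →ₗ[DegreeZeroRing 𝒜] N.comp j :=
  (f.restrictScalars (DegreeZeroRing 𝒜)).restrict (hf j)

theorem IsGradedRetract.projective_comp {M : GrModule.{u, v, w} 𝒜} {N : GrModule.{u, v, z} 𝒜}
    (h : IsGradedRetract M N) (j : ℤ) (hN : Module.Projective (DegreeZeroRing 𝒜) (N.comp j)) :
    Module.Projective (DegreeZeroRing 𝒜) (M.comp j) := by
  obtain ⟨i, r, hi, hr, hri⟩ := h
  exact Module.Projective.of_split (compMap hi j) (compMap hr j)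
    (LinearMap.ext fun x => Subtype.ext (hri x))

theorem projective_comp_pi {ι : Type z} [Finite ι] (M : ι → GrModule.{u, v, w} 𝒜) (j : ℤ)
    (h : ∀ i, Module.Projective (DegreeZeroRing 𝒜) ((M i).comp j)) :
    Module.Projective (DegreeZeroRing 𝒜) ((pi M).comp j) := by
  classical
  have := Fintype.ofFinite ι
  have : Module.Projective (DegreeZeroRing 𝒜) (∀ i, (M i).comp j) :=
    Module.Projective.of_equiv (DFinsupp.linearEquivFunOnFintype (R := DegreeZeroRing 𝒜)
      (M := fun i => (M i).comp j))
  let f : (pi M).comp j →ₗ[DegreeZeroRing 𝒜] (∀ i, (M i).comp j) :=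
    { toFun := fun x i => ⟨x.1 i, x.2 i trivial⟩
      map_add' := fun _ _ => rfl
      map_smul' := fun _ _ => rfl }
  let g : (∀ i, (M i).comp j) →ₗ[DegreeZeroRing 𝒜] (pi M).comp j :=
    { toFun := fun x => ⟨fun i => (x i).1, fun i _ => (x i).2⟩
      map_add' := fun _ _ => rfl
      map_smul' := fun _ _ => rfl }
  exact Module.Projective.of_split f g rfl

theorem isProjectiveOverDegreeZero_iff (M : GrModule.{u, v, w} 𝒜) :
    M.IsProjectiveOverDegreeZero ↔ ∀ j, Module.Projective (DegreeZeroRing 𝒜) (M.comp j) := by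
  constructor
  · intro h j
    have : Module.Projective (DegreeZeroRing 𝒜) M.carrier := h
    let p : M.carrier →ₗ[DegreeZeroRing 𝒜] M.comp j :=
      { toFun := fun m => ⟨M.proj j m, M.proj_mem j m⟩
        map_add' := fun x y => Subtype.ext (map_add _ _ _)
        map_smul' := fun r x => Subtype.ext <| by
          have := M.proj_smul r.2 j x
          rw [Nat.cast_zero, zero_add] at this
          exact this }
    exact Module.Projective.of_split (M.comp j).subtype p
      (LinearMap.ext fun x => Subtype.ext (M.proj_of_mem x.2))
  · intro h
    have hb : Function.Bijective (DirectSum.coeLinearMap fun j => M.comp j) := M.isInternal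
    exact Module.Projective.of_equiv (LinearEquiv.ofBijective _ hb)

theorem IsGradedRetract.isProjectiveOverDegreeZero {M : GrModule.{u, v, w} 𝒜}
    {N : GrModule.{u, v, z} 𝒜} (h : IsGradedRetract M N) (hN : N.IsProjectiveOverDegreeZero) :
    M.IsProjectiveOverDegreeZero :=
  M.isProjectiveOverDegreeZero_iff.2 fun j =>
    h.projective_comp j (N.isProjectiveOverDegreeZero_iff.1 hN j)

theorem projective_comp_of_lt {M : GrModule.{u, v, w} 𝒜} {s j : ℤ} (h : M.GeneratedInDegree s)
    (hj : j < s) : Module.Projective (DegreeZeroRing 𝒜) (M.comp j) := by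
  have : Subsingleton (M.comp j) := ⟨fun x y => Subtype.ext <| by
    rw [h.eq_zero_of_mem hj x.2, h.eq_zero_of_mem hj y.2]⟩
  infer_instance

/-- If the components `A_0, …, A_m` are projective over the self-injective ring `A_0`, then so are
the first components of modules with linear resolutions. -/
theorem projective_comp_of_linearUpTo (hA : ∀ i, Module.Finite k (𝒜 i))
    (hself : IsSelfInjective (DegreeZeroRing 𝒜)) (m : ℕ)
    (hAm : ∀ j ≤ m, Module.Projective (DegreeZeroRing 𝒜) ((selfModule 𝒜).comp j))
    {M : GrModule.{u, v, w} 𝒜} {s : ℤ} (hM : ∀ n, LinearUpTo n s M) :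
    Module.Projective (DegreeZeroRing 𝒜) (M.comp (s + m)) := by
  induction m generalizing M s with
  | zero =>
    obtain ⟨hg, P, π, hπ, -⟩ := hM 1
    obtain ⟨n, hn⟩ := isGradedRetract_free.{u, v, 0} s P hπ.projective hπ.locallyFinite hπ.generated
    have hP : Module.Projective (DegreeZeroRing 𝒜) (P.comp s) := by
      refine hn.projective_comp s (projective_comp_pi _ _ fun _ => ?_)
      change Module.Projective (DegreeZeroRing 𝒜) ((selfModule 𝒜).comp (s - s))
      rw [sub_self]
      exact hAm 0 le_rfl
    rw [Nat.cast_zero, add_zero]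
    refine Module.Projective.of_equiv (LinearEquiv.ofBijective (compMap hπ.graded s) ⟨?_, ?_⟩)
    · rw [injective_iff_map_eq_zero]
      exact fun x hx => Subtype.ext (hπ.eq_zero _ x.2 (congrArg Subtype.val hx))
    · rintro ⟨y, hy⟩
      obtain ⟨x, hx, rfl⟩ := hπ.graded.exists_preimage hπ.surjective hy
      exact ⟨⟨x, hx⟩, rfl⟩
  | succ m ih =>
    obtain ⟨hg, P, π, hπ, -⟩ := hM 1
    obtain ⟨n, hn⟩ := isGradedRetract_free.{u, v, 0} s P hπ.projective hπ.locallyFinite hπ.generated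
    have hP : Module.Projective (DegreeZeroRing 𝒜) (P.comp (s + (m + 1 : ℕ))) := by
      refine hn.projective_comp _ (projective_comp_pi _ _ fun _ => ?_)
      change Module.Projective (DegreeZeroRing 𝒜) ((selfModule 𝒜).comp (s + (m + 1 : ℕ) - s))
      rw [add_sub_cancel_left]
      exact hAm _ le_rfl
    -- The kernel is generated in degree `s + 1`, so its component in degree `s + m + 1` is only `m`
    -- steps above its generators and needs only `A_0, …, A_m`.
    have hK := ih (fun j hj => hAm j (hj.trans (Nat.le_succ m)))
      (fun n => (hM (n + 1)).ker_of_isCover hπ)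
    rw [add_assoc, add_comm (1 : ℤ), ← Nat.cast_succ] at hK
    have := (hπ.locallyFinite.of_injective (isGradedHom_subι _ _ hπ.graded.isHomogeneous_ker)
      (subι_injective _ _ _)) (s + (m + 1 : ℕ))
    have := (ker hπ.graded).finite_comp (s + (m + 1 : ℕ))
    let i := compMap (isGradedHom_subι P _ hπ.graded.isHomogeneous_ker) (s + (m + 1 : ℕ))
    have hi : Function.Injective i := fun x y h =>
      Subtype.ext (P.subι_injective _ hπ.graded.isHomogeneous_ker (congrArg (fun t => t.1) h))
    -- Self-injectivity enters here: the component of the kernel is finitely generated projective,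
    -- so it splits off from that of `P`, and the component of `M` is the complement.
    obtain ⟨r, hr⟩ := hself.exists_retraction hi
    refine Module.Projective.of_exact_of_retraction (f := compMap hπ.graded _) ?_ ?_ hr
    · rintro ⟨y, hy⟩
      obtain ⟨x, hx, rfl⟩ := hπ.graded.exists_preimage hπ.surjective hy
      exact ⟨⟨x, hx⟩, rfl⟩
    · intro x
      constructor
      · intro hx
        exact ⟨⟨⟨x.1, congrArg Subtype.val hx⟩, x.2⟩, rfl⟩
      · rintro ⟨y, rfl⟩
        exact Subtype.ext (apply_kerι hπ.graded y.1)

/-- `A_{m+1}` is a component of the ideal of positive elements, which is generated in degree `1` and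
has a linear resolution. It sits `m` steps above the generators, so projectivity of `A_0, …, A_m`
suffices and strong induction closes. -/
theorem selfModule_comp_projective (hA : ∀ i, Module.Finite k (𝒜 i))
    (hself : IsSelfInjective (DegreeZeroRing 𝒜))
    (h : ∀ n, LinearUpTo n 0 (degreeZeroModule 𝒜)) (m : ℕ) :
    Module.Projective (DegreeZeroRing 𝒜) ((selfModule 𝒜).comp m) := by
  induction m using Nat.strong_induction_on with
  | _ m ih =>
    cases m with
    | zero =>
      have hm : ∀ r : DegreeZeroRing 𝒜, selfVal.symm (r : A) ∈ (selfModule 𝒜).comp (0 : ℕ) := by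
        intro r
        change (r : A) ∈ intGrading 𝒜 ((0 : ℕ) : ℤ)
        rw [intGrading_natCast]
        exact r.2
      let f : DegreeZeroRing 𝒜 →ₗ[DegreeZeroRing 𝒜] (selfModule 𝒜).comp (0 : ℕ) :=
        { toFun := fun r => ⟨selfVal.symm (r : A), hm r⟩
          map_add' := fun _ _ => rfl
          map_smul' := fun _ _ => rfl }
      refine Module.Projective.of_equiv (LinearEquiv.ofBijective f ⟨?_, ?_⟩)
      · intro x y hxy
        exact Subtype.ext (congrArg Subtype.val hxy)
      · rintro ⟨y, hy⟩
        have hy' : selfVal y ∈ intGrading 𝒜 ((0 : ℕ) : ℤ) := hy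
        rw [intGrading_natCast] at hy'
        exact ⟨⟨selfVal y, hy'⟩, rfl⟩
    | succ m =>
      have hc := isCover_selfπ (𝒜 := 𝒜) hA
      have hJ := projective_comp_of_linearUpTo hA hself m (fun j hj => ih j (Nat.lt_succ_of_le hj))
        (fun n => (h (n + 1)).ker_of_isCover hc)
      rw [zero_add, add_comm, ← Nat.cast_succ] at hJ
      let f := compMap (isGradedHom_subι (selfModule 𝒜) _ hc.graded.isHomogeneous_ker)
        ((m + 1 : ℕ) : ℤ)
      refine Module.Projective.of_equiv (LinearEquiv.ofBijective f ⟨?_, ?_⟩)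
      · exact fun x y h => Subtype.ext
          ((selfModule 𝒜).subι_injective _ hc.graded.isHomogeneous_ker (congrArg (fun t => t.1) h))
      · rintro ⟨y, hy⟩
        have hy' : selfVal y ∈ intGrading 𝒜 ((m + 1 : ℕ) : ℤ) := hy
        rw [intGrading_natCast] at hy'
        have h0 : selfπ y = 0 := degreeZeroVal_injective <| by
          rw [degreeZeroVal_selfπ, DirectSum.decompose_of_mem_ne 𝒜 hy' (by omega), map_zero]
        exact ⟨⟨⟨y, h0⟩, hy⟩, rfl⟩

/-- Modules with linear resolutions over a Koszul algebra are projective over `A_0`. -/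
theorem isProjectiveOverDegreeZero_of_linearUpTo (hA : ∀ i, Module.Finite k (𝒜 i))
    (hself : IsSelfInjective (DegreeZeroRing 𝒜))
    (h : ∀ n, LinearUpTo n 0 (degreeZeroModule 𝒜)) {M : GrModule.{u, v, w} 𝒜} {s : ℤ}
    (hM : ∀ n, LinearUpTo n s M) : M.IsProjectiveOverDegreeZero := by
  refine M.isProjectiveOverDegreeZero_iff.2 fun j => ?_
  by_cases hj : j < s
  · exact projective_comp_of_lt (hM 0) hj
  · obtain ⟨m, rfl⟩ : ∃ m : ℕ, j = s + m := ⟨(j - s).toNat, by omega⟩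
    exact projective_comp_of_linearUpTo hA hself m
      (fun i _ => selfModule_comp_projective hA hself h i) hM

theorem selfModule_isProjectiveOverDegreeZero (hA : ∀ i, Module.Finite k (𝒜 i))
    (hself : IsSelfInjective (DegreeZeroRing 𝒜))
    (h : ∀ n, LinearUpTo n 0 (degreeZeroModule 𝒜)) :
    (selfModule 𝒜).IsProjectiveOverDegreeZero := by
  refine (selfModule 𝒜).isProjectiveOverDegreeZero_iff.2 fun j => ?_
  by_cases hj : j < 0
  · exact projective_comp_of_lt selfModule_generated hj
  · obtain ⟨m, rfl⟩ := Int.eq_ofNat_of_zero_le (not_lt.1 hj)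
    exact selfModule_comp_projective hA hself h m

end GrModule

/-! ### Graded subalgebras agreeing in positive degrees -/

/-- An embedding of graded algebras which is bijective in positive degrees. -/
structure IsPositivelyBijective {k : Type u} [Field k] {A B : Type v} [Ring A] [Algebra k A]
    [Ring B] [Algebra k B] (𝒜 : ℕ → Submodule k A) (ℬ : ℕ → Submodule k B) (φ : B →ₐ[k] A) :
    Prop where
  map_mem : ∀ i, ∀ b ∈ ℬ i, φ b ∈ 𝒜 i
  injective : Function.Injective φ
  exists_preimage : ∀ i, i ≠ 0 → ∀ a ∈ 𝒜 i, ∃ b ∈ ℬ i, φ b = a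

namespace GrModule

variable {k : Type u} [Field k] {A B : Type v} [Ring A] [Algebra k A] [Ring B] [Algebra k B]
  {𝒜 : ℕ → Submodule k A} {ℬ : ℕ → Submodule k B} {φ : B →ₐ[k] A}

section Restrict

variable (hφ : ∀ i, ∀ b ∈ ℬ i, φ b ∈ 𝒜 i)

/-- An element of a module as an element of its restriction. -/
def toRestrict (M : GrModule.{u, v, w} 𝒜) : M.carrier ≃+ (M.restrict φ hφ).carrier :=
  AddEquiv.refl M.carrier

/-- A homomorphism, restricted to the subalgebra. -/
def restrictHom {M : GrModule.{u, v, w} 𝒜} {N : GrModule.{u, v, z} 𝒜}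
    (f : M.carrier →ₗ[A] N.carrier) :
    (M.restrict φ hφ).carrier →ₗ[B] (N.restrict φ hφ).carrier where
  toFun m := f m
  map_add' := f.map_add
  map_smul' b m := f.map_smul (φ b) m

theorem IsGradedHom.restrictHom {M : GrModule.{u, v, w} 𝒜} {N : GrModule.{u, v, z} 𝒜}
    {f : M.carrier →ₗ[A] N.carrier} (hf : IsGradedHom M N f) :
    IsGradedHom (M.restrict φ hφ) (N.restrict φ hφ) (restrictHom hφ f) := hf

theorem IsGradedRetract.restrict {M : GrModule.{u, v, w} 𝒜} {N : GrModule.{u, v, z} 𝒜}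
    (h : IsGradedRetract M N) : IsGradedRetract (M.restrict φ hφ) (N.restrict φ hφ) := by
  obtain ⟨i, r, hi, hr, hri⟩ := h
  exact ⟨restrictHom hφ i, restrictHom hφ r, hi, hr, hri⟩

theorem ker_restrictHom_retract {M : GrModule.{u, v, w} 𝒜} {N : GrModule.{u, v, z} 𝒜}
    {f : M.carrier →ₗ[A] N.carrier} (hf : IsGradedHom M N f) :
    IsGradedRetract ((ker hf).restrict φ hφ) (ker (hf.restrictHom hφ)) ∧
      IsGradedRetract (ker (hf.restrictHom hφ)) ((ker hf).restrict φ hφ) := by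
  let F : ((ker hf).restrict φ hφ).carrier →ₗ[B] (ker (hf.restrictHom hφ)).carrier :=
    (M.restrict φ hφ).subLift _ _ (restrictHom hφ (kerι hf)) fun x => apply_kerι hf x
  refine isGradedRetract_of_bijective (f := F) (fun j m hm => hm) ⟨?_, ?_⟩
  · intro x y hxy
    exact M.subι_injective _ hf.isHomogeneous_ker
      (congrArg (kerι (hf.restrictHom hφ)) hxy)
  · intro y
    exact ⟨⟨kerι (hf.restrictHom hφ) y, apply_kerι (hf.restrictHom hφ) y⟩, rfl⟩

theorem GeneratedInDegree.of_restrict {M : GrModule.{u, v, w} 𝒜} {s : ℤ}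
    (h : (M.restrict φ hφ).GeneratedInDegree s) : M.GeneratedInDegree s := by
  rw [GeneratedInDegree, eq_top_iff]
  intro m _
  have hm : M.toRestrict hφ m ∈ Submodule.span B ((M.restrict φ hφ).gr s : Set _) := by
    rw [h]
    trivial
  have key : ∀ x : (M.restrict φ hφ).carrier,
      x ∈ Submodule.span B ((M.restrict φ hφ).gr s : Set _) →
      (M.toRestrict hφ).symm x ∈ Submodule.span A (M.gr s : Set M.carrier) := by
    intro x hx
    induction hx using Submodule.span_induction with
    | mem x hx => exact Submodule.subset_span hx
    | zero => exact zero_mem _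
    | add x y _ _ hx hy => exact add_mem hx hy
    | smul b x _ hx => exact Submodule.smul_mem _ (φ b) hx
  exact key _ hm

end Restrict

variable [GradedAlgebra 𝒜] [GradedAlgebra ℬ]

/-- Scalars of positive degree come from `B`, and those of degree `0` preserve `M_s`, so `B · M_s =
A · M_s`. -/
theorem GeneratedInDegree.restrict (hφ : IsPositivelyBijective 𝒜 ℬ φ)
    {M : GrModule.{u, v, w} 𝒜} {s : ℤ}
    (h : M.GeneratedInDegree s) : (M.restrict φ hφ.map_mem).GeneratedInDegree s := by
  let T := Submodule.span B ((M.restrict φ hφ.map_mem).gr s : Set (M.restrict φ hφ.map_mem).carrier)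
  have hT : ∀ b : B, ∀ m : M.carrier, M.toRestrict hφ.map_mem m ∈ T →
      M.toRestrict hφ.map_mem (φ b • m) ∈ T := fun b m hm => T.smul_mem b hm
  have h1 : ∀ a : A, ∀ m ∈ M.gr s, M.toRestrict hφ.map_mem (a • m) ∈ T := by
    intro a m hm
    induction a using DirectSum.Decomposition.inductionOn 𝒜 with
    | zero =>
      rw [zero_smul, map_zero]
      exact zero_mem _
    | @homogeneous i a =>
      by_cases hi : i = 0
      · subst hi
        have := M.smul_mem 0 s a m a.2 hm
        rw [Nat.cast_zero, zero_add] at this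
        exact Submodule.subset_span this
      · obtain ⟨b, -, hb⟩ := hφ.exists_preimage i hi a a.2
        rw [← hb]
        exact hT b m (Submodule.subset_span hm)
    | add a b ha hb =>
      rw [add_smul, map_add]
      exact add_mem ha hb
  rw [GeneratedInDegree, eq_top_iff]
  intro x _
  have hx : (M.toRestrict hφ.map_mem).symm x ∈ Submodule.span A (M.gr s : Set M.carrier) := by
    rw [h]
    trivial
  -- All multipliers `a` are carried through the induction because `T` is only known to be stable
  -- under `B`.
  have key : ∀ m ∈ Submodule.span A (M.gr s : Set M.carrier), ∀ a : A,
      M.toRestrict hφ.map_mem (a • m) ∈ T := by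
    intro m hm
    induction hm using Submodule.span_induction with
    | mem m hm => exact fun a => h1 a m hm
    | zero =>
      intro a
      rw [smul_zero, map_zero]
      exact zero_mem _
    | add m n _ _ hm hn =>
      intro a
      rw [smul_add, map_add]
      exact add_mem (hm a) (hn a)
    | smul c m _ hm =>
      intro a
      rw [smul_smul]
      exact hm _
  have := key _ hx 1
  rwa [one_smul, AddEquiv.apply_symm_apply] at this

/-! ### Comparison with a subalgebra whose degree zero part is semisimple -/

section Semisimple

variable [IsSemisimpleRing (DegreeZeroRing ℬ)]

theorem finite_of_isPositivelyBijective (hφ : IsPositivelyBijective 𝒜 ℬ φ) (hA : ∀ i, Module.Finite k (𝒜 i))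
    (i : ℕ) : Module.Finite k (ℬ i) := by
  have := hA i
  let f : ℬ i →ₗ[k] 𝒜 i :=
    { toFun := fun b => ⟨φ b, hφ.map_mem i b b.2⟩
      map_add' := fun x y => Subtype.ext (map_add φ _ _)
      map_smul' := fun c x => Subtype.ext (map_smul φ c x.1) }
  exact Module.Finite.of_injective f fun x y h =>
    Subtype.ext (hφ.injective (congrArg Subtype.val h))

theorem exists_isCover_of_isSemisimpleRing (hB : ∀ i, Module.Finite k (ℬ i)) (s : ℤ)
    (M : GrModule.{u, v, max v w} ℬ) (hlf : M.LocallyFinite) (hg : M.GeneratedInDegree s) :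
    ∃ (P : GrModule.{u, v, max v w} ℬ) (π : P.carrier →ₗ[B] M.carrier), IsCover P M π s :=
  exists_isCover hB s M hlf hg (Module.projective_of_isSemisimpleRing _ _)

/-- In `0 → B → A → A/B → 0` the left term is projective over `B`. The right one is concentrated in
degree `0`, because `φ` is onto in positive degrees, and it is projective over the semisimple `B_0`,
so it is as linear as `B_0`. -/
theorem linearUpTo_restrict_selfModule (hφ : IsPositivelyBijective 𝒜 ℬ φ) (hA : ∀ i, Module.Finite k (𝒜 i))
    {n : ℕ} (hS : LinearUpTo n 0 (degreeZeroModule ℬ)) :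
    LinearUpTo n 0 ((selfModule 𝒜).restrict φ hφ.map_mem) := by
  let i : (selfModule ℬ).carrier →ₗ[B] ((selfModule 𝒜).restrict φ hφ.map_mem).carrier :=
    { toFun := fun b => φ (selfVal b)
      map_add' := fun b c => map_add φ (selfVal b) (selfVal c)
      map_smul' := fun b c => map_mul φ b (selfVal c) }
  have hi : IsGradedHom (selfModule ℬ) ((selfModule 𝒜).restrict φ hφ.map_mem) i := by
    intro j b hb
    change φ (selfVal b) ∈ intGrading 𝒜 j
    change selfVal b ∈ intGrading ℬ j at hb
    by_cases h : 0 ≤ j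
    · simp only [intGrading, h, if_true] at hb ⊢
      exact hφ.map_mem _ _ hb
    · simp only [intGrading, h, if_false, Submodule.mem_bot] at hb ⊢
      rw [hb]
      exact map_zero φ
  let M := (selfModule 𝒜).restrict φ hφ.map_mem
  let N := M.quot (LinearMap.range i) hi.isHomogeneous_range
  have hMf : M.LocallyFinite := fun j => selfModule_locallyFinite (𝒜 := 𝒜) hA j
  have hMN : IsGradedHom M N (M.quotπ _ _) := M.isGradedHom_quotπ _ hi.isHomogeneous_range
  have hNf : N.LocallyFinite := hMf.of_surjective hMN (M.quotπ_surjective _ _)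
  have hN : ∀ x, x ∈ N.gr 0 := by
    intro x
    obtain ⟨x, rfl⟩ := M.quotπ_surjective _ hi.isHomogeneous_range x
    induction x using M.hom_induction with
    | hom j x hx =>
      by_cases hj : j = 0
      · subst hj
        exact hMN _ _ hx
      · have : M.quotπ (LinearMap.range i) hi.isHomogeneous_range x = 0 := by
          rw [M.quotπ_eq_zero]
          change x ∈ intGrading 𝒜 j at hx
          by_cases h : 0 ≤ j
          · simp only [intGrading, h, if_true] at hx
            obtain ⟨b, -, hb⟩ := hφ.exists_preimage _ (by omega) _ hx
            exact ⟨selfVal.symm b, hb⟩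
          · have h0 : ∀ a : A, a ∈ intGrading 𝒜 j → a = 0 := fun a ha => by
              rwa [intGrading_of_neg 𝒜 (by omega), Submodule.mem_bot] at ha
            have hx0 : x = 0 := h0 _ hx
            rw [hx0]
            exact zero_mem _
        rw [this]
        exact zero_mem _
    | zero =>
      rw [map_zero]
      exact zero_mem _
    | add x y hx hy =>
      rw [map_add]
      exact add_mem hx hy
  have hex : IsGradedShortExact (selfModule ℬ) M N i (M.quotπ _ hi.isHomogeneous_range) := by
    refine ⟨hi, hMN, fun x y h => hφ.injective h, M.quotπ_surjective _ _, fun x => ?_⟩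
    rw [M.quotπ_eq_zero]
    rfl
  refine hex.linearUpTo (linearUpTo_of_projective n (inferInstanceAs (Module.Projective B B))
    (selfModule_locallyFinite (finite_of_isPositivelyBijective hφ hA)) selfModule_generated) ?_
  exact linearUpTo_of_concentrated.{u, v, 0} N hN hNf (Module.projective_of_isSemisimpleRing _ _) hS

theorem linearUpTo_restrict_of_projective (hφ : IsPositivelyBijective 𝒜 ℬ φ) (hA : ∀ i, Module.Finite k (𝒜 i))
    {n : ℕ} (hS : LinearUpTo n 0 (degreeZeroModule ℬ))
    {P : GrModule.{u, v, max v w} 𝒜} {s : ℤ} (hp : Module.Projective A P.carrier)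
    (hlf : P.LocallyFinite) (hg : P.GeneratedInDegree s) :
    LinearUpTo n s (P.restrict φ hφ.map_mem) := by
  obtain ⟨m, hm⟩ := isGradedRetract_free.{u, v, w} s P hp hlf hg
  have h1 := (linearUpTo_restrict_selfModule hφ hA hS).shift s
  rw [zero_add] at h1
  have h2 : LinearUpTo n s (pi fun _ : ULift.{w} (Fin m) =>
    ((selfModule 𝒜).restrict φ hφ.map_mem).shift s) := LinearUpTo.pi fun _ => h1
  refine (h2.retract ?_).retract (hm.restrict hφ.map_mem)
  let f : ((free 𝒜 (ULift.{w} (Fin m)) s).restrict φ hφ.map_mem).carrier →ₗ[B]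
    (pi fun _ : ULift.{w} (Fin m) =>
      ((selfModule 𝒜).restrict φ hφ.map_mem).shift s).carrier :=
    { toFun := fun x => x
      map_add' := fun _ _ => rfl
      map_smul' := fun _ _ => rfl }
  exact (isGradedRetract_of_bijective (f := f) (fun j m hm => hm)
    ⟨fun x y h => h, fun x => ⟨x, rfl⟩⟩).1

/-- Restrictions of modules with linear resolutions have linear resolutions, as far as the
simple modules of the subalgebra do. -/
theorem linearUpTo_restrict (hφ : IsPositivelyBijective 𝒜 ℬ φ) (hA : ∀ i, Module.Finite k (𝒜 i))
    {n : ℕ} (hS : LinearUpTo n 0 (degreeZeroModule ℬ))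
    {M : GrModule.{u, v, max v w} 𝒜} {s : ℤ} (hM : ∀ n, LinearUpTo n s M) :
    LinearUpTo n s (M.restrict φ hφ.map_mem) := by
  induction n generalizing M s with
  | zero => exact (hM 0).generated.restrict hφ
  | succ n ih =>
    obtain ⟨hg, P, ρ, hρ, -⟩ := hM 1
    obtain ⟨hPg, Q, π, hπ, hL⟩ := linearUpTo_restrict_of_projective hφ hA hS hρ.projective
      hρ.locallyFinite hρ.generated
    -- The restriction of `P` need not be projective over `B`, so it is covered in turn by `Q`. The
    -- kernel of `Q → M` is an extension of `ker ρ`, linear by induction, by `ker π`.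
    obtain ⟨hc, f, g, hex⟩ := hπ.comp_shortExact (hρ.graded.restrictHom hφ.map_mem)
      hρ.surjective hρ.eq_zero
    refine ⟨hg.restrict hφ, Q, _, hc, hex.linearUpTo hL ?_⟩
    exact (ih hS.of_succ fun n => (hM (n + 1)).ker_of_isCover hρ).retract
      (ker_restrictHom_retract hφ.map_mem hρ.graded).2

/-- `φ` identifies the positive ideals of `B` and `A`. If `B_0` is linear to stage `n`, then so is
this ideal by `linearUpTo_restrict`; being the first syzygy of `B_0`, it makes `B_0` linear to stage
`n + 1`. -/
theorem linearUpTo_degreeZeroModule_of_restrict (hφ : IsPositivelyBijective 𝒜 ℬ φ) (hA : ∀ i, Module.Finite k (𝒜 i))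
    (hK : ∀ n, LinearUpTo n 0 (degreeZeroModule 𝒜))
    (n : ℕ) : LinearUpTo n 0 (degreeZeroModule ℬ) := by
  have hc := isCover_selfπ (𝒜 := 𝒜) hA
  have hcB := isCover_selfπ (𝒜 := ℬ) (finite_of_isPositivelyBijective hφ hA)
  induction n with
  | zero => exact degreeZeroModule_generated
  | succ n ih =>
    refine ⟨degreeZeroModule_generated, _, _, hcB, ?_⟩
    have hJ := linearUpTo_restrict.{u, v, 0} hφ hA ih fun n => (hK (n + 1)).ker_of_isCover hc
    refine hJ.retract ?_
    have hdec : ∀ b : B, (DirectSum.decompose 𝒜 (φ b) 0 : A) = φ (DirectSum.decompose ℬ b 0) := by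
      intro b
      induction b using DirectSum.Decomposition.inductionOn ℬ with
      | zero => simp
      | @homogeneous i b =>
        by_cases hi : i = 0
        · subst hi
          rw [DirectSum.decompose_of_mem_same 𝒜 (hφ.map_mem _ _ b.2),
            DirectSum.decompose_of_mem_same ℬ b.2]
        · rw [DirectSum.decompose_of_mem_ne 𝒜 (hφ.map_mem _ _ b.2) hi,
            DirectSum.decompose_of_mem_ne ℬ b.2 hi, map_zero]
      | add a b ha hb =>
        simp only [map_add, DirectSum.decompose_add, DirectSum.add_apply, Submodule.coe_add, ha, hb]
    have hmem : ∀ x : (ker hcB.graded).carrier,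
        selfπ (𝒜 := 𝒜) (selfVal.symm (φ (selfVal (kerι hcB.graded x)))) = 0 := by
      intro x
      apply degreeZeroVal_injective
      rw [degreeZeroVal_selfπ, map_zero]
      refine (hdec _).trans ?_
      have := congrArg degreeZeroVal (apply_kerι hcB.graded x)
      rw [degreeZeroVal_selfπ, map_zero] at this
      rw [this, map_zero]
    let F : (ker hcB.graded).carrier →ₗ[B] ((ker hc.graded).restrict φ hφ.map_mem).carrier :=
      { toFun := fun x => ⟨φ (selfVal (kerι hcB.graded x)), hmem x⟩
        map_add' := fun x y => Subtype.ext
          (map_add φ (selfVal (kerι hcB.graded x)) (selfVal (kerι hcB.graded y)))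
        map_smul' := fun b x => Subtype.ext (map_mul φ b (selfVal (kerι hcB.graded x))) }
    refine (isGradedRetract_of_bijective (f := F) ?_ ⟨?_, ?_⟩).1
    · intro j x hx
      change φ (selfVal (kerι hcB.graded x)) ∈ intGrading 𝒜 j
      change selfVal (kerι hcB.graded x) ∈ intGrading ℬ j at hx
      by_cases h : 0 ≤ j
      · simp only [intGrading, h, if_true] at hx ⊢
        exact hφ.map_mem _ _ hx
      · simp only [intGrading, h, if_false, Submodule.mem_bot] at hx ⊢
        rw [hx, map_zero]
    · intro x y hxy
      exact (selfModule ℬ).subι_injective _ hcB.graded.isHomogeneous_ker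
        (hφ.injective (congrArg (fun t => t.1) hxy))
    · intro y
      -- Without a component in degree `0`, an element is a sum of components of positive degree,
      -- each of which lifts to `B`.
      have key : ∀ a : A, (DirectSum.decompose 𝒜 a 0 : A) = 0 → ∃ b, φ b = a := by
        intro a ha
        classical
        rw [← DirectSum.sum_support_decompose 𝒜 a]
        choose! f hf using fun i (hi : i ≠ 0) => hφ.exists_preimage i hi
          (DirectSum.decompose 𝒜 a i) (Subtype.prop _)
        refine ⟨∑ i ∈ (DirectSum.decompose 𝒜 a).support, f i, ?_⟩
        rw [map_sum]
        refine Finset.sum_congr rfl fun i hi => (hf i ?_).2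
        rintro rfl
        rw [DFinsupp.mem_support_toFun] at hi
        exact hi (Subtype.ext ha)
      have hy := congrArg degreeZeroVal (apply_kerι hc.graded y)
      rw [degreeZeroVal_selfπ, map_zero] at hy
      obtain ⟨b, hb⟩ := key _ hy
      have hb0 : selfπ (𝒜 := ℬ) (selfVal.symm b) = 0 := by
        apply degreeZeroVal_injective
        rw [degreeZeroVal_selfπ, map_zero]
        apply hφ.injective
        rw [map_zero]
        refine (hdec b).symm.trans ?_
        rw [hb]
        exact hy
      exact ⟨⟨selfVal.symm b, hb0⟩, Subtype.ext hb⟩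

/-- A module which is projective over `A_0` has a linear resolution if its restriction does. -/
theorem linearUpTo_of_restrict (hφ : IsPositivelyBijective 𝒜 ℬ φ) (hA : ∀ i, Module.Finite k (𝒜 i))
    (hAp : (selfModule 𝒜).IsProjectiveOverDegreeZero)
    (hS : ∀ n, LinearUpTo n 0 (degreeZeroModule ℬ)) {M : GrModule.{u, v, max v w} 𝒜} {s : ℤ}
    (hlf : M.LocallyFinite) (hp : M.IsProjectiveOverDegreeZero)
    (hM : ∀ n, LinearUpTo n s (M.restrict φ hφ.map_mem)) (n : ℕ) : LinearUpTo n s M := by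
  have hB := finite_of_isPositivelyBijective hφ hA
  induction n generalizing M s with
  | zero => exact (hM 0).generated.of_restrict
  | succ n ih =>
    have hg : M.GeneratedInDegree s := (hM 0).generated.of_restrict
    obtain ⟨P, ρ, hρ⟩ := exists_isCover.{u, v, w} hA s M hlf hg
      (M.isProjectiveOverDegreeZero_iff.1 hp s)
    have hKlf : (ker hρ.graded).LocallyFinite :=
      hρ.locallyFinite.of_injective (isGradedHom_subι _ _ _) (subι_injective _ _ _)
    refine ⟨hg, P, ρ, hρ, ih hKlf ?_ ?_⟩
    · have : Module.Projective (DegreeZeroRing 𝒜) A := hAp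
      have : Module.Projective (DegreeZeroRing 𝒜) M.carrier := hp
      have := hρ.projective
      have : Module.Projective (DegreeZeroRing 𝒜) P.carrier :=
        Module.Projective.of_subring (DegreeZeroRing 𝒜) P.carrier
      let ρ' := ρ.restrictScalars (DegreeZeroRing 𝒜)
      -- As `M` is projective over `A_0`, the cover splits over `A_0`, so its kernel is an
      -- `A_0`-summand of `P`. The latter is projective over `A_0` because `A` is, so the hypothesis
      -- on `M` passes to the kernel.
      obtain ⟨σ, hσ⟩ := Module.projective_lifting_property ρ' LinearMap.id hρ.surjective
      have hσ' : ∀ m, ρ (σ m) = m := fun m => LinearMap.congr_fun hσ m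
      let r : P.carrier →ₗ[DegreeZeroRing 𝒜] (ker hρ.graded).carrier :=
        LinearMap.codRestrict ((LinearMap.ker ρ).restrictScalars (DegreeZeroRing 𝒜))
          (LinearMap.id - σ ∘ₗ ρ') fun p => by
          change ρ (p - σ (ρ p)) = 0
          rw [map_sub, hσ', sub_self]
      refine Module.Projective.of_split ((kerι hρ.graded).restrictScalars (DegreeZeroRing 𝒜)) r
        (LinearMap.ext fun x => P.subι_injective _ hρ.graded.isHomogeneous_ker ?_)
      change kerι hρ.graded x - σ (ρ (kerι hρ.graded x)) = kerι hρ.graded x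
      rw [apply_kerι, map_zero, sub_zero]
    · intro m
      obtain ⟨hPg, Q, π, hπ, -⟩ := linearUpTo_restrict_of_projective hφ hA (hS 1) hρ.projective
        hρ.locallyFinite hρ.generated
      obtain ⟨hc, f, g, hex⟩ := hπ.comp_shortExact (hρ.graded.restrictHom hφ.map_mem)
        hρ.surjective hρ.eq_zero
      have hL : LinearUpTo m (s + 1) (ker hπ.graded) :=
        (linearUpTo_restrict_of_projective hφ hA (hS (m + 1)) hρ.projective
          hρ.locallyFinite hρ.generated).ker_of_isCover hπ
      -- The sequence is now used to control its right-hand term: `ker π` and the kernel of `Q → M`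
      -- are linear over `B`, hence so is `ker ρ`.
      have := hex.linearUpTo_right (n := m) (s := s + 1)
        (fun s N => exists_isCover_of_isSemisimpleRing.{u, v, w} hB s N)
        (hc.locallyFinite.of_injective (isGradedHom_subι _ _ _) (subι_injective _ _ _)) hL
        ((hM (m + 1)).ker_of_isCover hc)
      exact this.retract (ker_restrictHom_retract hφ.map_mem hρ.graded).1

end Semisimple

end GrModule

/-! ### Koszulity over the algebra and over the subalgebra -/

section Main

variable {k : Type u} [Field k] {A B : Type v} [Ring A] [Algebra k A] [Ring B] [Algebra k B]
  {𝒜 : ℕ → Submodule k A} {ℬ : ℕ → Submodule k B} {φ : B →ₐ[k] A}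
  [GradedAlgebra 𝒜] [GradedAlgebra ℬ] [IsSemisimpleRing (DegreeZeroRing ℬ)]

open GrModule

theorem isKoszulAlgebra_iff_linearUpTo :
    IsKoszulAlgebra 𝒜 ↔ ∀ n, LinearUpTo n 0 (degreeZeroModule 𝒜) :=
  isKoszul_iff_linearUpTo (isGradedHom_id (degreeZeroModule 𝒜)) Function.bijective_id

/-- For the converse, `linearUpTo_of_restrict` is applied to the module `A_0`: it is projective over
itself, and its restriction is concentrated in degree `0` over the semisimple `B_0`, hence linear
when `B` is Koszul. -/
theorem isKoszulAlgebra_iff (hφ : IsPositivelyBijective 𝒜 ℬ φ) (hA : ∀ i, Module.Finite k (𝒜 i))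
    (hself : IsSelfInjective (DegreeZeroRing 𝒜)) :
    IsKoszulAlgebra 𝒜 ↔ Module.Projective (DegreeZeroRing 𝒜) A ∧ IsKoszulAlgebra ℬ := by
  rw [isKoszulAlgebra_iff_linearUpTo, isKoszulAlgebra_iff_linearUpTo]
  constructor
  · intro h
    exact ⟨selfModule_isProjectiveOverDegreeZero hA hself h,
      linearUpTo_degreeZeroModule_of_restrict hφ hA h⟩
  · rintro ⟨hp, hS⟩
    have hR : (degreeZeroModule 𝒜).IsProjectiveOverDegreeZero := by
      let f : DegreeZeroRing 𝒜 →ₗ[DegreeZeroRing 𝒜] (degreeZeroModule 𝒜).carrier :=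
        { toFun := fun r => (⟨r.1, r.2⟩ : 𝒜 0)
          map_add' := fun _ _ => rfl
          map_smul' := fun r x => degreeZeroVal_injective <| by
            refine Eq.trans ?_ (degreeZeroVal_smul r.1 _).symm
            rw [DirectSum.decompose_of_mem_same 𝒜 r.2]
            rfl }
      exact Module.Projective.of_equiv (LinearEquiv.ofBijective f
        ⟨fun x y h => Subtype.ext (congrArg degreeZeroVal h),
          fun y => ⟨⟨degreeZeroVal y, degreeZeroVal_mem y⟩, rfl⟩⟩)
    have hlf := degreeZeroModule_locallyFinite (𝒜 := 𝒜) hA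
    refine linearUpTo_of_restrict.{u, v, 0} hφ hA hp hS hlf hR fun n => ?_
    exact linearUpTo_of_concentrated.{u, v, 0} _ mem_gr_degreeZeroModule hlf
      (Module.projective_of_isSemisimpleRing _ _) (hS n)

/-- The transfer lemmas require `M` to live in the universe of its resolutions, so they are applied
to its universe lift. -/
theorem GrModule.isKoszul_iff_restrict (hφ : IsPositivelyBijective 𝒜 ℬ φ) (hA : ∀ i, Module.Finite k (𝒜 i))
    (hself : IsSelfInjective (DegreeZeroRing 𝒜))
    (hK : IsKoszulAlgebra 𝒜) (M : GrModule.{u, v, z} 𝒜) (hlf : M.LocallyFinite) :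
    M.IsKoszul ↔ M.IsProjectiveOverDegreeZero ∧ (M.restrict φ hφ.map_mem).IsKoszul := by
  obtain ⟨hp, hS⟩ := (isKoszulAlgebra_iff hφ hA hself).1 hK
  rw [isKoszulAlgebra_iff_linearUpTo] at hK hS
  let e := (upEquiv.{u, v, z, v} M).symm.toLinearMap
  have he : IsGradedHom (ulift.{u, v, z, v} M) M e := fun j m hm => hm
  have heb : Function.Bijective e := (upEquiv.{u, v, z, v} M).symm.bijective
  rw [isKoszul_iff_linearUpTo he heb, isKoszul_iff_linearUpTo (he.restrictHom hφ.map_mem) heb]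
  obtain ⟨hr, hr'⟩ := isGradedRetract_of_bijective he heb
  constructor
  · intro h
    exact ⟨hr'.isProjectiveOverDegreeZero (isProjectiveOverDegreeZero_of_linearUpTo hA hself hK h),
      fun n => linearUpTo_restrict.{u, v, z} hφ hA (hS n) h⟩
  · rintro ⟨hM, h⟩
    exact linearUpTo_of_restrict.{u, v, z} hφ hA hp hS (hr.locallyFinite hlf)
      (hr.isProjectiveOverDegreeZero hM) h

end Main

/-! ### Primitive idempotents in Artinian rings -/

/-- Fitting's lemma for right multiplication by `c`: for large `n`, `R` is the direct sum of the
annihilator of `c ^ n` and of `R c ^ n`. The components `a` and `b` of `e` are orthogonal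
idempotents, so one vanishes. If `b = 0` then `c ^ n = e * c ^ n = 0`, which is excluded; so `e`
lies in `R c ^ n`. -/
theorem exists_left_inverse_of_isPrimitiveIdempotentElem {R : Type w} [Ring R] [IsArtinianRing R]
    {e c : R} (he : IsPrimitiveIdempotentElem e) (hec : e * c = c) (hce : c * e = c)
    (hc : ∀ n, c ^ n ≠ 0) : ∃ d, e * d = d ∧ d * c = e := by
  let φ : R →ₗ[R] R := LinearMap.toSpanSingleton R R c
  have hφ : ∀ n r, (φ ^ n) r = r * c ^ n := by
    intro n
    induction n with
    | zero => simp
    | succ n ih =>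
      intro r
      rw [pow_succ', Module.End.mul_apply, ih, LinearMap.toSpanSingleton_apply, smul_eq_mul,
        mul_assoc, pow_succ]
  obtain ⟨n, hn, hn1⟩ := (φ.eventually_isCompl_ker_pow_range_pow.and
    (Filter.eventually_ge_atTop 1)).exists
  have huniq : ∀ a b a' b', a * c ^ n = 0 → a' * c ^ n = 0 → (∃ s, s * c ^ n = b) →
      (∃ s, s * c ^ n = b') → a + b = a' + b' → a = a' ∧ b = b' := by
    rintro a b a' b' ha ha' ⟨s, rfl⟩ ⟨s', rfl⟩ h
    have h1 : a - a' = (s' - s) * c ^ n := by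
      rw [sub_mul, sub_eq_sub_iff_add_eq_add, h, add_comm]
    have h2 : a - a' = 0 := by
      refine (Submodule.disjoint_def.1 hn.disjoint) _ ?_ ?_
      · rw [LinearMap.mem_ker, hφ, sub_mul, ha, ha', sub_zero]
      · exact ⟨s' - s, by rw [hφ, h1]⟩
    have h3 : a = a' := sub_eq_zero.1 h2
    subst h3
    exact ⟨rfl, add_left_cancel h⟩
  obtain ⟨a, ha, b, hb, hab⟩ := Submodule.mem_sup.1
    (hn.sup_eq_top ▸ Submodule.mem_top (x := e))
  rw [LinearMap.mem_ker, hφ] at ha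
  obtain ⟨s, hs⟩ := hb
  rw [hφ] at hs
  have hpe : c ^ n * e = c ^ n := by
    obtain ⟨m, rfl⟩ := Nat.exists_eq_add_of_le' hn1
    rw [pow_succ, mul_assoc, hce]
  have hep : e * c ^ n = c ^ n := by
    obtain ⟨m, rfl⟩ := Nat.exists_eq_add_of_le' hn1
    rw [pow_succ', ← mul_assoc, hec]
  have hbe : b * e = b := by rw [← hs, mul_assoc, hpe]
  have hae : a * e = a := by
    rw [eq_sub_of_add_eq hab, sub_mul, hbe, he.1.eq]
  -- Multiplying `e = a + b` on the left by `e`, `b` and `a` and comparing Fitting components yields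
  -- `e * b = b` and then the idempotency and orthogonality relations.
  obtain ⟨-, heb⟩ := huniq (e * a) (e * b) a b (by rw [mul_assoc, ha, mul_zero]) ha
    ⟨e * s, by rw [mul_assoc, hs]⟩ ⟨s, hs⟩ (by rw [← mul_add, hab, he.1.eq])
  obtain ⟨hba, hbb⟩ := huniq (b * a) (b * b) 0 b (by rw [mul_assoc, ha, mul_zero]) (zero_mul _)
    ⟨b * s, by rw [mul_assoc, hs]⟩ ⟨s, hs⟩ (by rw [← mul_add, hab, hbe, zero_add])
  obtain ⟨haa, hab'⟩ := huniq (a * a) (a * b) a 0 (by rw [mul_assoc, ha, mul_zero]) ha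
    ⟨a * s, by rw [mul_assoc, hs]⟩ ⟨0, zero_mul _⟩ (by rw [← mul_add, hab, hae, add_zero])
  rcases he.2.2 a b haa hbb hab' hba hab.symm with h | h
  · subst h
    rw [zero_add] at hab
    obtain ⟨m, rfl⟩ := Nat.exists_eq_add_of_le' hn1
    refine ⟨e * (s * c ^ m), by rw [← mul_assoc, he.1.eq], ?_⟩
    rw [mul_assoc, mul_assoc, ← pow_succ, hs, heb, hab]
  · subst h
    rw [add_zero] at hab
    subst hab
    exact absurd (hep.symm.trans ha) (hc n)

/-- A nonzero finitely generated projective module over an Artinian ring has a direct summand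
generated by a primitive idempotent. -/
theorem exists_primitive_summand {R : Type w} [Ring R] [IsArtinianRing R] {ι : Type*} [Fintype ι]
    {e : ι → R} (he : CompleteOrthogonalIdempotents e)
    (hp : ∀ i, IsPrimitiveIdempotentElem (e i)) (Q : Type z) [AddCommGroup Q] [Module R Q]
    [Module.Projective R Q] [Module.Finite R Q] [Nontrivial Q] :
    ∃ (i : ι) (x : Q) (f : Q →ₗ[R] R), e i • x = x ∧ f x = e i := by
  obtain ⟨N, hN⟩ := IsCoatomic.exists_coatom (Submodule R Q)
  have : IsSimpleModule R (Q ⧸ N) := isSimpleModule_iff_isCoatom.2 hN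
  have := IsSimpleModule.nontrivial R (Q ⧸ N)
  obtain ⟨t, ht⟩ := exists_ne (0 : Q ⧸ N)
  obtain ⟨i, hi⟩ : ∃ i, e i • t ≠ 0 := by
    by_contra! h
    apply ht
    rw [← one_smul R t, ← he.complete, Finset.sum_smul]
    exact Finset.sum_eq_zero fun i _ => h i
  have het : e i • e i • t = e i • t := by rw [smul_smul, (hp i).1.eq]
  generalize e i • t = t' at hi het
  -- The projection to the simple quotient lifts through `R → Q ⧸ N`, `1 ↦ t'`. As `e i` fixes `t'`,
  -- the lift may be chosen with values in `R e_i`.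
  let ρ := LinearMap.toSpanSingleton R (Q ⧸ N) t'
  have hρ : Function.Surjective ρ := IsSimpleModule.toSpanSingleton_surjective R hi
  obtain ⟨f₀, hf₀⟩ := Module.projective_lifting_property ρ N.mkQ hρ
  have hf₀' : ∀ x, f₀ x • t' = N.mkQ x := fun x => LinearMap.congr_fun hf₀ x
  let f : Q →ₗ[R] R := LinearMap.toSpanSingleton R R (e i) ∘ₗ f₀
  have hf : ∀ x, f x = f₀ x * e i := fun x => rfl
  have hft : ∀ x, f x • t' = N.mkQ x := by
    intro x
    rw [hf, mul_smul, het, hf₀']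
  obtain ⟨y, hy⟩ := N.mkQ_surjective t'
  -- The element `f (e i • y)` of `e_i R e_i` fixes the nonzero vector `t'`, so it is not nilpotent
  -- and has a left inverse relative to `e i`. Rescaling `e i • y` by this inverse normalises the
  -- value of `f` to `e i`.
  have hc : ∀ n, (f (e i • y)) ^ n • t' = t' := by
    intro n
    induction n with
    | zero => simp
    | succ n ih => rw [pow_succ, mul_smul, hft, N.mkQ.map_smul, hy, het, ih]
  obtain ⟨d, hd, hdc⟩ := exists_left_inverse_of_isPrimitiveIdempotentElem (c := f (e i • y)) (hp i)
    (by rw [map_smul, smul_eq_mul, ← mul_assoc, (hp i).1.eq])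
    (by rw [hf, mul_assoc, (hp i).1.eq])
    (fun n h => hi (by rw [← hc n, h, zero_smul]))
  refine ⟨i, d • e i • y, f, by rw [smul_smul, hd], ?_⟩
  rw [map_smul, smul_eq_mul, hdc]

/-- Induction on the left ideal `R e`, well-founded in an Artinian ring: if `e = f + g` is a
nontrivial orthogonal splitting, both `R f` and `R g` are strictly smaller. -/
theorem IsIdempotentElem.exists_primitive_decomposition {R : Type w} [Ring R] [IsArtinianRing R]
    {e : R} (he : IsIdempotentElem e) :
    ∃ (n : ℕ) (f : Fin n → R), OrthogonalIdempotents f ∧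
      (∀ i, IsPrimitiveIdempotentElem (f i)) ∧ ∑ i, f i = e := by
  generalize hI : Submodule.span R {e} = I
  induction I using WellFoundedLT.induction generalizing e with
  | _ I ih =>
    subst hI
    by_cases h0 : e = 0
    · subst h0
      exact ⟨0, Fin.elim0, ⟨fun i => i.elim0, fun i => i.elim0⟩, fun i => i.elim0, by simp⟩
    by_cases hp : IsPrimitiveIdempotentElem e
    · refine ⟨1, fun _ => e, ⟨fun _ => he, fun i j h => absurd (Subsingleton.elim i j) h⟩,
        fun _ => hp, by simp⟩
    simp only [IsPrimitiveIdempotentElem, not_and, not_forall, not_or] at hp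
    obtain ⟨f, g, hf, hg, hfg, hgf, rfl, hf0, hg0⟩ := hp he h0
    have key : ∀ f g : R, IsIdempotentElem f → IsIdempotentElem g → f * g = 0 → g * f = 0 →
        g ≠ 0 → Submodule.span R {f} < Submodule.span R {f + g} := by
      intro f g hf hg hfg hgf hg0
      refine lt_of_le_of_ne ?_ fun h => hg0 ?_
      · rw [Submodule.span_singleton_le_iff_mem, Submodule.mem_span_singleton]
        exact ⟨f, by rw [smul_eq_mul, mul_add, hf.eq, hfg, add_zero]⟩
      · have : f + g ∈ Submodule.span R {f} := h ▸ Submodule.mem_span_singleton_self _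
        obtain ⟨s, hs⟩ := Submodule.mem_span_singleton.1 this
        have := congrArg (fun t => t * g) hs
        simpa [mul_assoc, add_mul, hfg, hg.eq] using this.symm
    obtain ⟨m, a, ha, hap, has⟩ := ih _ (key f g hf hg hfg hgf hg0) hf rfl
    obtain ⟨n, b, hb, hbp, hbs⟩ := ih _ (by
      rw [add_comm]
      exact key g f hg hf hgf hfg hf0) hg rfl
    -- The pieces of `f` lie in `f R f`, and likewise those of `g` in `g R g`; orthogonality of `f`
    -- and `g` then makes the two families mutually orthogonal.
    have haf : ∀ i, a i * f = a i ∧ f * a i = a i := by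
      intro i
      rw [← has, Finset.mul_sum, Finset.sum_mul]
      constructor
      · rw [Finset.sum_eq_single i (fun j _ hj => ha.ortho (Ne.symm hj)) (by simp), (ha.idem i).eq]
      · rw [Finset.sum_eq_single i (fun j _ hj => ha.ortho hj) (by simp), (ha.idem i).eq]
    have hbg : ∀ i, b i * g = b i ∧ g * b i = b i := by
      intro i
      rw [← hbs, Finset.mul_sum, Finset.sum_mul]
      constructor
      · rw [Finset.sum_eq_single i (fun j _ hj => hb.ortho (Ne.symm hj)) (by simp), (hb.idem i).eq]
      · rw [Finset.sum_eq_single i (fun j _ hj => hb.ortho hj) (by simp), (hb.idem i).eq]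
    have hab : ∀ i j, a i * b j = 0 := fun i j => by
      rw [← (haf i).1, ← (hbg j).2, mul_assoc, ← mul_assoc f, hfg, zero_mul, mul_zero]
    have hba : ∀ i j, b i * a j = 0 := fun i j => by
      rw [← (hbg i).1, ← (haf j).2, mul_assoc, ← mul_assoc g, hgf, zero_mul, mul_zero]
    have hs : OrthogonalIdempotents (Sum.elim a b) := by
      refine ⟨fun i => ?_, fun i j hij => ?_⟩
      · cases i with
        | inl i => exact ha.idem i
        | inr i => exact hb.idem i
      · cases i with
        | inl i =>
          cases j with
          | inl j => exact ha.ortho fun h => hij (congrArg _ h)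
          | inr j => exact hab i j
        | inr i =>
          cases j with
          | inl j => exact hba i j
          | inr j => exact hb.ortho fun h => hij (congrArg _ h)
    refine ⟨m + n, Sum.elim a b ∘ finSumFinEquiv.symm, ⟨fun i => hs.idem _, fun i j hij =>
      hs.ortho fun h => hij (finSumFinEquiv.symm.injective h)⟩, fun i => ?_, ?_⟩
    · simp only [Function.comp_apply]
      cases finSumFinEquiv.symm i with
      | inl i => exact hap i
      | inr i => exact hbp i
    · rw [← has, ← hbs]
      simp only [Function.comp_apply]
      rw [Equiv.sum_comp finSumFinEquiv.symm (Sum.elim a b), Fintype.sum_sum_type]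
      rfl

theorem IsDirectedCategory.nonempty_primitiveSystem {k : Type u} [Field k] {C : Type v}
    [Category.{w} C] [Preadditive C] [Linear k C] {le : C → C → Prop}
    (hC : IsDirectedCategory k C le) : Nonempty (PrimitiveSystem C) := by
  have h : ∀ x : C, ∃ (n : ℕ) (f : Fin n → End x), CompleteOrthogonalIdempotents f ∧
      ∀ i, IsPrimitiveIdempotentElem (f i) := by
    intro x
    have : Module.Finite k (End x) := hC.finite_hom x x
    have : IsArtinianRing (End x) := IsArtinianRing.of_finite k _
    obtain ⟨n, f, hf, hp, hs⟩ :=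
      IsIdempotentElem.exists_primitive_decomposition (R := End x) IsIdempotentElem.one
    exact ⟨n, f, ⟨hf, hs⟩, hp⟩
  choose n f hf hp using h
  exact ⟨⟨n, f, hf, hp⟩⟩

/-! ### Composition in a directed category and its associated algebra -/

namespace IsDirectedCategory

variable {k : Type u} [Field k] {C : Type v} [Category.{w} C] [Preadditive C] [Linear k C]
  {le : C → C → Prop}

theorem comp_eq_zero (hC : IsDirectedCategory k C le) {x y : C} (h : x ≠ y) (f : x ⟶ y)
    (g : y ⟶ x) : f ≫ g = 0 := by
  by_cases hf : f = 0
  · rw [hf, Limits.zero_comp]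
  by_cases hg : g = 0
  · rw [hg, Limits.comp_zero]
  have := hC.isPartialOrder
  exact absurd (antisymm_of le (hC.le_of_ne_zero _ _ f hf) (hC.le_of_ne_zero _ _ g hg)) h

variable [Fintype C] [DecidableEq C]

/-- A composite `x → t → x` with `t ≠ x` vanishes by antisymmetry. So passing to diagonal components
is multiplicative, up to the order convention. -/
theorem mul_apply_self (hC : IsDirectedCategory k C le) (b a : AssocAlg C) (x : C) :
    (b * a) x x = a x x ≫ b x x := by
  rw [AssocAlg.mul_apply, Finset.sum_eq_single x]
  · exact fun t _ ht => hC.comp_eq_zero (Ne.symm ht) _ _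
  · simp

theorem finite_assocAlg (hC : IsDirectedCategory k C le) : Module.Finite k (AssocAlg C) := by
  have := hC.finite_hom
  exact inferInstanceAs (Module.Finite k (∀ x y : C, x ⟶ y))

end IsDirectedCategory

namespace AssocAlg

variable {C : Type v} [Category.{w} C] [Preadditive C] [Fintype C] [DecidableEq C]
  (k : Type u) [Field k] [Linear k C]

theorem mul_single_apply (b : AssocAlg C) {x : C} (f : x ⟶ x) (y : C) :
    (b * single k x x f) x y = f ≫ b x y := by
  rw [mul_apply, Finset.sum_eq_single x, single_self]
  · exact fun t _ ht => by rw [single_of_ne k _ _ _ _ _ fun h => ht h.2.symm, Limits.zero_comp]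
  · simp

theorem mul_single_apply_of_ne (b : AssocAlg C) {x x' : C} (f : x ⟶ x) (h : x ≠ x') (y : C) :
    (b * single k x x f) x' y = 0 := by
  rw [mul_apply]
  exact Finset.sum_eq_zero fun t _ => by
    rw [single_of_ne k _ _ _ _ _ fun e => h e.1, Limits.zero_comp]

theorem single_mul_apply (b : AssocAlg C) {y : C} (f : y ⟶ y) (x : C) :
    (single k y y f * b) x y = b x y ≫ f := by
  rw [mul_apply, Finset.sum_eq_single y, single_self]
  · exact fun t _ ht => by rw [single_of_ne k _ _ _ _ _ fun h => ht h.1.symm, Limits.comp_zero]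
  · simp

theorem single_mul_apply_of_ne (b : AssocAlg C) {y y' : C} (f : y ⟶ y) (h : y ≠ y') (x : C) :
    (single k y y f * b) x y' = 0 := by
  rw [mul_apply]
  exact Finset.sum_eq_zero fun t _ => by
    rw [single_of_ne k _ _ _ _ _ fun e => h e.2, Limits.comp_zero]

theorem single_mul_single (x : C) (f g : x ⟶ x) :
    single k x x g * single k x x f = single k x x (f ≫ g) := by
  ext x' y'
  by_cases hx : x = x'
  · subst hx
    by_cases hy : x = y'
    · subst hy
      rw [mul_single_apply, single_self, single_self]
    · rw [single_mul_apply_of_ne k _ _ hy, single_of_ne k _ _ _ _ _ fun h => hy h.2]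
  · rw [mul_single_apply_of_ne k _ _ hx, single_of_ne k _ _ _ _ _ fun h => hx h.1]

theorem single_mul_single_of_ne {x y : C} (h : x ≠ y) (f : x ⟶ x) (g : y ⟶ y) :
    single k y y g * single k x x f = 0 := by
  ext x' y'
  by_cases hx : x = x'
  · subst hx
    rw [mul_single_apply, single_of_ne k _ _ _ _ _ fun e => h e.1.symm, Limits.comp_zero]
    rfl
  · rw [mul_single_apply_of_ne k _ _ hx]
    rfl

theorem sum_single_id : ∑ x : C, single k x x (𝟙 x) = 1 := by
  rw [← sum_single k (1 : AssocAlg C)]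
  refine Finset.sum_congr rfl fun x _ => ?_
  rw [Finset.sum_eq_single x]
  · rw [one_apply, dif_pos rfl, eqToHom_refl]
  · intro y _ hy
    rw [one_apply, dif_neg (Ne.symm hy), map_zero]
  · simp

end AssocAlg

/-! ### Endomorphisms as the degree zero part; traces in projectives -/

section Directed

variable {k : Type u} [Field k] {C : Type v} [Category.{w} C] [Preadditive C] [Linear k C]
  [Fintype C] [DecidableEq C] {le : C → C → Prop}

namespace CatGrading.IsGradedDirected

variable {G : CatGrading k C}

theorem mem_alg_zero (hG : G.IsGradedDirected) {a : AssocAlg C} :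
    a ∈ G.alg 0 ↔ ∀ x y, x ≠ y → a x y = 0 := by
  constructor
  · intro h x y hxy
    have := h x y
    rwa [hG.gr_zero_of_ne x y hxy] at this
  · intro h x y
    by_cases hxy : x = y
    · subst hxy
      rw [hG.gr_zero_self]
      trivial
    · rw [h x y hxy]
      exact zero_mem _

theorem apply_self_eq_zero (hG : G.IsGradedDirected) {i : ℕ} (hi : i ≠ 0) {a : AssocAlg C}
    (ha : a ∈ G.alg i) (x : C) : a x x = 0 := by
  have hd := (G.isInternal x x).submodule_iSupIndep.pairwiseDisjoint hi
  refine (Submodule.disjoint_def.1 hd) _ (ha x x) ?_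
  rw [hG.gr_zero_self]
  trivial

theorem single_mem (hG : G.IsGradedDirected) (x : C) (f : x ⟶ x) :
    AssocAlg.single k x x f ∈ G.alg 0 :=
  G.single_mem_alg (by rw [hG.gr_zero_self]; trivial)

/-- The projection onto the degree zero part, which consists of the endomorphisms. -/
def diag (hG : G.IsGradedDirected) (hC : IsDirectedCategory k C le) :
    AssocAlg C →ₗ[DegreeZeroRing G.alg] DegreeZeroRing G.alg where
  toFun a := ⟨fun x y => if h : x = y then a x y else 0,
    hG.mem_alg_zero.2 fun x y h => dif_neg h⟩
  map_add' a b := Subtype.ext <| AssocAlg.ext fun x y => by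
    change (if h : x = y then (a + b) x y else 0) =
      (if h : x = y then a x y else 0) + (if h : x = y then b x y else 0)
    split_ifs <;> simp
  map_smul' r a := Subtype.ext <| AssocAlg.ext fun x y => by
    have hm : (r • (⟨fun x y => if h : x = y then a x y else 0,
        hG.mem_alg_zero.2 fun x y h => dif_neg h⟩ : DegreeZeroRing G.alg)).1 ∈ G.alg 0 := Subtype.prop _
    by_cases h : x = y
    · subst h
      refine (dif_pos rfl).trans ?_
      refine (hC.mul_apply_self r.1 a x).trans ?_
      refine Eq.trans ?_ (hC.mul_apply_self r.1 _ x).symm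
      have h1 : (if h : x = x then a x x else 0) = a x x := dif_pos rfl
      exact congrArg (fun t => t ≫ r.1 x x) h1.symm
    · exact (dif_neg h).trans (hG.mem_alg_zero.1 hm x y h).symm

theorem diag_apply_self (hG : G.IsGradedDirected) (hC : IsDirectedCategory k C le)
    (a : AssocAlg C) (x : C) : (hG.diag hC a).1 x x = a x x := dif_pos rfl

theorem diag_apply_of_ne (hG : G.IsGradedDirected) (hC : IsDirectedCategory k C le)
    (a : AssocAlg C) {x y : C} (h : x ≠ y) : (hG.diag hC a).1 x y = 0 := dif_neg h

end CatGrading.IsGradedDirected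

namespace PrimitiveSystem

variable (k) (E : PrimitiveSystem C)

/-- The idempotent `e_λ` as an element of the associated algebra. -/
def idem (l : E.Index) : AssocAlg C := AssocAlg.single k l.1 l.1 (E.e l.1 l.2)

theorem completeOrthogonalIdempotents_idem :
    CompleteOrthogonalIdempotents (E.idem k) where
  idem l := (AssocAlg.single_mul_single k _ _ _).trans
    (congrArg _ ((E.complete l.1).idem l.2))
  ortho := by
    rintro ⟨x, i⟩ ⟨y, j⟩ h
    by_cases hxy : x = y
    · subst hxy
      refine (AssocAlg.single_mul_single k _ _ _).trans ?_
      have : E.e x j ≫ E.e x i = 0 := (E.complete x).ortho (i := i) (j := j) fun e => h (by rw [e])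
      rw [this, map_zero]
    · exact AssocAlg.single_mul_single_of_ne k (Ne.symm hxy) _ _
  complete := by
    rw [Fintype.sum_sigma, ← AssocAlg.sum_single_id k]
    refine Finset.sum_congr rfl fun x _ => ?_
    simp only [idem]
    exact (map_sum (AssocAlg.single k x x) (fun i => (E.e x i : x ⟶ x)) Finset.univ).symm.trans
      (congrArg (AssocAlg.single k x x) (E.complete x).complete)

theorem mem_proj {l : E.Index} {a : AssocAlg C} : a ∈ E.proj k l ↔ a * E.idem k l = a := by
  rw [proj, Submodule.mem_span_singleton]
  constructor
  · rintro ⟨b, rfl⟩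
    exact (mul_assoc _ _ _).trans
      (congrArg (fun t => b * t) ((E.completeOrthogonalIdempotents_idem k).idem l))
  · exact fun h => ⟨a, h⟩

theorem idem_mem_proj (l : E.Index) : E.idem k l ∈ E.proj k l := Submodule.mem_span_singleton_self _

theorem apply_of_mem_proj {l : E.Index} {a : AssocAlg C} (ha : a ∈ E.proj k l) {x : C}
    (h : l.1 ≠ x) (y : C) : a x y = 0 := by
  rw [← (E.mem_proj k).1 ha]
  exact AssocAlg.mul_single_apply_of_ne k a _ h y

/-- `Σ_μ tr_{P_μ}(P_λ)` is the part of positive degree of `P_λ`. -/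
theorem mem_traceSum (hC : IsDirectedCategory k C le) {l : E.Index} {a : E.proj k l} :
    a ∈ E.traceSum k le l ↔ (a : AssocAlg C) l.1 l.1 = 0 := by
  have hpo := hC.isPartialOrder
  constructor
  · let K : Submodule (AssocAlg C) (E.proj k l) :=
      { carrier := {a | (a : AssocAlg C) l.1 l.1 = 0}
        add_mem' := fun {a b} ha hb => by
          change (a : AssocAlg C) l.1 l.1 + (b : AssocAlg C) l.1 l.1 = 0
          rw [show (a : AssocAlg C) l.1 l.1 = 0 from ha, show (b : AssocAlg C) l.1 l.1 = 0 from hb,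
            add_zero]
        zero_mem' := rfl
        smul_mem' := fun c a ha => by
          change (c * (a : AssocAlg C)) l.1 l.1 = 0
          rw [hC.mul_apply_self, show (a : AssocAlg C) l.1 l.1 = 0 from ha, Limits.zero_comp] }
    suffices h : E.traceSum k le l ≤ K from fun ha => h ha
    -- `P_μ` is generated by `e_μ`, and `f e_μ = e_μ • f e_μ` has its target at the object of `μ`.
    -- That object differs from the object of `λ`, since `le` is reflexive.
    refine iSup₂_le fun m hm => iSup_le fun f => ?_
    rintro _ ⟨⟨b, hb⟩, rfl⟩
    have h1 : (⟨b, hb⟩ : E.proj k m) = b • ⟨E.idem k m, E.idem_mem_proj k m⟩ :=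
      Subtype.ext ((E.mem_proj k).1 hb).symm
    have h2 : (⟨E.idem k m, E.idem_mem_proj k m⟩ : E.proj k m) =
        E.idem k m • ⟨E.idem k m, E.idem_mem_proj k m⟩ :=
      Subtype.ext ((E.completeOrthogonalIdempotents_idem k).idem m).symm
    rw [h1, map_smul]
    refine K.smul_mem b ?_
    rw [h2, map_smul]
    refine AssocAlg.single_mul_apply_of_ne k _ _ ?_ _
    intro h
    exact hm (h ▸ refl_of le _)
  · intro ha
    -- Splitting `a` by targets: a piece with `m.1` below `l.1` vanishes, since a nonzero one would
    -- force the objects to coincide, where `a` is zero. Every other piece is the image of `e_μ`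
    -- under right multiplication by `a`.
    have h1 : a = ∑ m, E.idem k m • a := by
      rw [← Finset.sum_smul, (E.completeOrthogonalIdempotents_idem k).complete, one_smul]
    rw [h1]
    refine sum_mem fun m _ => ?_
    by_cases hm : le m.1 l.1
    · have : E.idem k m • a = 0 := by
        apply Subtype.ext
        change E.idem k m * (a : AssocAlg C) = 0
        ext x y
        by_cases hx : l.1 = x
        · subst hx
          by_cases hy : m.1 = y
          · subst hy
            refine (AssocAlg.single_mul_apply k _ _ _).trans ?_
            have h0 : (a : AssocAlg C) l.1 m.1 = 0 := by
              by_contra h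
              have hlm := antisymm_of le hm (hC.le_of_ne_zero _ _ _ h)
              rw [hlm] at h
              exact h ha
            rw [h0, Limits.zero_comp]
            rfl
          · exact AssocAlg.single_mul_apply_of_ne k _ _ hy _
        · exact E.apply_of_mem_proj k (Submodule.smul_mem _ (E.idem k m) a.2) hx y
      rw [this]
      exact zero_mem _
    · let f : E.proj k m →ₗ[AssocAlg C] E.proj k l :=
        { toFun := fun b => ⟨(b : AssocAlg C) * a, Submodule.smul_mem _ (b : AssocAlg C) a.2⟩
          map_add' := fun b c => Subtype.ext (add_mul _ _ _)
          map_smul' := fun b c => Subtype.ext (mul_assoc _ _ _) }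
      exact Submodule.mem_iSup_of_mem m (Submodule.mem_iSup_of_mem hm
        (Submodule.mem_iSup_of_mem f ⟨⟨E.idem k m, E.idem_mem_proj k m⟩, rfl⟩))

end PrimitiveSystem

end Directed

/-! ### Standard stratification and projectivity over the degree zero part -/

theorem Module.Projective.of_exact {R : Type v} [Ring R] {K M P : Type*}
    [AddCommGroup K] [Module R K] [AddCommGroup P] [Module R P] [AddCommGroup M] [Module R M]
    [Module.Projective R K] [Module.Projective R M] {i : K →ₗ[R] P} {f : P →ₗ[R] M}
    (hi : Function.Injective i) (hf : Function.Surjective f) (h : Function.Exact i f) :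
    Module.Projective R P := by
  obtain ⟨σ, hσ⟩ := Module.projective_lifting_property f LinearMap.id hf
  have hσ' : ∀ m, f (σ m) = m := fun m => LinearMap.congr_fun hσ m
  have hfi : ∀ x, f (i x) = 0 := fun x => (h _).2 ⟨x, rfl⟩
  refine Module.Projective.of_equiv (LinearEquiv.ofBijective (i.coprod σ) ⟨?_, ?_⟩)
  · rw [injective_iff_map_eq_zero]
    rintro ⟨x, m⟩ hx
    simp only [LinearMap.coprod_apply] at hx
    have h1 := congrArg f hx
    rw [map_add, hfi, hσ', zero_add, map_zero] at h1
    subst h1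
    rw [map_zero, add_zero] at hx
    exact Prod.ext (hi (hx.trans (map_zero i).symm)) rfl
  · intro p
    obtain ⟨x, hx⟩ := (h (p - σ (f p))).1 (by rw [map_sub, hσ', sub_self])
    exact ⟨(x, f p), by rw [LinearMap.coprod_apply, hx, sub_add_cancel]⟩

theorem Module.Projective.of_submoduleOf {A : Type v} [Ring A] (R : Subring A) {N : Type*}
    [AddCommGroup N] [Module A N] {U V : Submodule A N} (h : U ≤ V) [Module.Projective R U]
    [Module.Projective R (V ⧸ U.submoduleOf V)] : Module.Projective R V := by
  refine Module.Projective.of_exact (i := (Submodule.inclusion h).restrictScalars R)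
    (f := (U.submoduleOf V).mkQ.restrictScalars R)
    (Submodule.inclusion_injective h) (U.submoduleOf V).mkQ_surjective fun x => ?_
  have hx : (U.submoduleOf V).mkQ x = 0 ↔ x ∈ U.submoduleOf V := by
    rw [← LinearMap.mem_ker, Submodule.ker_mkQ]
  refine hx.trans ⟨fun h => ⟨⟨x, h⟩, rfl⟩, ?_⟩
  rintro ⟨y, rfl⟩
  exact y.2

/-- The degree zero ring as a `k`-algebra. -/
abbrev DegreeZeroRing.algebra {k : Type u} [Field k] {A : Type v} [Ring A] [Algebra k A]
    (𝒜 : ℕ → Submodule k A) [GradedAlgebra 𝒜] : Algebra k (DegreeZeroRing 𝒜) :=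
  inferInstanceAs (Algebra k (SetLike.GradeZero.subalgebra 𝒜))

section Directed

variable {k : Type u} [Field k] {C : Type v} [Category.{w} C] [Preadditive C] [Linear k C]
  [Fintype C] [DecidableEq C] {le : C → C → Prop} {G : CatGrading k C}

namespace PrimitiveSystem

variable (E : PrimitiveSystem C)

/-- By `mem_traceSum`, `Δ_λ` is `A_0 e_λ`: the diagonal part maps it to `A_0`, and `1 ↦ e_λ` gives a
map back that splits this. -/
theorem standard_projective (hC : IsDirectedCategory k C le) (hG : G.IsGradedDirected)
    (l : E.Index) : Module.Projective (DegreeZeroRing G.alg) (E.Standard k le l) := by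
  let R := DegreeZeroRing G.alg
  let T := (E.traceSum k le l).restrictScalars R
  let d : E.proj k l →ₗ[R] R := hG.diag hC ∘ₗ ((E.proj k l).subtype.restrictScalars R)
  have hd : T ≤ LinearMap.ker d := by
    intro a ha
    have h0 : (a : AssocAlg C) l.1 l.1 = 0 := (E.mem_traceSum k hC).1 ha
    refine Subtype.ext (AssocAlg.ext fun x y => ?_)
    by_cases hxy : x = y
    · subst hxy
      refine (hG.diag_apply_self hC _ x).trans ?_
      by_cases hx : l.1 = x
      · subst hx
        exact h0
      · exact E.apply_of_mem_proj k a.2 hx x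
    · exact hG.diag_apply_of_ne hC _ hxy
  let s : E.Standard k le l →ₗ[R] R := T.liftQ d hd ∘ₗ
    (Submodule.Quotient.restrictScalarsEquiv R (E.traceSum k le l)).symm.toLinearMap
  let r : R →ₗ[R] E.Standard k le l := LinearMap.toSpanSingleton R _
    ((E.traceSum k le l).mkQ ⟨E.idem k l, E.idem_mem_proj k l⟩)
  refine Module.Projective.of_split s r (LinearMap.ext fun x => ?_)
  obtain ⟨a, rfl⟩ := (E.traceSum k le l).mkQ_surjective x
  change (E.traceSum k le l).mkQ ((d a).1 • ⟨E.idem k l, E.idem_mem_proj k l⟩) =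
    (E.traceSum k le l).mkQ a
  rw [← sub_eq_zero, ← map_sub]
  refine (Submodule.Quotient.mk_eq_zero _).2 ((E.mem_traceSum k hC).2 ?_)
  have h1 : ((d a).1 * E.idem k l) l.1 l.1 = (a : AssocAlg C) l.1 l.1 := by
    refine (hC.mul_apply_self _ _ _).trans ?_
    refine (congrArg (fun t => E.idem k l l.1 l.1 ≫ t)
      (hG.diag_apply_self hC (a : AssocAlg C) l.1)).trans ?_
    refine (hC.mul_apply_self _ _ _).symm.trans ?_
    rw [(E.mem_proj k).1 a.2]
  exact sub_eq_zero.2 h1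

theorem projective_of_hasStandardFiltration (hC : IsDirectedCategory k C le)
    (hG : G.IsGradedDirected) {N : Type z} [AddCommGroup N] [Module (AssocAlg C) N]
    (h : E.HasStandardFiltration k le N) : Module.Projective (DegreeZeroRing G.alg) N := by
  obtain ⟨n, F, hF, h0, hn, hq⟩ := h
  have key : ∀ i ≤ n, Module.Projective (DegreeZeroRing G.alg) (F i) := by
    intro i
    induction i with
    | zero =>
      intro _
      rw [h0]
      infer_instance
    | succ i ih =>
      intro hi
      have := ih (by omega)
      obtain ⟨m, ⟨e⟩⟩ := hq i (by omega)
      have := E.standard_projective hC hG m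
      have hle : F i ≤ F (i + 1) := hF (Nat.le_succ i)
      have : Module.Projective (DegreeZeroRing G.alg)
          (F (i + 1) ⧸ (F i).submoduleOf (F (i + 1))) :=
        Module.Projective.of_equiv (e.symm.restrictScalars (DegreeZeroRing G.alg))
      exact Module.Projective.of_submoduleOf _ hle
  have := key n le_rfl
  rw [hn] at this
  exact Module.Projective.of_equiv
    ((Submodule.topEquiv (R := AssocAlg C) (M := N)).restrictScalars (DegreeZeroRing G.alg))

theorem projective_of_proj (hproj : ∀ l : E.Index,
    Module.Projective (DegreeZeroRing G.alg) (E.proj k l)) :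
    Module.Projective (DegreeZeroRing G.alg) (AssocAlg C) := by
  classical
  have : Module.Projective (DegreeZeroRing G.alg) (∀ l, E.proj k l) :=
    Module.Projective.of_equiv (DFinsupp.linearEquivFunOnFintype (R := DegreeZeroRing G.alg)
      (M := fun l => E.proj k l))
  let i : AssocAlg C →ₗ[DegreeZeroRing G.alg] (∀ l, E.proj k l) :=
    { toFun := fun a l => ⟨a * E.idem k l, Submodule.smul_mem _ a (E.idem_mem_proj k l)⟩
      map_add' := fun a b => funext fun l => Subtype.ext (add_mul _ _ _)
      map_smul' := fun r a => funext fun l => Subtype.ext (mul_assoc _ _ _) }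
  let r : (∀ l, E.proj k l) →ₗ[DegreeZeroRing G.alg] AssocAlg C :=
    ∑ l, ((E.proj k l).subtype.restrictScalars (DegreeZeroRing G.alg)) ∘ₗ LinearMap.proj l
  refine Module.Projective.of_split i r (LinearMap.ext fun a => ?_)
  simp only [r, LinearMap.comp_apply, LinearMap.sum_apply]
  change ∑ l, a * E.idem k l = a
  rw [← Finset.mul_sum, (E.completeOrthogonalIdempotents_idem k).complete, mul_one]

theorem proj_projective (hA : Module.Projective (DegreeZeroRing G.alg) (AssocAlg C)) (l : E.Index) :
    Module.Projective (DegreeZeroRing G.alg) (E.proj k l) := by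
  let r : AssocAlg C →ₗ[DegreeZeroRing G.alg] E.proj k l :=
    { toFun := fun a => ⟨a * E.idem k l, Submodule.smul_mem _ a (E.idem_mem_proj k l)⟩
      map_add' := fun a b => Subtype.ext (add_mul _ _ _)
      map_smul' := fun r a => Subtype.ext (mul_assoc _ _ _) }
  exact Module.Projective.of_split ((E.proj k l).subtype.restrictScalars (DegreeZeroRing G.alg)) r
    (LinearMap.ext fun a => Subtype.ext ((E.mem_proj k).1 a.2))

/-- The idempotent `e_λ` as an element of the degree zero ring. -/
def idemZero (hG : G.IsGradedDirected) (l : E.Index) : DegreeZeroRing G.alg :=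
  ⟨E.idem k l, hG.single_mem _ _⟩

theorem completeOrthogonalIdempotents_idemZero (hG : G.IsGradedDirected) :
    CompleteOrthogonalIdempotents (E.idemZero hG) where
  idem l := Subtype.ext ((E.completeOrthogonalIdempotents_idem k).idem l)
  ortho i j h := Subtype.ext ((E.completeOrthogonalIdempotents_idem k).ortho h)
  complete := Subtype.ext <| by
    rw [AddSubmonoidClass.coe_finsetSum]
    exact (E.completeOrthogonalIdempotents_idem k).complete

/-- An orthogonal summand `f` of `e_λ` satisfies `f * e_λ = f`, so it starts at the object of `λ`;
having degree zero, it also ends there. A splitting in `A_0` is thus determined by one in the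
endomorphism ring of that object. -/
theorem isPrimitiveIdempotentElem_idemZero (hC : IsDirectedCategory k C le)
    (hG : G.IsGradedDirected) (l : E.Index) : IsPrimitiveIdempotentElem (E.idemZero hG l) := by
  obtain ⟨hid, h0, hp⟩ := E.primitive l.1 l.2
  have key : ∀ f g : DegreeZeroRing G.alg, f * g = 0 → IsIdempotentElem f →
      E.idemZero hG l = f + g → f.1 l.1 l.1 = 0 → f = 0 := by
    intro f g hfg hf h hf0
    have h1 : f * E.idemZero hG l = f := by rw [h, mul_add, hf.eq, hfg, add_zero]
    have h2 : f.1 ∈ E.proj k l := (E.mem_proj k).2 (congrArg Subtype.val h1)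
    refine Subtype.ext (AssocAlg.ext fun x y => ?_)
    by_cases hx : l.1 = x
    · subst hx
      by_cases hy : l.1 = y
      · subst hy
        exact hf0
      · exact hG.mem_alg_zero.1 f.2 _ _ hy
    · exact E.apply_of_mem_proj k h2 hx y
  have hmul : ∀ a b : DegreeZeroRing G.alg,
      (show End l.1 from (a * b).1 l.1 l.1) =
        (show End l.1 from a.1 l.1 l.1) * (show End l.1 from b.1 l.1 l.1) :=
    fun a b => hC.mul_apply_self a.1 b.1 l.1
  refine ⟨(E.completeOrthogonalIdempotents_idemZero hG).idem l, ?_, ?_⟩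
  · intro h
    apply h0
    have := congrArg (fun a : DegreeZeroRing G.alg => a.1 l.1 l.1) h
    exact (AssocAlg.single_self k l.1 l.1 _).symm.trans this
  · intro f g hf hg hfg hgf h
    have e1 : E.e l.1 l.2 = (show End l.1 from f.1 l.1 l.1) + (show End l.1 from g.1 l.1 l.1) := by
      have := congrArg (fun a : DegreeZeroRing G.alg => a.1 l.1 l.1) h
      exact (AssocAlg.single_self k l.1 l.1 _).symm.trans this
    have hz : (show End l.1 from (0 : DegreeZeroRing G.alg).1 l.1 l.1) = 0 := rfl
    rcases hp (show End l.1 from f.1 l.1 l.1) (show End l.1 from g.1 l.1 l.1)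
      ((hmul f f).symm.trans (by rw [hf.eq])) ((hmul g g).symm.trans (by rw [hg.eq]))
      ((hmul f g).symm.trans (by rw [hfg]; rfl)) ((hmul g f).symm.trans (by rw [hgf]; rfl)) e1
      with h' | h'
    · exact Or.inl (key f g hfg hf h h')
    · exact Or.inr (key g f hgf hg (by rw [h, add_comm]) h')

theorem HasStandardFiltration.of_subsingleton (N : Type z) [AddCommGroup N]
    [Module (AssocAlg C) N] [Subsingleton N] : E.HasStandardFiltration k le N :=
  ⟨0, fun _ => ⊥, fun _ _ _ => le_rfl, rfl, Subsingleton.elim _ _, fun i hi => absurd hi (by omega)⟩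

theorem HasStandardFiltration.of_quotient {N : Type z} [AddCommGroup N]
    [Module (AssocAlg C) N] (W : Submodule (AssocAlg C) N) {m : E.Index}
    (e : W ≃ₗ[AssocAlg C] E.Standard k le m) (h : E.HasStandardFiltration k le (N ⧸ W)) :
    E.HasStandardFiltration k le N := by
  obtain ⟨n, F, hF, h0, hn, hq⟩ := h
  -- The pulled-back filtration starts at `W`, so indices shift by one to make room for `⊥`; the new
  -- first factor is `W` itself.
  let F' : ℕ → Submodule (AssocAlg C) N := fun i => Nat.casesOn i ⊥ fun i => (F i).comap W.mkQ
  have hF1 : F' 1 = W := by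
    change (F 0).comap W.mkQ = W
    rw [h0]
    exact W.ker_mkQ
  refine ⟨n + 1, F', monotone_nat_of_le_succ ?_, rfl, ?_, ?_⟩
  · intro i
    cases i with
    | zero => exact bot_le
    | succ i => exact Submodule.comap_mono (hF (Nat.le_succ i))
  · change (F n).comap W.mkQ = ⊤
    rw [hn, Submodule.comap_top]
  · intro i hi
    cases i with
    | zero =>
      have key : ∀ U V : Submodule (AssocAlg C) N, U = ⊥ → V = W →
          Nonempty ((V ⧸ U.submoduleOf V) ≃ₗ[AssocAlg C] E.Standard k le m) := by
        rintro _ V rfl rfl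
        have hb : (⊥ : Submodule (AssocAlg C) N).submoduleOf V = ⊥ := by
          rw [eq_bot_iff]
          exact fun x hx => Subtype.ext hx
        exact ⟨(Submodule.quotEquivOfEqBot _ hb).trans e⟩
      exact ⟨m, key _ _ rfl hF1⟩
    | succ i =>
      obtain ⟨m', ⟨e'⟩⟩ := hq i (by omega)
      refine ⟨m', ⟨?_⟩⟩
      let g : F' (i + 1 + 1) →ₗ[AssocAlg C] F (i + 1) := W.mkQ.restrict fun x hx => hx
      let g' := ((F i).submoduleOf (F (i + 1))).mkQ ∘ₗ g
      have hg' : Function.Surjective g' := by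
        refine (Submodule.mkQ_surjective _).comp ?_
        rintro ⟨y, hy⟩
        obtain ⟨x, rfl⟩ := W.mkQ_surjective y
        exact ⟨⟨x, hy⟩, rfl⟩
      have hk : (F' (i + 1)).submoduleOf (F' (i + 1 + 1)) = LinearMap.ker g' := by
        ext x
        rw [LinearMap.mem_ker]
        exact (Submodule.Quotient.mk_eq_zero ((F i).submoduleOf (F (i + 1))) (x := g x)).symm
      exact ((Submodule.quotEquivOfEq _ _ hk).trans (g'.quotKerEquivOfSurjective hg')).trans e'

/-- A nonzero finite-dimensional module which is projective in degree zero contains a standard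
module, with a quotient which is again projective in degree zero. -/
theorem exists_standard_submodule (hC : IsDirectedCategory k C le) (hG : G.IsGradedDirected)
    (N : Type z) [AddCommGroup N] [Module (AssocAlg C) N]
    [Module k N] [IsScalarTower k (AssocAlg C) N] [Module.Finite k N] [Nontrivial N]
    [Module.Projective (DegreeZeroRing G.alg) N] :
    ∃ (W : Submodule (AssocAlg C) N) (m : E.Index), W ≠ ⊥ ∧
      Nonempty (W ≃ₗ[AssocAlg C] E.Standard k le m) ∧
      Module.Projective (DegreeZeroRing G.alg) (N ⧸ W) := by
  let R := DegreeZeroRing G.alg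
  let u : C → AssocAlg C := fun x => AssocAlg.single k x x (𝟙 x)
  have hu : ∑ x, u x = 1 := AssocAlg.sum_single_id k
  have huu : ∀ x, u x * u x = u x := fun x =>
    (AssocAlg.single_mul_single k x _ _).trans (congrArg _ (Category.comp_id _))
  -- Elements of degree zero are diagonal, so identities of objects are central there. Hence `u y •
  -- N` is an `A_0`-summand of `N`.
  have hcomm : ∀ (r : R) x, u x * r.1 = r.1 * u x := by
    intro r x
    ext s t
    by_cases hs : x = s
    · subst hs
      by_cases ht : x = t
      · subst ht
        refine (AssocAlg.single_mul_apply k _ _ _).trans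
          (Eq.trans ?_ (AssocAlg.mul_single_apply k _ _ _).symm)
        rw [Category.comp_id, Category.id_comp]
      · refine (AssocAlg.single_mul_apply_of_ne k _ _ ht _).trans
          (Eq.trans ?_ (AssocAlg.mul_single_apply k _ _ _).symm)
        rw [hG.mem_alg_zero.1 r.2 _ _ ht, Limits.comp_zero]
    · refine Eq.trans ?_ (AssocAlg.mul_single_apply_of_ne k _ _ hs _).symm
      by_cases ht : x = t
      · subst ht
        refine (AssocAlg.single_mul_apply k _ _ _).trans ?_
        rw [hG.mem_alg_zero.1 r.2 _ _ (Ne.symm hs), Limits.zero_comp]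
      · exact AssocAlg.single_mul_apply_of_ne k _ _ ht _
  -- An object maximal in the support of `N`: every morphism leaving it for another object acts as
  -- zero on the part of `N` at `y`.
  obtain ⟨y, ⟨n₀, hn₀⟩, hy⟩ : ∃ y, (∃ n : N, u y • n ≠ 0) ∧
      ∀ z, z ≠ y → le y z → ∀ n : N, u z • n = 0 := by
    have hpo := hC.isPartialOrder
    let ord : PartialOrder C :=
      { le := le
        le_refl := refl_of le
        le_trans := fun _ _ _ => trans_of le
        le_antisymm := fun _ _ => antisymm_of le }
    have hne : {y | ∃ n : N, u y • n ≠ 0}.Nonempty := by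
      obtain ⟨n, hn⟩ := exists_ne (0 : N)
      by_contra h
      rw [Set.not_nonempty_iff_eq_empty, Set.eq_empty_iff_forall_notMem] at h
      apply hn
      rw [← one_smul (AssocAlg C) n, ← hu, Finset.sum_smul]
      exact Finset.sum_eq_zero fun x _ => not_not.1 fun hx => h x ⟨n, hx⟩
    obtain ⟨y, hy⟩ := (Set.toFinite {y | ∃ n : N, u y • n ≠ 0}).exists_maximal hne
    refine ⟨y, hy.1, fun z hz hyz n => ?_⟩
    by_contra h
    exact hz (antisymm_of le (hy.2 ⟨n, h⟩ hyz) hyz)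
  -- Insert `1 = ∑ u z` on the left of `a * u y`. The terms with `z ≠ y` act as zero, either by
  -- maximality of `y` or because there are no nonzero morphisms `y → z`; the remaining term sees
  -- only the diagonal entry of `a` at `y`.
  have hdiag : ∀ (a : AssocAlg C) (n : N), u y • n = n → a • n = (hG.diag hC a).1 • n := by
    intro a n hn
    rw [← hn, smul_smul, smul_smul, ← one_smul (AssocAlg C) ((a * u y) • n), ← hu,
      Finset.sum_smul, Finset.sum_eq_single y]
    · rw [smul_smul]
      congr 1
      rw [← hcomm]
      ext s t
      by_cases ht : y = t
      · subst ht
        refine (AssocAlg.single_mul_apply k _ _ _).trans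
          (Eq.trans ?_ (AssocAlg.single_mul_apply k _ _ _).symm)
        congr 1
        by_cases hs : y = s
        · subst hs
          refine (AssocAlg.mul_single_apply k _ _ _).trans ?_
          rw [Category.id_comp]
          exact (hG.diag_apply_self hC a y).symm
        · exact (AssocAlg.mul_single_apply_of_ne k _ _ hs _).trans
            (hG.diag_apply_of_ne hC a (Ne.symm hs)).symm
      · exact (AssocAlg.single_mul_apply_of_ne k _ _ ht _).trans
          (AssocAlg.single_mul_apply_of_ne k _ _ ht _).symm
    · intro z _ hz
      by_cases hyz : le y z
      · exact hy z hz hyz _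
      · rw [smul_smul]
        have h0 : u z * (a * u y) = 0 := by
          ext s t
          by_cases ht : z = t
          · subst ht
            refine (AssocAlg.single_mul_apply k _ _ _).trans ((Category.comp_id _).trans ?_)
            by_cases hs : y = s
            · subst hs
              refine (AssocAlg.mul_single_apply k _ _ _).trans ((Category.id_comp _).trans ?_)
              exact not_not.1 fun h => hyz (hC.le_of_ne_zero _ _ _ h)
            · exact AssocAlg.mul_single_apply_of_ne k _ _ hs _
          · exact AssocAlg.single_mul_apply_of_ne k _ _ ht _
        rw [h0, zero_smul]
    · simp
  let p : N →ₗ[R] N :=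
    { toFun := fun n => u y • n
      map_add' := smul_add _
      map_smul' := fun r n => by
        change u y • r.1 • n = r.1 • u y • n
        rw [smul_smul, smul_smul, hcomm] }
  let Q := LinearMap.range p
  have hp : ∀ q : Q, u y • q.1 = q.1 := by
    rintro ⟨_, n, rfl⟩
    exact (smul_smul _ _ _).trans (congrArg (fun t => t • n) (huu y))
  have : Module.Projective R Q := Module.Projective.of_split Q.subtype p.rangeRestrict
    (LinearMap.ext fun q => Subtype.ext (hp q))
  have : Nontrivial Q := ⟨⟨⟨_, n₀, rfl⟩, 0, fun h => hn₀ (congrArg Subtype.val h)⟩⟩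
  let : Algebra k R := DegreeZeroRing.algebra G.alg
  have : IsScalarTower k R N := ⟨fun c r n => smul_assoc c r.1 n⟩
  have := hC.finite_assocAlg
  have : Module.Finite k R :=
    Module.Finite.of_injective (SetLike.GradeZero.subalgebra G.alg).val.toLinearMap
      Subtype.val_injective
  have : IsArtinianRing R := isArtinian_of_tower k inferInstance
  have : Module.Finite R N := Module.Finite.of_restrictScalars_finite k R N
  have : Module.Finite R Q := Module.Finite.of_surjective p.rangeRestrict
    p.surjective_rangeRestrict
  -- The part of `N` at `y` is a nonzero finitely generated projective `A_0`-module, so it has a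
  -- summand `A_0 x` isomorphic to `A_0 e_m`. By `hdiag`, `A_0 x` is already the `A`-submodule
  -- generated by `x`.
  obtain ⟨m, x, f, hx, hf⟩ := exists_primitive_summand
    (E.completeOrthogonalIdempotents_idemZero hG)
    (E.isPrimitiveIdempotentElem_idemZero hC hG) Q
  have hfx : ∀ r : R, f (r • x) = r * E.idemZero hG m := fun r => by rw [map_smul, hf, smul_eq_mul]
  have hx' : E.idem k m • x.1 = x.1 := congrArg Subtype.val hx
  let W : Submodule (AssocAlg C) N := Submodule.span (AssocAlg C) {x.1}
  have hW : ∀ a : AssocAlg C, a • x.1 ∈ W := fun a =>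
    W.smul_mem a (Submodule.mem_span_singleton_self _)
  refine ⟨W, m, ?_, ?_, ?_⟩
  · intro h
    have h1 : x = 0 := Subtype.ext ((Submodule.mem_bot _).1 (h.le (Submodule.mem_span_singleton_self x.1)))
    apply (E.isPrimitiveIdempotentElem_idemZero hC hG m).2.1
    rw [← hf, h1, map_zero]
  · let g : E.proj k m →ₗ[AssocAlg C] W :=
      ((LinearMap.toSpanSingleton (AssocAlg C) N x.1).domRestrict (E.proj k m)).codRestrict W
        fun b => hW b
    have hg : Function.Surjective g := by
      rintro ⟨t, ht⟩
      obtain ⟨a, rfl⟩ := Submodule.mem_span_singleton.1 ht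
      refine ⟨⟨a * E.idem k m, Submodule.smul_mem _ a (E.idem_mem_proj k m)⟩, Subtype.ext ?_⟩
      exact (mul_smul _ _ _).trans (congrArg (fun t => a • t) hx')
    -- On both sides membership of `b` means that its entry at the object of `m` vanishes: `f` turns
    -- `b • x = 0` into `diag b * e_m = 0`.
    have hk : E.traceSum k le m = LinearMap.ker g := by
      ext b
      have h1 : b ∈ LinearMap.ker g ↔ hG.diag hC b • x = 0 := by
        rw [LinearMap.mem_ker, Subtype.ext_iff, Subtype.ext_iff]
        change b.1 • x.1 = 0 ↔ (hG.diag hC b).1 • x.1 = 0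
        rw [hdiag b.1 x.1 (hp x)]
      rw [h1, E.mem_traceSum k hC]
      constructor
      · intro h
        have h2 : hG.diag hC b = 0 := by
          refine Subtype.ext (AssocAlg.ext fun s t => ?_)
          by_cases hst : s = t
          · subst hst
            refine (hG.diag_apply_self hC _ s).trans ?_
            by_cases hs : m.1 = s
            · subst hs
              exact h
            · exact E.apply_of_mem_proj k b.2 hs s
          · exact hG.diag_apply_of_ne hC _ hst
        rw [h2, zero_smul]
      · intro h
        have h2 : hG.diag hC b * E.idemZero hG m = 0 := by rw [← hfx, h, map_zero]
        have h3 := congrArg (fun r : R => r.1 m.1 m.1) h2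
        refine Eq.trans ?_ h3
        conv_lhs => rw [← (E.mem_proj k).1 b.2]
        refine (hC.mul_apply_self _ _ _).trans (Eq.trans ?_ (hC.mul_apply_self _ _ _).symm)
        exact congrArg (fun t => E.idem k m m.1 m.1 ≫ t) (hG.diag_apply_self hC b.1 m.1).symm
    exact ⟨((Submodule.quotEquivOfEq _ _ hk).trans (g.quotKerEquivOfSurjective hg)).symm⟩
  -- Projecting to the part at `y`, applying `f` and multiplying into `x` is an `A_0`-linear
  -- retraction of `N` onto `W`, so the quotient is again projective over `A_0`.
  · let r : N →ₗ[R] W :=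
      { toFun := fun n => ⟨(f (p.rangeRestrict n)).1 • x.1, hW _⟩
        map_add' := fun n n' => Subtype.ext <| by
          rw [map_add, map_add]
          exact add_smul _ _ _
        map_smul' := fun c n => Subtype.ext <| by
          rw [map_smul, map_smul]
          exact mul_smul _ _ _ }
    refine Module.Projective.of_exact_of_retraction (i := W.subtype.restrictScalars R)
      (f := W.mkQ.restrictScalars R) (r := r) W.mkQ_surjective (fun n => ?_) ?_
    · have hn : W.mkQ n = 0 ↔ n ∈ W := by rw [← LinearMap.mem_ker, Submodule.ker_mkQ]
      refine hn.trans ⟨fun h => ⟨⟨n, h⟩, rfl⟩, ?_⟩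
      rintro ⟨t, rfl⟩
      exact t.2
    · rintro ⟨t, ht⟩
      obtain ⟨a, rfl⟩ := Submodule.mem_span_singleton.1 ht
      have h1 : p.rangeRestrict (a • x.1) = hG.diag hC a • x := by
        rw [hdiag a x.1 (hp x)]
        refine Subtype.ext ((p.map_smul (hG.diag hC a) x.1).trans ?_)
        exact congrArg (fun t => hG.diag hC a • t) (hp x)
      refine Subtype.ext ?_
      change (f (p.rangeRestrict (a • x.1))).1 • x.1 = a • x.1
      rw [h1, hfx, hdiag a x.1 (hp x)]
      exact (mul_smul _ _ _).trans (congrArg (fun t => (hG.diag hC a).1 • t) hx')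

/-- Each standard submodule split off by `exists_standard_submodule` is nonzero, so the dimension
drops and the process ends. The bound `d` carries the induction, since the module changes at each
step. -/
theorem hasStandardFiltration_of_projective (hC : IsDirectedCategory k C le)
    (hG : G.IsGradedDirected) (d : ℕ) (N : Type z) [AddCommGroup N] [Module (AssocAlg C) N]
    [Module k N] [IsScalarTower k (AssocAlg C) N] [Module.Finite k N]
    [Module.Projective (DegreeZeroRing G.alg) N] (hd : Module.finrank k N ≤ d) :
    E.HasStandardFiltration k le N := by
  induction d generalizing N with
  | zero =>
    have : Subsingleton N := Module.finrank_zero_iff.1 (Nat.le_zero.1 hd)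
    exact HasStandardFiltration.of_subsingleton E N
  | succ d ih =>
    rcases subsingleton_or_nontrivial N with hN | hN
    · exact HasStandardFiltration.of_subsingleton E N
    obtain ⟨W, m, hW, ⟨e⟩, hp⟩ := E.exists_standard_submodule hC hG N
    refine HasStandardFiltration.of_quotient E W e ?_
    have : Module.Finite k (N ⧸ W) :=
      Module.Finite.of_surjective (W.mkQ.restrictScalars k) W.mkQ_surjective
    refine ih (N ⧸ W) (Nat.lt_succ_iff.1 (lt_of_lt_of_le ?_ hd))
    rw [← (Submodule.Quotient.restrictScalarsEquiv k W).finrank_eq]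
    have h1 := (W.restrictScalars k).finrank_quotient_add_finrank
    have h2 : 0 < Module.finrank k (W.restrictScalars k) := by
      have : Nontrivial (W.restrictScalars k) := (Submodule.nontrivial_iff_ne_bot (p := W)).2 hW
      exact Module.finrank_pos
    omega

end PrimitiveSystem

/-- One direction holds because standard modules are projective over `A_0` and extensions preserve
this. The other works for any primitive system, as each `P_λ` is a summand of `A`. -/
theorem isStandardlyStratified_iff (hC : IsDirectedCategory k C le) (hG : G.IsGradedDirected) :
    IsStandardlyStratified k C le ↔ Module.Projective (DegreeZeroRing G.alg) (AssocAlg C) := by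
  constructor
  · rintro ⟨E, hE⟩
    exact E.projective_of_proj fun l => E.projective_of_hasStandardFiltration hC hG (hE l)
  · intro h
    obtain ⟨E⟩ := hC.nonempty_primitiveSystem
    refine ⟨E, fun l => ?_⟩
    have := E.proj_projective h l
    have := hC.finite_assocAlg
    have : Module.Finite k (E.proj k l) :=
      Module.Finite.of_injective ((E.proj k l).subtype.restrictScalars k) Subtype.val_injective
    exact E.hasStandardFiltration_of_projective hC hG _ (E.proj k l) le_rfl

/-! ### The subcategory with trivial endomorphisms -/

namespace EndReduced

/-- In degree zero only scalar multiples of identities survive, so the ring is a quotient of a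
finite product of copies of `k`. -/
theorem isSemisimpleRing_degreeZeroRing (hC : IsDirectedCategory k C le)
    (hG : G.IsGradedDirected) : IsSemisimpleRing (DegreeZeroRing (grading hC G).alg) := by
  let D := EndReduced hC
  have hmem : ∀ c : D → k, (∑ x : D, AssocAlg.single k x x (c x • 𝟙 x)) ∈ (grading hC G).alg 0 :=
    fun c => sum_mem fun x _ => (grading hC G).single_mem_alg
      (Submodule.smul_mem _ _ ((grading hC G).id_mem x))
  let f : (D → k) →+* DegreeZeroRing (grading hC G).alg :=
    { toFun := fun c => ⟨∑ x : D, AssocAlg.single k x x (c x • 𝟙 x), hmem c⟩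
      map_one' := Subtype.ext <| by
        simp only [Pi.one_apply, one_smul]
        exact AssocAlg.sum_single_id k
      map_mul' := fun c c' => Subtype.ext <| by
        change _ = (∑ x : D, AssocAlg.single k x x (c x • 𝟙 x)) *
          (∑ x : D, AssocAlg.single k x x (c' x • 𝟙 x))
        rw [Finset.sum_mul]
        refine Finset.sum_congr rfl fun x _ => ?_
        rw [Finset.mul_sum, Finset.sum_eq_single x]
        · rw [AssocAlg.single_mul_single]
          congr 1
          simp [smul_smul]
        · exact fun y _ hy => AssocAlg.single_mul_single_of_ne k hy _ _
        · simp
      map_zero' := Subtype.ext <| by simp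
      map_add' := fun c c' => Subtype.ext <| by
        change _ = (∑ x : D, AssocAlg.single k x x (c x • 𝟙 x)) +
          (∑ x : D, AssocAlg.single k x x (c' x • 𝟙 x))
        rw [← Finset.sum_add_distrib]
        refine Finset.sum_congr rfl fun x _ => ?_
        rw [Pi.add_apply, add_smul, map_add] }
  refine RingHom.isSemisimpleRing_of_surjective f ?_
  rintro ⟨a, ha⟩
  have h1 : ∀ x : D, ∃ c : k, c • 𝟙 x = a x x := by
    intro x
    obtain ⟨c, hc⟩ := Submodule.mem_span_singleton.1 ((reducedHom_self x.obj).le (a x x).2)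
    exact ⟨c, Subtype.ext hc⟩
  choose c hc using h1
  refine ⟨c, Subtype.ext ?_⟩
  change ∑ x : D, AssocAlg.single k x x (c x • 𝟙 x) = a
  conv_rhs => rw [← AssocAlg.sum_single k a]
  refine Finset.sum_congr rfl fun x _ => ?_
  rw [Finset.sum_eq_single x, hc]
  · intro y _ hy
    have h2 : (a x y).1 = 0 := (Submodule.mem_bot k).1
      ((hG.gr_zero_of_ne _ _ fun h => hy ((objEquiv hC).injective h.symm)).le (ha x y))
    rw [show a x y = 0 from Subtype.ext h2, map_zero]
  · simp

/-- All endomorphisms have degree zero, so elements of positive degree have zero diagonal entries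
and already lie in the subcategory. -/
theorem isPositivelyBijective_inclusion (hC : IsDirectedCategory k C le)
    (hG : G.IsGradedDirected) :
    IsPositivelyBijective G.alg (grading hC G).alg (inclusion hC) where
  map_mem := inclusion_mem hC G
  injective a b h := AssocAlg.ext fun x y =>
    Subtype.ext (congrFun (congrFun h x.obj) y.obj)
  exists_preimage i hi a ha := by
    have h : ∀ x y, a x y ∈ reducedHom k x y := by
      intro x y
      by_cases hxy : x = y
      · subst hxy
        rw [hG.apply_self_eq_zero hi ha]
        exact zero_mem _
      · rw [reducedHom_of_ne hxy]
        trivial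
    exact ⟨fun x y => ⟨a x.obj y.obj, h _ _⟩, fun x y => ha x.obj y.obj, rfl⟩

end EndReduced

end Directed

end

theorem theorem5p15 {k : Type u} [Field k] [IsAlgClosed k]
    {C : Type v} [Category.{w} C] [Preadditive C] [Linear k C] [Fintype C] [DecidableEq C]
    (le : C → C → Prop) (hC : IsDirectedCategory k C le)
    (G : CatGrading k C) (hG : G.IsGradedDirected)
    (hself : IsSelfInjective (DegreeZeroRing G.alg)) :
    (G.IsKoszul ↔
      IsStandardlyStratified k C le ∧ (EndReduced.grading hC G).IsClassicalKoszul) ∧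
    (G.IsKoszul →
      ∀ M : GrModule.{u, max v w, z} G.alg, M.LocallyFinite → M.GeneratedInDegree 0 →
        (M.IsKoszul ↔
          M.IsProjectiveOverDegreeZero ∧ (EndReduced.restrict hC G M).IsKoszul)) := by
  have hφ := EndReduced.isPositivelyBijective_inclusion hC hG
  have hss := EndReduced.isSemisimpleRing_degreeZeroRing hC hG
  have hA : ∀ i, Module.Finite k (G.alg i) := fun i => by
    have := hC.finite_assocAlg
    exact Module.Finite.of_injective (G.alg i).subtype Subtype.val_injective
  refine ⟨?_, fun hK M hlf _ => M.isKoszul_iff_restrict hφ hA hself hK hlf⟩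
  rw [isStandardlyStratified_iff hC hG]
  refine (isKoszulAlgebra_iff hφ hA hself).trans (and_congr_right' ?_)
  -- The classical sense adds only semisimplicity in degree zero, which always holds for the
  -- subcategory.
  exact ⟨fun h => ⟨hss, h⟩, fun h => h.2⟩
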